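/- Let $p=(p(n))_{n\in\mathbb N}$ be a probability distribution on $\mathbb N=\{0,1,2,\dots\}$ with mean $\sum_n n\,p(n)=1$ (critical) and with $0<p(0)<1$, $p(0)+p(1)<1$ (call a distribution with the latter two properties non-degenerate). Let $\mathcal A\subset\mathbb N$ satisfy $p(\mathcal A)=\sum_{n\in\mathcal A}p(n)>0$. Trees are rooted ordered trees, coded as sets of finite sequences of positive integers, in which every vertex $u$ has a finite number $k_u(\mathbf t)$ of children; they form the set $\mathbb T$, endowed with the local distance $d(\mathbf t,\mathbf t')=2^{-\sup\{h\in\mathbb N:\ r_h(\mathbf t)=r_h(\mathbf t')\}}$, where $r_h(\mathbf t)$ is the set of vertices of $\mathbf t$ of height at most $h$, and with its Borel $\sigma$-field. Write $|\mathbf t|$ for the number of vertices of $\mathbf t$, and $L_{\mathcal A}(\mathbf t)=\mathrm{Card}\{u\in\mathbf t:\ k_u(\mathbf t)\in\mathcal A\}$. A Galton–Watson (GW) tree with offspring distribution $q$ is a $\mathbb T$-valued random variable $\sigma$ such that the number of children of the root has law $q$ and, for $n\ge 1$, conditionally on this number being $n$, the $n$ sub-trees above the children of the root are independent and distributed as $\sigma$.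 The Kesten's tree $\tau^*$ associated to $p$ is the random tree whose individuals are normal or special and reproduce independently as follows: the root is special; a normal individual has only normal children, their number having law $p$; the number of children of a special individual has the size-biased law $p^*(n)=n\,p(n)/\sum_k k\,p(k)$, and one of these children, chosen uniformly at random, is special, the others being normal. Let $\tau$ be a GW tree with offspring distribution $p$ and $\tau^*$ a Kesten's tree associated to $p$. Then: 1. There is a critical non-degenerate distribution $p_{\mathcal A}$ on $\mathbb N$ such that, conditionally on $\{L_{\mathcal A}(\tau)>0\}$, $L_{\mathcal A}(\tau)$ is distributed as $|\tau_{\mathcal A}|$, where $\tau_{\mathcal A}$ is a GW tree with offspring distribution $p_{\mathcal A}$. 2. For every such $p_{\mathcal A}$, let $d_{\mathcal A}=\max\{k:\ p_{\mathcal A}(k\mathbb N)=1\}$ be its period. Then $\mathbb P(L_{\mathcal A}(\tau)\in[n,n+d_{\mathcal A}))>0$ for all $n$ large enough, and if $\tau_n$ is a random tree distributed as $\tau$ conditionally on $\{L_{\mathcal A}(\tau)\in[n,n+d_{\mathcal A})\}$ (for all $n$ for which this event has positive probability), then $\tau_n$ converges in distribution to $\tau^*$ as $n\to\infty$, with respect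 to the distance $d$. 3. For every $n$, $\mathbb P(L_{\mathcal A}(\tau)\ge n)>0$, and if $\tau_n$ is a random tree distributed as $\tau$ conditionally on $\{L_{\mathcal A}(\tau)\ge n\}$, then $\tau_n$ converges in distribution to $\tau^*$ as $n\to\infty$, with respect to the distance $d$. -/

import Mathlib

open MeasureTheory ProbabilityTheory Filter Topology
open scoped ENNReal

noncomputable section

/-! ### Ordered rooted trees in Neveu's formalism -/

/-- Finite sequences of positive integers; `[]` is the root and `u ++ [i]` is the `i`-th child
of `u`. -/
abbrev Node : Type := List ℕ+

/-- Ordered rooted trees all of whose vertices have finitely many children. The tree itself may be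
infinite. -/
@[ext] structure PlaneTree where
  /-- the set of vertices -/
  nodes : Set Node
  root_mem : [] ∈ nodes
  ancestor_mem : ∀ u v : Node, u ++ v ∈ nodes → u ∈ nodes
  exists_degree : ∀ u ∈ nodes, ∃ k : ℕ, ∀ i : ℕ+, u ++ [i] ∈ nodes ↔ (i : ℕ) ≤ k

namespace PlaneTree

/-- `k_u(t)`, the number of children of `u` in `t` (used for `u ∈ t` only). -/
def outDegree (t : PlaneTree) (u : Node) : ℕ := {i : ℕ+ | u ++ [i] ∈ t.nodes}.ncard

/-- `|t|`, the number of vertices of `t`, possibly infinite. -/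
def size (t : PlaneTree) : ℕ∞ := t.nodes.encard

/-- `L_A(t)`, the number of vertices of `t` whose out-degree belongs to `A`, possibly infinite. -/
def numDegreeIn (A : Set ℕ) (t : PlaneTree) : ℕ∞ := {u ∈ t.nodes | t.outDegree u ∈ A}.encard

/-- The sub-tree of `t` above a vertex `u` of `t`, re-rooted at `u`. -/
def subtreeAt (t : PlaneTree) (u : Node) (hu : u ∈ t.nodes) : PlaneTree where
  nodes := {v | u ++ v ∈ t.nodes}
  root_mem := by simpa using hu
  ancestor_mem v w h := t.ancestor_mem (u ++ v) w (by simpa using h)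
  exists_degree v hv := by simpa using t.exists_degree (u ++ v) hv

open Classical in
/-- The sub-tree of `t` above the `i`-th child of the root. The value `t` when the root has fewer
than `i` children is never used. -/
def childSubtree (i : ℕ+) (t : PlaneTree) : PlaneTree :=
  if h : [i] ∈ t.nodes then t.subtreeAt [i] h else t

/-- `r_h(t)`: the vertices of `t` at height at most `h`. -/
def restrict (h : ℕ) (t : PlaneTree) : Set Node := {u ∈ t.nodes | u.length ≤ h}

theorem restrict_mono {s t : PlaneTree} {g h : ℕ} (hgh : g ≤ h)
    (e : s.restrict h = t.restrict h) : s.restrict g = t.restrict g := by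
  ext u
  have := Set.ext_iff.1 e u
  simp only [restrict, Set.mem_ofPred_eq] at this ⊢
  constructor
  · exact fun ⟨a, b⟩ => ⟨(this.1 ⟨a, b.trans hgh⟩).1, b⟩
  · exact fun ⟨a, b⟩ => ⟨(this.2 ⟨a, b.trans hgh⟩).1, b⟩

theorem eq_of_restrict {s t : PlaneTree} (e : ∀ h, s.restrict h = t.restrict h) : s = t := by
  ext u
  have := Set.ext_iff.1 (e u.length) u
  simpa [restrict] using this

open Classical in
/-- The local distance `d(s, t) = 2 ^ (- sup {h : r_h(s) = r_h(t)})`, equal to `0` when `s = t`. -/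
def localDist (s t : PlaneTree) : ℝ :=
  if s = t then 0 else (1 / 2 : ℝ) ^ sSup {h : ℕ | s.restrict h = t.restrict h}

theorem localDist_le_iff (s t : PlaneTree) (h : ℕ) :
    localDist s t ≤ (1 / 2 : ℝ) ^ h ↔ s.restrict h = t.restrict h := by
  unfold localDist
  split_ifs with e
  · subst e; simp
  · obtain ⟨b, hb⟩ : ∃ b, s.restrict b ≠ t.restrict b := by
      by_contra! hc
      exact e (eq_of_restrict hc)
    have hbdd : BddAbove {h : ℕ | s.restrict h = t.restrict h} :=
      ⟨b, fun g hg => le_of_not_ge fun hbg => hb (restrict_mono hbg hg)⟩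
    have hne : {h : ℕ | s.restrict h = t.restrict h}.Nonempty := by
      refine ⟨0, ?_⟩
      ext u
      constructor <;> rintro ⟨-, hu⟩ <;>
        · rw [Nat.le_zero, List.length_eq_zero_iff] at hu
          subst hu
          exact ⟨root_mem _, by simp⟩
    rw [pow_le_pow_iff_right_of_lt_one₀ (by norm_num) (by norm_num)]
    constructor
    · exact fun hle => restrict_mono hle (Nat.sSup_mem hne hbdd)
    · exact fun hh => le_csSup hbdd hh

theorem localDist_cases (s t : PlaneTree) :
    localDist s t = 0 ∨ ∃ h : ℕ, localDist s t = (1 / 2 : ℝ) ^ h := by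
  unfold localDist
  split_ifs
  · exact Or.inl rfl
  · exact Or.inr ⟨_, rfl⟩

theorem localDist_nonneg (s t : PlaneTree) : 0 ≤ localDist s t := by
  unfold localDist
  split_ifs <;> positivity

theorem localDist_comm (s t : PlaneTree) : localDist s t = localDist t s := by
  have h2 : {h | s.restrict h = t.restrict h} = {h | t.restrict h = s.restrict h} :=
    Set.ext fun _ => eq_comm
  by_cases e : s = t
  · rw [e]
  · rw [localDist, localDist, if_neg e, if_neg (Ne.symm e), h2]

theorem eq_of_localDist_eq_zero {s t : PlaneTree} (h : localDist s t = 0) : s = t :=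
  eq_of_restrict fun g => (localDist_le_iff s t g).1 (by rw [h]; positivity)

theorem localDist_self (t : PlaneTree) : localDist t t = 0 := by simp [localDist]

theorem localDist_triangle (s t u : PlaneTree) :
    localDist s u ≤ localDist s t + localDist t u := by
  have hst := localDist_nonneg s t
  have htu := localDist_nonneg t u
  rcases localDist_cases s t with h1 | ⟨a, h1⟩
  · rw [eq_of_localDist_eq_zero h1, localDist_self]; linarith
  rcases localDist_cases t u with h2 | ⟨b, h2⟩
  · rw [← eq_of_localDist_eq_zero h2, localDist_self]; linarith
  have e1 := (localDist_le_iff s t a).1 h1.le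
  have e2 := (localDist_le_iff t u b).1 h2.le
  have e3 : localDist s u ≤ (1 / 2 : ℝ) ^ min a b :=
    (localDist_le_iff s u _).2
      ((restrict_mono (min_le_left a b) e1).trans (restrict_mono (min_le_right a b) e2))
  rcases min_choice a b with h | h <;> rw [h] at e3 <;> linarith

/-- The topology on trees is the topology of local convergence. -/
instance : MetricSpace PlaneTree where
  dist := localDist
  dist_self := localDist_self
  dist_comm := localDist_comm
  dist_triangle := localDist_triangle
  eq_of_dist_eq_zero := eq_of_localDist_eq_zero

instance : MeasurableSpace PlaneTree := borel PlaneTree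

instance : BorelSpace PlaneTree := ⟨rfl⟩

/-- The tree in which every vertex `u` has `k u` children. -/
def ofDegrees (k : Node → ℕ) : PlaneTree where
  nodes := {u | ∀ (v : Node) (i : ℕ+), v ++ [i] <+: u → (i : ℕ) ≤ k v}
  root_mem v i h := by simp at h
  ancestor_mem u w h v i hv := h v i (hv.trans (List.prefix_append u w))
  exists_degree u hu := by
    refine ⟨k u, fun i => ⟨fun h => h u i List.prefix_rfl, fun hi v j hv => ?_⟩⟩
    rcases List.prefix_concat_iff.1 hv with h | h
    · obtain ⟨rfl, hj⟩ := List.append_inj' h rfl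
      obtain rfl : j = i := by simpa using hj
      exact hi
    · exact hu v j h

end PlaneTree

/-! ### Offspring distributions and Galton-Watson trees -/

/-- The mean `∑ n p(n)` of a probability distribution on `ℕ`, possibly infinite. -/
def offspringMean (p : PMF ℕ) : ℝ≥0∞ := ∑' n : ℕ, (n : ℝ≥0∞) * p n

/-- `0 < p(0) < 1` and `p(0) + p(1) < 1`. -/
def IsNondegenerate (p : PMF ℕ) : Prop := 0 < p 0 ∧ p 0 < 1 ∧ p 0 + p 1 < 1

/-- The period: the largest `k` such that `p` is carried by the multiples of `k`. -/
def offspringPeriod (p : PMF ℕ) : ℕ := sSup {k : ℕ | p.toMeasure {n : ℕ | k ∣ n} = 1}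

/-- `τ` is a Galton-Watson tree with offspring distribution `p`: the number of children of the root
has law `p` and, conditionally on this number being `n ≥ 1`, the `n` sub-trees above the children of
the root are independent and distributed as `τ`. -/
structure IsGWTree (p : PMF ℕ) {Ω : Type*} [MeasurableSpace Ω] (τ : Ω → PlaneTree)
    (P : Measure Ω) : Prop where
  measurable : Measurable τ
  root_law : ∀ n : ℕ, P {ω | (τ ω).outDegree [] = n} = p n
  branching : ∀ n : ℕ, 1 ≤ n → P {ω | (τ ω).outDegree [] = n} ≠ 0 →
    iIndepFun (fun (i : Fin n) ω => (τ ω).childSubtree i.val.succPNat)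
      P[|{ω | (τ ω).outDegree [] = n}] ∧
    ∀ i : Fin n, IdentDistrib (fun ω => (τ ω).childSubtree i.val.succPNat) τ
      P[|{ω | (τ ω).outDegree [] = n}] P

/-! ### Kesten's tree -/

/-- The size-biased distribution `n p(n) / m`, where `m` is the mean of `p`. -/
def sizeBiased (p : PMF ℕ) (h0 : offspringMean p ≠ 0) (h1 : offspringMean p ≠ ∞) : PMF ℕ :=
  PMF.normalize (fun n : ℕ => (n : ℝ≥0∞) * p n)
    (show ∑' n : ℕ, (n : ℝ≥0∞) * p n ≠ 0 from h0) (show ∑' n : ℕ, (n : ℝ≥0∞) * p n ≠ ∞ from h1)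

/-- The offspring of a special individual: its number `n` of children, which is size-biased,
together with the rank of its special child, which is uniform on `{1, …, n}` given `n`. (The case
`n = 0` has probability zero.) -/
def specialOffspring (p : PMF ℕ) (h0 : offspringMean p ≠ 0) (h1 : offspringMean p ≠ ∞) :
    PMF (ℕ × ℕ) :=
  (sizeBiased p h0 h1).bind fun n =>
    if hn : 1 ≤ n then
      (PMF.uniformOfFinset (Finset.Icc 1 n) (Finset.nonempty_Icc.2 hn)).map fun i => (n, i)
    else PMF.pure (0, 0)

/-- The special individuals, when `I u` is the rank of the special child of `u` in case `u` is
special. All other individuals are normal. -/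
inductive IsSpecial (I : Node → ℕ) : Node → Prop
  | root : IsSpecial I []
  | child (u : Node) (i : ℕ+) : IsSpecial I u → (i : ℕ) = I u → IsSpecial I (u ++ [i])

open Classical in
/-- The tree in which an individual `u` has `(x u).1` children if it is normal, and has
`(x u).2.1` children, of which the one of rank `(x u).2.2` is special, if it is special. -/
def kestenTree (x : Node → ℕ × (ℕ × ℕ)) : PlaneTree :=
  PlaneTree.ofDegrees fun u =>
    if IsSpecial (fun v => (x v).2.2) u then (x u).2.1 else (x u).1

/-- The law of Kesten's tree: all the individuals reproduce independently, the normal ones according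
to `p` and the special ones according to `specialOffspring p`. -/
def kestenLaw (p : PMF ℕ) (h0 : offspringMean p ≠ 0) (h1 : offspringMean p ≠ ∞) :
    Measure PlaneTree :=
  (Measure.infinitePi fun _ : Node =>
    p.toMeasure.prod (specialOffspring p h0 h1).toMeasure).map kestenTree

/-- `τ` is a Kesten's tree associated to `p`. -/
structure IsKestenTree (p : PMF ℕ) (h0 : offspringMean p ≠ 0) (h1 : offspringMean p ≠ ∞)
    {Ω : Type*} [MeasurableSpace Ω] (τ : Ω → PlaneTree) (P : Measure Ω) : Prop where
  measurable : Measurable τ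
  law : P.map τ = kestenLaw p h0 h1

/-! ### Conditioning on the number of vertices with out-degree in `A` -/

/-- `q` is an offspring distribution `p_A` attached to the random tree `τ` and to `A`: it is
critical and non-degenerate and, conditionally on `L_A(τ) > 0`, the variable `L_A(τ)` has the law of
the total size of a Galton-Watson tree with offspring distribution `q`. -/
def IsReducedOffspring (A : Set ℕ) {Ω : Type*} [MeasurableSpace Ω] (τ : Ω → PlaneTree)
    (P : Measure Ω) (q : PMF ℕ) : Prop :=
  offspringMean q = 1 ∧ IsNondegenerate q ∧
    ∃ (Ω₁ : Type) (_ : MeasurableSpace Ω₁) (P₁ : Measure Ω₁) (σ : Ω₁ → PlaneTree),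
      IsProbabilityMeasure P₁ ∧ IsGWTree q σ P₁ ∧
      ∀ n : ℕ∞, P[|{ω | 0 < (τ ω).numDegreeIn A}] {ω | (τ ω).numDegreeIn A = n} =
        P₁ {ω | (σ ω).size = n}

/-- For every `n` such that the event `E n` has positive probability, `τₙ n` is distributed as `τ`
conditionally on `E n`. -/
def IsConditionedOn {Ω : Type*} [MeasurableSpace Ω] (τ : Ω → PlaneTree) (P : Measure Ω)
    (E : ℕ → Set Ω) {Ωₙ : ℕ → Type*} [∀ n, MeasurableSpace (Ωₙ n)]
    (τₙ : ∀ n, Ωₙ n → PlaneTree) (Pₙ : ∀ n, Measure (Ωₙ n)) : Prop :=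
  ∀ n, P (E n) ≠ 0 → IdentDistrib (τₙ n) τ (Pₙ n) P[|E n]

end

/-! ### Membership, degrees and sub-trees -/

namespace PlaneTree

/-! The generating function `G` of `L_A(τ)` satisfies `G(s) = s g_A(G(s)) + g_{Aᶜ}(G(s))`, where
`g_A` and `g_{Aᶜ}` are the generating functions of `p` restricted to `A` and to its complement. Put
`a = G(0)`, so that `g_{Aᶜ}(a) = a`, and substitute `G = a + (1 - a) x`. Solving for `s` turns the
equation into `x = s q(x)` with `q` a critical generating function (`exists_reduced_pmf`). The total
size of a Galton-Watson tree with offspring law `q` solves the same equation, which has one solution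
for `s < 1`; comparing coefficients gives the first assertion
(`IsGWTree.exists_isReducedOffspring`).

The analytic core is that the window probabilities `P(n ≤ L_A(τ) < n + d)` have ratio of consecutive
terms tending to `1`. By the first assertion this reduces to total sizes, and by the Otter-Dwass
formula (`mul_coeff_pow_eq`) to the probabilities `[X^n] q^(n+1)` of a random walk. Given the
position of the walk at time `N`, the probability that a prescribed step equals `k` is the
conditional mean proportion of such steps. That proportion is close to `q(k)` outside an
exponentially unlikely event (`abs_coeff_pow_sub_le`), while the conditioning event is not
exponentially unlikely, because the total size has infinite mean. Hence adding one step `k` barely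
changes the probability, and steps in the support generate all large multiples of the period `d`.

For the trees, let `t` have `z` vertices at height `h`. If `τ` agrees with `t` up to height `h`,
then `L_A(τ)` is a constant plus `z` independent copies of itself, and it is large in particular
when exactly one of the copies is large. So the probability that `τ` agrees with `t` and `L_A(τ)`
lies in a far window is asymptotically at least `z P(r_h(τ) = r_h(t))` times the window probability
(`IsGWTree.hasTailWeight_localBall`). The law of Kesten's tree gives the ball around `t` at most
that same factor, by a union bound over the possible spines (`kestenLaw_localBall_le`). Lower bounds
on balls suffice for weak convergence, since open sets are exhausted by disjoint balls
(`tendsto_of_forall_localBall`). Conditioning on `L_A(τ) ≥ n` follows by summing over consecutive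
windows. -/

theorem mem_nodes_iff_of_restrict_eq {s t : PlaneTree} {h : ℕ} (e : s.restrict h = t.restrict h)
    {u : Node} (hu : u.length ≤ h) : u ∈ s.nodes ↔ u ∈ t.nodes := by
  have := Set.ext_iff.1 e u
  simpa [restrict, hu] using this

theorem append_singleton_mem_iff (t : PlaneTree) (u : Node) (i : ℕ+) :
    u ++ [i] ∈ t.nodes ↔ (i : ℕ) ≤ t.outDegree u := by
  by_cases hu : u ∈ t.nodes
  · obtain ⟨k, hk⟩ := t.exists_degree u hu
    have : {i : ℕ+ | u ++ [i] ∈ t.nodes} = (Finset.range k).image Nat.succPNat := by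
      ext i
      simp only [Set.mem_ofPred_eq, hk, Finset.coe_image, Set.mem_image, Finset.coe_range,
        Set.mem_Iio]
      constructor
      · intro hi
        exact ⟨i.natPred, by have := i.natPred_add_one; omega, PNat.succPNat_natPred i⟩
      · rintro ⟨j, hj, rfl⟩
        simpa using hj
    rw [hk, outDegree, this, Set.ncard_coe_finset, Finset.card_image_of_injective _
      Nat.succPNat_injective, Finset.card_range]
  · have h1 : ∀ j : ℕ+, u ++ [j] ∉ t.nodes := fun j hj => hu (t.ancestor_mem u [j] hj)
    have h2 : t.outDegree u = 0 := by simp [outDegree, h1]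
    have := i.pos
    simp only [h1, h2, false_iff]
    omega

theorem singleton_mem_iff (t : PlaneTree) (i : ℕ+) : [i] ∈ t.nodes ↔ (i : ℕ) ≤ t.outDegree [] :=
  t.append_singleton_mem_iff [] i

theorem mem_childSubtree_iff (t : PlaneTree) (i : ℕ+) (u : Node) :
    u ∈ (t.childSubtree i).nodes ↔
      ([i] ∈ t.nodes ∧ i :: u ∈ t.nodes) ∨ ([i] ∉ t.nodes ∧ u ∈ t.nodes) := by
  unfold childSubtree
  split_ifs with h
  · simp [h, subtreeAt]
  · simp [h]

theorem cons_mem_iff (t : PlaneTree) (i : ℕ+) (u : Node) :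
    i :: u ∈ t.nodes ↔ (i : ℕ) ≤ t.outDegree [] ∧ u ∈ (t.childSubtree i).nodes := by
  rw [mem_childSubtree_iff, ← singleton_mem_iff]
  have : i :: u ∈ t.nodes → [i] ∈ t.nodes := fun h => t.ancestor_mem [i] u h
  tauto

theorem outDegree_childSubtree (t : PlaneTree) (i : ℕ+) (hi : (i : ℕ) ≤ t.outDegree []) (u : Node) :
    (t.childSubtree i).outDegree u = t.outDegree (i :: u) := by
  unfold outDegree
  congr 1
  ext j
  have := t.cons_mem_iff i (u ++ [j])
  simp only [Set.mem_ofPred_eq, List.cons_append]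
  tauto

theorem finite_restrict (h : ℕ) (t : PlaneTree) : (t.restrict h).Finite := by
  induction h with
  | zero =>
    refine (Set.finite_singleton ([] : Node)).subset fun u hu => ?_
    simpa using hu.2
  | succ h ih =>
    refine (ih.union (ih.biUnion fun u _ =>
      ((Finset.range (t.outDegree u)).finite_toSet.image fun j => u ++ [Nat.succPNat j]))).subset ?_
    rintro v ⟨hv, hl⟩
    rcases hl.lt_or_eq with hl | hl
    · exact Or.inl ⟨hv, by omega⟩
    · obtain ⟨u, i, rfl⟩ : ∃ u i, v = u ++ [i] := by
        rcases List.eq_nil_or_concat v with rfl | ⟨u, i, rfl⟩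
        · simp at hl
        · exact ⟨u, i, by simp⟩
      refine Or.inr (Set.mem_biUnion (x := u) ⟨t.ancestor_mem _ _ hv, ?_⟩ ?_)
      · simp at hl; omega
      · refine ⟨i.natPred, ?_, by simp⟩
        have := (t.append_singleton_mem_iff u i).1 hv
        have := i.natPred_add_one
        simp; omega

/-! ### Measurability -/

theorem isOpen_restrict_eq (h : ℕ) (t : PlaneTree) :
    IsOpen {s : PlaneTree | s.restrict h = t.restrict h} := by
  rw [Metric.isOpen_iff]
  intro s hs
  refine ⟨(1 / 2) ^ h, by positivity, fun r hr => ?_⟩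
  exact ((localDist_le_iff r s h).1 (le_of_lt hr)).trans hs

theorem exists_restrict_subset {U : Set PlaneTree} (hU : IsOpen U) {t : PlaneTree} (ht : t ∈ U) :
    ∃ h, {s : PlaneTree | s.restrict h = t.restrict h} ⊆ U := by
  obtain ⟨ε, hε, hb⟩ := Metric.isOpen_iff.1 hU t ht
  obtain ⟨h, hh⟩ := exists_pow_lt_of_lt_one hε (by norm_num : (1 / 2 : ℝ) < 1)
  exact ⟨h, fun s hs => hb (((localDist_le_iff s t h).2 hs).trans_lt hh)⟩

theorem measurableSet_mem_nodes (u : Node) : MeasurableSet {t : PlaneTree | u ∈ t.nodes} := by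
  refine IsOpen.measurableSet (isOpen_iff_forall_mem_open.2 fun t ht =>
    ⟨_, fun s hs => ?_, isOpen_restrict_eq u.length t, rfl⟩)
  exact (mem_nodes_iff_of_restrict_eq hs le_rfl).2 ht

/-- A truncation `r_h` takes its values in the countable set of finite sets of nodes, so every open
set is a countable union of balls, and a ball is a countable intersection of node events. -/
theorem measurable_of_nodes {α : Type*} [MeasurableSpace α] {f : α → PlaneTree}
    (hf : ∀ u, MeasurableSet {a | u ∈ (f a).nodes}) : Measurable f := by
  refine measurable_of_isOpen fun U hU => ?_
  have : f ⁻¹' U = ⋃ (h : ℕ) (F : Finset Node) (_ : {s : PlaneTree | s.restrict h = F} ⊆ U),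
      {a | ∀ u : Node, u ∈ (f a).restrict h ↔ u ∈ F} := by
    ext a
    simp only [Set.mem_preimage, Set.mem_iUnion, Set.mem_ofPred_eq, exists_prop]
    constructor
    · intro ha
      obtain ⟨h, hh⟩ := exists_restrict_subset hU ha
      refine ⟨h, (finite_restrict h (f a)).toFinset, ?_, ?_⟩
      · simpa using hh
      · simp
    · rintro ⟨h, F, hs, hF⟩
      exact hs (Set.ext fun u => by simpa using hF u)
  rw [this]
  refine .iUnion fun h => .iUnion fun F => .iUnion fun _ => ?_
  simp only [Set.ofPred_forall]
  refine .iInter fun u => ?_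
  have h1 : MeasurableSet {a | u ∈ (f a).restrict h} := by
    simp only [restrict, Set.ofPred_and]
    exact (hf u).inter (.const _)
  by_cases hu : u ∈ F
  · simpa [hu] using h1
  · simpa [hu, Set.compl_def] using h1.compl

theorem measurableSet_restrict_eq (h : ℕ) (t : PlaneTree) :
    MeasurableSet {s : PlaneTree | s.restrict h = t.restrict h} :=
  (isOpen_restrict_eq h t).measurableSet

theorem measurable_childSubtree (i : ℕ+) : Measurable (childSubtree i) := by
  refine measurable_of_nodes fun u => ?_
  simp only [mem_childSubtree_iff]
  exact ((measurableSet_mem_nodes _).inter (measurableSet_mem_nodes _)).union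
    ((measurableSet_mem_nodes _).compl.inter (measurableSet_mem_nodes _))

theorem measurable_outDegree (u : Node) : Measurable fun t : PlaneTree => t.outDegree u := by
  refine measurable_of_Ici fun n => ?_
  rcases n with _ | n
  · simp
  · convert measurableSet_mem_nodes (u ++ [Nat.succPNat n]) using 1
    ext t
    simp [append_singleton_mem_iff]

/-- Reaching the count `m` is witnessed by one of countably many finite sets of nodes. -/
theorem measurableSet_le_numDegreeIn (A : Set ℕ) (m : ℕ) :
    MeasurableSet {t : PlaneTree | (m : ℕ∞) ≤ t.numDegreeIn A} := by
  have : {t : PlaneTree | (m : ℕ∞) ≤ t.numDegreeIn A} =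
      ⋃ (F : Finset Node) (_ : F.card = m), ⋂ u ∈ F, {t | u ∈ t.nodes ∧ t.outDegree u ∈ A} := by
    ext t
    simp only [Set.mem_ofPred_eq, Set.mem_iUnion, Set.mem_iInter, numDegreeIn]
    constructor
    · intro h
      obtain ⟨F, hF, hc⟩ := Set.exists_subset_encard_eq h
      have hfin : F.Finite := Set.finite_of_encard_eq_coe hc
      refine ⟨hfin.toFinset, ?_, fun u hu => hF (by simpa using hu)⟩
      rw [hfin.encard_eq_coe_toFinset_card] at hc
      exact_mod_cast hc
    · rintro ⟨F, rfl, hF⟩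
      rw [← Set.encard_coe_eq_coe_finsetCard]
      exact Set.encard_le_encard fun u hu => hF u hu
  rw [this]
  refine .iUnion fun F => .iUnion fun _ => Finset.measurableSet_biInter _ fun u _ => ?_
  exact (measurableSet_mem_nodes u).inter
    (measurable_outDegree u (MeasurableSet.of_discrete (s := A)))

theorem measurable_numDegreeIn (A : Set ℕ) : Measurable fun t : PlaneTree => t.numDegreeIn A := by
  refine measurable_to_countable' fun m => ?_
  induction m using ENat.recTopCoe with
  | coe m =>
    convert (measurableSet_le_numDegreeIn A m).diff (measurableSet_le_numDegreeIn A (m + 1)) using 1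
    ext t
    simp only [Set.mem_preimage, Set.mem_singleton_iff, Set.mem_sdiff, Set.mem_ofPred_eq, not_le]
    push_cast
    rw [ENat.lt_add_one_iff (by simp), le_antisymm_iff, and_comm]
  | top =>
    convert MeasurableSet.iInter (measurableSet_le_numDegreeIn A) using 1
    ext t
    simp [ENat.eq_top_iff_forall_ge]

/-! ### Decomposition at the root -/

theorem size_eq_numDegreeIn_univ (t : PlaneTree) : t.size = t.numDegreeIn Set.univ := by
  simp [size, numDegreeIn]

-- The identity lives in `ℕ∞`, so it covers infinite trees. Children are indexed from `0` by `Fin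
-- n`, whence `succPNat` throughout.
open Classical in
theorem numDegreeIn_eq_add_sum (A : Set ℕ) (t : PlaneTree) {n : ℕ} (hn : t.outDegree [] = n) :
    t.numDegreeIn A = (if n ∈ A then 1 else 0) +
      ∑ i : Fin n, (t.childSubtree i.val.succPNat).numDegreeIn A := by
  subst hn
  have hdec : {u ∈ t.nodes | t.outDegree u ∈ A} =
      {u | u = [] ∧ t.outDegree [] ∈ A} ∪ ⋃ i : Fin (t.outDegree []), (List.cons i.val.succPNat) ''
        {u ∈ (t.childSubtree i.val.succPNat).nodes |
          (t.childSubtree i.val.succPNat).outDegree u ∈ A} := by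
    ext u
    rcases u with _ | ⟨j, u⟩
    · simp [t.root_mem]
    · simp only [Set.mem_ofPred_eq, cons_mem_iff, Set.mem_union, reduceCtorEq, false_and, false_or,
        Set.mem_iUnion, Set.mem_image, List.cons.injEq]
      constructor
      · rintro ⟨⟨hj, hu⟩, hA⟩
        have hj' := j.natPred_add_one
        refine ⟨⟨j.natPred, by omega⟩, u, ⟨?_, ?_⟩, ?_⟩
        · simpa using hu
        · simpa [outDegree_childSubtree t j hj] using hA
        · simp
      · rintro ⟨i, v, ⟨hv, hA⟩, rfl, rfl⟩
        have hi : ((i.val.succPNat : ℕ+) : ℕ) ≤ t.outDegree [] := by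
          simp
        rw [outDegree_childSubtree t _ hi] at hA
        exact ⟨⟨hi, hv⟩, hA⟩
  rw [numDegreeIn, hdec, Set.encard_union_eq, Set.encard_iUnion_of_finite,
    finsum_eq_sum_of_fintype]
  · congr 1
    · split_ifs with h <;> simp [h]
    · refine Finset.sum_congr rfl fun i _ => ?_
      rw [numDegreeIn, Function.Injective.encard_image]
      exact List.cons_injective
  · intro i j hij
    refine Set.disjoint_left.2 ?_
    rintro _ ⟨u, _, rfl⟩ ⟨v, _, hv⟩
    simp only [List.cons.injEq, Nat.succPNat_inj] at hv
    exact hij (Fin.ext hv.1.symm)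
  · refine Set.disjoint_left.2 ?_
    rintro _ ⟨rfl, _⟩ hv
    simp at hv

theorem restrict_zero (t : PlaneTree) : t.restrict 0 = {[]} := by
  ext u
  simp only [restrict, Nat.le_zero, List.length_eq_zero_iff, Set.mem_ofPred_eq,
    Set.mem_singleton_iff]
  exact ⟨fun h => h.2, fun h => ⟨h ▸ t.root_mem, h⟩⟩

theorem outDegree_root_eq_iff (s t : PlaneTree) :
    s.outDegree [] = t.outDegree [] ↔ s.restrict 1 = t.restrict 1 := by
  constructor
  · intro h
    ext u
    rcases u with _ | ⟨i, _ | ⟨j, u⟩⟩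
    · simp [restrict, root_mem]
    · simp [restrict, singleton_mem_iff, h]
    · simp [restrict]
  · intro h
    unfold outDegree
    congr 1
    ext i
    exact mem_nodes_iff_of_restrict_eq h (by simp)

/-- Balls split as products at the root; every induction on the height rests on this. -/
theorem restrict_succ_eq_iff (h : ℕ) (s t : PlaneTree) {n : ℕ} (hn : t.outDegree [] = n) :
    s.restrict (h + 1) = t.restrict (h + 1) ↔ s.outDegree [] = n ∧
      ∀ i : Fin n, (s.childSubtree i.val.succPNat).restrict h =
        (t.childSubtree i.val.succPNat).restrict h := by
  subst hn
  constructor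
  · intro e
    have h0 := (outDegree_root_eq_iff s t).2 (restrict_mono (by omega) e)
    refine ⟨h0, fun i => ?_⟩
    have hi : ((i.val.succPNat : ℕ+) : ℕ) ≤ t.outDegree [] := by simp
    ext u
    simp only [restrict, Set.mem_ofPred_eq, and_congr_left_iff]
    intro hu
    have := mem_nodes_iff_of_restrict_eq e (u := i.val.succPNat :: u) (by simpa using hu)
    simpa only [cons_mem_iff, hi, h0, true_and] using this
  · rintro ⟨h0, hi⟩
    ext u
    rcases u with _ | ⟨j, u⟩
    · simp [restrict, root_mem]
    · simp only [restrict, Set.mem_ofPred_eq, cons_mem_iff, h0, List.length_cons,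
        add_le_add_iff_right, and_congr_left_iff, and_congr_right_iff]
      intro hu hj
      have hj' := j.natPred_add_one
      have := mem_nodes_iff_of_restrict_eq (hi ⟨j.natPred, by omega⟩) hu
      simpa using this

end PlaneTree

/-! ### Power series with nonnegative summable coefficients -/

/-- The power series is the generating function of a finite measure on `ℕ`. -/
def IsMass (f : PowerSeries ℝ) : Prop :=
  (∀ n, 0 ≤ f.coeff n) ∧ Summable fun n => f.coeff n

/-- The sum of a power series at a real point. -/
noncomputable def genFun (f : PowerSeries ℝ) (s : ℝ) : ℝ := ∑' n, f.coeff n * s ^ n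

namespace IsMass

variable {f g : PowerSeries ℝ} {s : ℝ}

theorem summable_mul_pow (hf : IsMass f) (h0 : 0 ≤ s) (h1 : s ≤ 1) :
    Summable fun n => f.coeff n * s ^ n :=
  hf.2.of_nonneg_of_le (fun n => mul_nonneg (hf.1 n) (pow_nonneg h0 n))
    fun n => mul_le_of_le_one_right (hf.1 n) (pow_le_one₀ h0 h1)

theorem coeff_mul_mul_pow (f g : PowerSeries ℝ) (s : ℝ) (n : ℕ) : (f * g).coeff n * s ^ n =
    ∑ kl ∈ Finset.HasAntidiagonal.antidiagonal n,
      (f.coeff kl.1 * s ^ kl.1) * (g.coeff kl.2 * s ^ kl.2) := by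
  rw [PowerSeries.coeff_mul, Finset.sum_mul]
  refine Finset.sum_congr rfl fun kl hkl => ?_
  rw [← Finset.HasAntidiagonal.mem_antidiagonal.1 hkl, pow_add]
  ring

theorem coeff_mul_nonneg (hf : ∀ n, 0 ≤ f.coeff n) (hg : ∀ n, 0 ≤ g.coeff n) (n : ℕ) :
    0 ≤ (f * g).coeff n := by
  rw [PowerSeries.coeff_mul]
  exact Finset.sum_nonneg fun kl _ => mul_nonneg (hf _) (hg _)

theorem mul (hf : IsMass f) (hg : IsMass g) : IsMass (f * g) := by
  refine ⟨coeff_mul_nonneg hf.1 hg.1, ?_⟩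
  have := (summable_norm_sum_mul_antidiagonal_of_summable_norm hf.2.norm hg.2.norm).of_norm
  simpa only [PowerSeries.coeff_mul] using this

theorem genFun_mul (hf : IsMass f) (hg : IsMass g) (h0 : 0 ≤ s) (h1 : s ≤ 1) :
    genFun (f * g) s = genFun f s * genFun g s := by
  unfold genFun
  rw [tsum_mul_tsum_eq_tsum_sum_antidiagonal_of_summable_norm
    (hf.summable_mul_pow h0 h1).norm (hg.summable_mul_pow h0 h1).norm]
  exact tsum_congr fun n => coeff_mul_mul_pow f g s n

theorem one : IsMass 1 :=
  ⟨fun n => by rw [PowerSeries.coeff_one]; split_ifs <;> norm_num,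
    summable_of_ne_finset_zero (s := {0}) fun n hn => by
      rw [PowerSeries.coeff_one, if_neg (by simpa using hn)]⟩

theorem genFun_one (s : ℝ) : genFun 1 s = 1 := by
  unfold genFun
  rw [tsum_eq_single 0 fun n hn => by simp [PowerSeries.coeff_one, hn]]
  simp

theorem X : IsMass PowerSeries.X :=
  ⟨fun n => by rw [PowerSeries.coeff_X]; split_ifs <;> norm_num,
    summable_of_ne_finset_zero (s := {1}) fun n hn => by
      rw [PowerSeries.coeff_X, if_neg (by simpa using hn)]⟩

theorem pow (hf : IsMass f) (n : ℕ) : IsMass (f ^ n) := by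
  induction n with
  | zero => simpa using one
  | succ n ih => rw [pow_succ]; exact ih.mul hf

theorem genFun_pow (hf : IsMass f) (h0 : 0 ≤ s) (h1 : s ≤ 1) (n : ℕ) :
    genFun (f ^ n) s = genFun f s ^ n := by
  induction n with
  | zero => simpa using genFun_one s
  | succ n ih => rw [pow_succ, (hf.pow n).genFun_mul hf h0 h1, ih, pow_succ]

theorem prod {ι : Type*} (t : Finset ι) {f : ι → PowerSeries ℝ} (hf : ∀ i, IsMass (f i)) :
    IsMass (∏ i ∈ t, f i) := by
  classical
  induction t using Finset.induction_on with
  | empty => simpa using one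
  | insert i t hi ih => rw [Finset.prod_insert hi]; exact (hf i).mul ih

theorem genFun_nonneg (hf : IsMass f) (h0 : 0 ≤ s) : 0 ≤ genFun f s :=
  tsum_nonneg fun n => mul_nonneg (hf.1 n) (pow_nonneg h0 n)

theorem genFun_mono (hf : IsMass f) {t : ℝ} (h0 : 0 ≤ s) (h : s ≤ t) (h1 : t ≤ 1) :
    genFun f s ≤ genFun f t :=
  (hf.summable_mul_pow h0 (h.trans h1)).tsum_le_tsum
    (fun n => mul_le_mul_of_nonneg_left (pow_le_pow_left₀ h0 h n) (hf.1 n))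
    (hf.summable_mul_pow (h0.trans h) h1)

theorem coeff_mul_pow_le_genFun (hf : IsMass f) (h0 : 0 ≤ s) (h1 : s ≤ 1) (n : ℕ) :
    f.coeff n * s ^ n ≤ genFun f s :=
  (hf.summable_mul_pow h0 h1).le_tsum n fun m _ => mul_nonneg (hf.1 m) (pow_nonneg h0 m)

theorem coeff_le_genFun_one (hf : IsMass f) (n : ℕ) : f.coeff n ≤ genFun f 1 := by
  simpa using hf.coeff_mul_pow_le_genFun zero_le_one le_rfl n

end IsMass

/-- A power series with summable coefficients that vanishes on `(0, 1)` is zero. -/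
theorem eq_zero_of_tsum_mul_pow_eq_zero {c : ℕ → ℝ} (hc : Summable fun n => |c n|)
    (h : ∀ s : ℝ, 0 < s → s < 1 → ∑' n, c n * s ^ n = 0) (n : ℕ) : c n = 0 := by
  induction n using Nat.strong_induction_on with
  | _ N ih =>
  by_contra hN
  have hpos : 0 < |c N| := abs_pos.2 hN
  obtain ⟨K, hKdef⟩ : ∃ K, K = ∑' n, |c (n + (N + 1))| := ⟨_, rfl⟩
  have hs' : Summable fun n => |c (n + (N + 1))| :=
    (summable_nat_add_iff (f := fun n => |c n|) (N + 1)).2 hc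
  have hK : 0 ≤ K := hKdef ▸ tsum_nonneg fun _ => abs_nonneg _
  -- All earlier coefficients vanish, so `c N * s ^ N` is minus a tail of order `s ^ (N + 1)`.
  -- Letting `s` be small contradicts `c N ≠ 0`.
  have key : ∀ s : ℝ, 0 < s → s < 1 → |c N| ≤ s * K := by
    intro s h0 h1
    have hsum : Summable fun n => c n * s ^ n :=
      Summable.of_norm (hc.of_nonneg_of_le (fun _ => norm_nonneg _) fun n => by
        rw [norm_mul, Real.norm_eq_abs, Real.norm_eq_abs, abs_of_nonneg (pow_nonneg h0.le n)]
        exact mul_le_of_le_one_right (abs_nonneg _) (pow_le_one₀ h0.le h1.le))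
    have h2 := hsum.sum_add_tsum_nat_add (N + 1)
    rw [h s h0 h1, Finset.sum_range_succ, Finset.sum_eq_zero fun i hi => by
      rw [ih i (Finset.mem_range.1 hi), zero_mul], zero_add] at h2
    have h3 : |∑' n, c (n + (N + 1)) * s ^ (n + (N + 1))| ≤ s ^ (N + 1) * K := by
      rw [hKdef, ← tsum_mul_left, ← Real.norm_eq_abs]
      refine tsum_of_norm_bounded (hs'.mul_left _).hasSum fun n => ?_
      rw [norm_mul, Real.norm_eq_abs, Real.norm_eq_abs, abs_of_nonneg (pow_nonneg h0.le _),
        mul_comm]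
      exact mul_le_mul_of_nonneg_right
        (pow_le_pow_of_le_one h0.le h1.le (Nat.le_add_left _ _)) (abs_nonneg _)
    have h4 : |c N| * s ^ N ≤ (s * K) * s ^ N := by
      have : |c N * s ^ N| = |∑' n, c (n + (N + 1)) * s ^ (n + (N + 1))| := by
        rw [eq_neg_of_add_eq_zero_left h2, abs_neg]
      rw [abs_mul, abs_of_nonneg (pow_nonneg h0.le N)] at this
      rw [this]
      exact h3.trans (le_of_eq (by ring))
    exact le_of_mul_le_mul_right h4 (pow_pos h0 N)
  have hq : 0 < |c N| / (2 * (K + 1)) := div_pos hpos (by linarith)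
  have h5 := key (min (1 / 2) (|c N| / (2 * (K + 1)))) (lt_min (by norm_num) hq)
    ((min_le_left _ _).trans_lt (by norm_num))
  have h6 : min (1 / 2) (|c N| / (2 * (K + 1))) * K ≤ |c N| / (2 * (K + 1)) * (K + 1) :=
    mul_le_mul (min_le_right _ _) (by linarith) hK hq.le
  have h7 : |c N| / (2 * (K + 1)) * (K + 1) = |c N| / 2 := by
    have : K + 1 ≠ 0 := by linarith
    field_simp
  linarith

/-! ### The branching property -/

/-- The branching property without conditional probabilities. This form also covers `n = 0` and root
degrees of probability zero. -/
theorem IsGWTree.measure_children {p : PMF ℕ} {Ω : Type*} [MeasurableSpace Ω] {P : Measure Ω}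
    [IsProbabilityMeasure P] {τ : Ω → PlaneTree} (hτ : IsGWTree p τ P) (n : ℕ)
    {S : Fin n → Set PlaneTree} (hS : ∀ i, MeasurableSet (S i)) :
    P {ω | (τ ω).outDegree [] = n ∧ ∀ i : Fin n, (τ ω).childSubtree i.val.succPNat ∈ S i} =
      p n * ∏ i, P (τ ⁻¹' S i) := by
  have hE : MeasurableSet {ω | (τ ω).outDegree [] = n} :=
    hτ.measurable (PlaneTree.measurable_outDegree [] (measurableSet_singleton n))
  rcases Nat.eq_zero_or_pos n with rfl | hn
  · simp [hτ.root_law]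
  by_cases h0 : P {ω | (τ ω).outDegree [] = n} = 0
  · rw [← hτ.root_law n, h0, zero_mul]
    exact measure_mono_null (fun ω hω => hω.1) h0
  obtain ⟨hind, hid⟩ := hτ.branching n hn h0
  have h1 := hind.measure_inter_preimage_eq_mul (S := Finset.univ) (sets := S) fun i _ => hS i
  have h2 : ∀ i, P[|{ω | (τ ω).outDegree [] = n}]
      ((fun ω => (τ ω).childSubtree i.val.succPNat) ⁻¹' S i) = P (τ ⁻¹' S i) :=
    fun i => (hid i).measure_mem_eq (hS i)
  simp only [h2] at h1
  rw [← h1, ← hτ.root_law n, cond_apply hE, ← mul_assoc,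
    ENNReal.mul_inv_cancel h0 (measure_ne_top _ _), one_mul]
  congr 1
  ext ω
  simp

/-- The generating function of the law of `L_A(τ)` restricted to the event `τ ∈ S`. -/
noncomputable def treeSeries (A : Set ℕ) {Ω : Type*} [MeasurableSpace Ω] (τ : Ω → PlaneTree)
    (P : Measure Ω) (S : Set PlaneTree) : PowerSeries ℝ :=
  PowerSeries.mk fun m => P.real {ω | τ ω ∈ S ∧ (τ ω).numDegreeIn A = m}

theorem coeff_treeSeries (A : Set ℕ) {Ω : Type*} [MeasurableSpace Ω] (τ : Ω → PlaneTree)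
    (P : Measure Ω) (S : Set PlaneTree) (m : ℕ) : (treeSeries A τ P S).coeff m =
    P.real {ω | τ ω ∈ S ∧ (τ ω).numDegreeIn A = m} := PowerSeries.coeff_mk _ _

section treeSeries

variable (A : Set ℕ) {p : PMF ℕ} {Ω : Type*} [MeasurableSpace Ω] {P : Measure Ω}
  [IsProbabilityMeasure P] {τ : Ω → PlaneTree}

theorem measurableSet_numDegreeIn (hτ : Measurable τ) {S : Set PlaneTree} (hS : MeasurableSet S)
    (B : Set ℕ∞) : MeasurableSet {ω | τ ω ∈ S ∧ (τ ω).numDegreeIn A ∈ B} :=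
  (hτ hS).inter (hτ (PlaneTree.measurable_numDegreeIn A (MeasurableSet.of_discrete (s := B))))

theorem hasSum_treeSeries (hτ : Measurable τ) {S : Set PlaneTree} (hS : MeasurableSet S) :
    HasSum (fun m => (treeSeries A τ P S).coeff m)
      (P.real {ω | τ ω ∈ S ∧ (τ ω).numDegreeIn A ≠ ⊤}) := by
  have h : {ω | τ ω ∈ S ∧ (τ ω).numDegreeIn A ≠ ⊤} =
      ⋃ m : ℕ, {ω | τ ω ∈ S ∧ (τ ω).numDegreeIn A = m} := by
    ext ω
    simp only [Set.mem_ofPred_eq, Set.mem_iUnion, exists_and_left, ENat.ne_top_iff_exists]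
    simp only [eq_comm]
  simp only [coeff_treeSeries, h]
  have hd : Pairwise (Function.onFun Disjoint
      fun m : ℕ => {ω | τ ω ∈ S ∧ (τ ω).numDegreeIn A = m}) := fun i j hij =>
    Set.disjoint_left.2 fun ω h1 h2 => hij (by exact_mod_cast h1.2.symm.trans h2.2)
  have hU := measure_iUnion (μ := P) hd fun m => measurableSet_numDegreeIn A hτ hS {(m : ℕ∞)}
  rw [measureReal_def, hU, ENNReal.tsum_toReal_eq fun _ => measure_ne_top _ _]
  exact ENNReal.hasSum_toReal (hU ▸ measure_ne_top _ _)

theorem isMass_treeSeries (hτ : Measurable τ) {S : Set PlaneTree} (hS : MeasurableSet S) :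
    IsMass (treeSeries A τ P S) :=
  ⟨fun m => by rw [coeff_treeSeries]; exact measureReal_nonneg,
    (hasSum_treeSeries A hτ hS).summable⟩

theorem genFun_treeSeries_one (hτ : Measurable τ) {S : Set PlaneTree} (hS : MeasurableSet S) :
    genFun (treeSeries A τ P S) 1 = P.real {ω | τ ω ∈ S ∧ (τ ω).numDegreeIn A ≠ ⊤} := by
  simpa [genFun] using (hasSum_treeSeries A hτ hS).tsum_eq

-- Given the root degree, the counts of the children are independent and add up, so splitting `m`
-- among the children is exactly the coefficient formula for a product of series.
open Classical in
theorem IsGWTree.measureReal_children_numDegreeIn (hτ : IsGWTree p τ P) (n m : ℕ)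
    {S : Fin n → Set PlaneTree} (hS : ∀ i, MeasurableSet (S i)) :
    P.real {ω | ((τ ω).outDegree [] = n ∧
        ∀ i : Fin n, (τ ω).childSubtree i.val.succPNat ∈ S i) ∧
        (τ ω).numDegreeIn A = ((m + if n ∈ A then 1 else 0 : ℕ) : ℕ∞)} =
      (p n).toReal * (∏ i, treeSeries A τ P (S i)).coeff m := by
  have hS' : ∀ (l : Fin n →₀ ℕ) (i : Fin n),
      MeasurableSet {t : PlaneTree | t ∈ S i ∧ t.numDegreeIn A = l i} := fun l i =>
    measurableSet_numDegreeIn (τ := id) A measurable_id (hS i) {(l i : ℕ∞)}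
  have h : {ω | ((τ ω).outDegree [] = n ∧
        ∀ i : Fin n, (τ ω).childSubtree i.val.succPNat ∈ S i) ∧
        (τ ω).numDegreeIn A = ((m + if n ∈ A then 1 else 0 : ℕ) : ℕ∞)} =
      ⋃ l ∈ Finset.finsuppAntidiag (Finset.univ : Finset (Fin n)) m,
        {ω | (τ ω).outDegree [] = n ∧ ∀ i : Fin n, (τ ω).childSubtree i.val.succPNat ∈
          {t : PlaneTree | t ∈ S i ∧ t.numDegreeIn A = l i}} := by
    ext ω
    simp only [Set.mem_ofPred_eq, Set.mem_iUnion, Finset.mem_finsuppAntidiag, Finset.subset_univ,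
      and_true, exists_prop]
    constructor
    · rintro ⟨⟨h1, h2⟩, h3⟩
      rw [PlaneTree.numDegreeIn_eq_add_sum A _ h1, add_comm, Nat.cast_add] at h3
      have h4 : ∑ i : Fin n, ((τ ω).childSubtree i.val.succPNat).numDegreeIn A = m := by
        split_ifs at h3 <;> simpa using h3
      -- A finite total leaves no room for an infinite count in one child, so natural numbers `l i`
      -- can be extracted.
      have h5 : ∀ i : Fin n, ((τ ω).childSubtree i.val.succPNat).numDegreeIn A ≠ ⊤ := by
        intro i hi
        have := Finset.single_le_sum
          (f := fun i : Fin n => ((τ ω).childSubtree i.val.succPNat).numDegreeIn A)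
          (fun _ _ => zero_le) (Finset.mem_univ i)
        rw [h4, hi, top_le_iff] at this
        exact ENat.natCast_ne_top m this
      choose l hl using fun i => ENat.ne_top_iff_exists.1 (h5 i)
      refine ⟨Finsupp.equivFunOnFinite.symm l, ?_, h1, fun i => ⟨h2 i, ?_⟩⟩
      · simp only [← hl] at h4
        simpa using (by exact_mod_cast h4 : ∑ i, l i = m)
      · simp [hl]
    · rintro ⟨l, hl, h1, h2⟩
      refine ⟨⟨h1, fun i => (h2 i).1⟩, ?_⟩
      rw [PlaneTree.numDegreeIn_eq_add_sum A _ h1, Finset.sum_congr rfl fun i _ => (h2 i).2,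
        ← hl]
      push_cast
      rw [add_comm]
  rw [h, measureReal_biUnion_finset]
  · rw [PowerSeries.coeff_prod, Finset.mul_sum]
    refine Finset.sum_congr rfl fun l _ => ?_
    rw [measureReal_def, hτ.measure_children n (hS' l), ENNReal.toReal_mul, ENNReal.toReal_prod]
    simp only [coeff_treeSeries]
    rfl
  · intro l _ l' _ hne
    refine Set.disjoint_left.2 fun ω h1 h2 => hne ?_
    ext i
    exact_mod_cast (h1.2 i).2.symm.trans (h2.2 i).2
  · intro l _
    have : MeasurableSet {t : PlaneTree | t.outDegree [] = n ∧ ∀ i : Fin n,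
        t.childSubtree i.val.succPNat ∈ {t : PlaneTree | t ∈ S i ∧ t.numDegreeIn A = l i}} := by
      simp only [Set.ofPred_and, Set.ofPred_forall]
      exact (PlaneTree.measurable_outDegree [] (measurableSet_singleton n)).inter
        (.iInter fun i => PlaneTree.measurable_childSubtree _ (hS' l i))
    exact hτ.measurable this

end treeSeries

/-! ### The Otter-Dwass formula -/

section Dwass

open PowerSeries

variable {q B : PowerSeries ℝ}

theorem constantCoeff_of_eq_X_mul_subst (hB : B = X * q.subst B) : constantCoeff B = 0 := by
  rw [hB, ← coeff_zero_eq_constantCoeff_apply, coeff_zero_X_mul]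

theorem coeff_pow_eq_zero_of_lt (hB : constantCoeff B = 0) {n m : ℕ} (h : n < m) :
    coeff n (B ^ m) = 0 :=
  X_pow_dvd_iff.1 (pow_dvd_pow_of_dvd (X_dvd_iff.2 hB) m) n h

theorem coeff_subst_eq_sum (hB : constantCoeff B = 0) (f : PowerSeries ℝ) (n : ℕ) :
    coeff n (f.subst B) = ∑ d ∈ Finset.range (n + 1), coeff d f * coeff n (B ^ d) := by
  rw [coeff_subst' (HasSubst.of_constantCoeff_zero' hB)]
  simp only [smul_eq_mul]
  refine finsum_eq_sum_of_support_subset _ fun d hd => ?_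
  by_contra h
  refine hd ?_
  beta_reduce
  rw [coeff_pow_eq_zero_of_lt hB (by simpa using h), mul_zero]

theorem coeff_X_mul_derivative (f : PowerSeries ℝ) (n : ℕ) :
    coeff n (X * derivative ℝ f) = n * coeff n f := by
  rcases n with _ | n
  · simp
  · rw [coeff_succ_X_mul, coeff_derivative, mul_comm]
    push_cast
    rfl

/-- Coefficient `k` of `(m + n) X (q^m)' q^n = m X (q^(m+n))'`. -/
theorem sum_antidiagonal_coeff_pow (q : PowerSeries ℝ) (m n k : ℕ) :
    ((m + n : ℕ) : ℝ) * ∑ ij ∈ Finset.HasAntidiagonal.antidiagonal k,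
      (ij.1 * coeff ij.1 (q ^ m)) * coeff ij.2 (q ^ n) = m * (k * coeff k (q ^ (m + n))) := by
  have h : ((m + n : ℕ) : PowerSeries ℝ) * ((X * derivative ℝ (q ^ m)) * q ^ n) =
      (m : PowerSeries ℝ) * (X * derivative ℝ (q ^ (m + n))) := by
    rw [derivative_pow, derivative_pow]
    rcases m with _ | m
    · simp
    · rw [show m + 1 + n - 1 = m + n by omega, Nat.add_sub_cancel, pow_add]
      ring
  have h' := congrArg (coeff k) h
  rw [← map_natCast (C (R := ℝ)), ← map_natCast (C (R := ℝ)), coeff_C_mul, coeff_C_mul,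
    coeff_X_mul_derivative, coeff_mul] at h'
  simpa only [coeff_X_mul_derivative] using h'

/-- Lagrange inversion by induction on `n`. Since `B^m = X^m (q^m ∘ B)`, coefficient `n` of `B^m`
involves only coefficients `n - m` of powers of `B`; the induction hypothesis turns them into
coefficients of `q^(n-m)`, and `sum_antidiagonal_coeff_pow` evaluates the sum. -/
theorem mul_coeff_pow_eq (hB : B = X * q.subst B) (n m : ℕ) (hm : m ≤ n) :
    (n : ℝ) * coeff n (B ^ m) = m * coeff (n - m) (q ^ n) := by
  have hB0 := constantCoeff_of_eq_X_mul_subst hB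
  have hs : HasSubst B := HasSubst.of_constantCoeff_zero' hB0
  induction n using Nat.strong_induction_on generalizing m with
  | _ n ih =>
  rcases Nat.eq_zero_or_pos m with rfl | hm0
  · rcases Nat.eq_zero_or_pos n with rfl | hn
    · simp
    · simp [coeff_one, hn.ne']
  obtain ⟨k, rfl⟩ := Nat.exists_eq_add_of_le hm
  have h1 : coeff (m + k) (B ^ m) =
      ∑ d ∈ Finset.range (k + 1), coeff d (q ^ m) * coeff k (B ^ d) := by
    conv_lhs => rw [hB]
    rw [mul_pow, ← subst_pow hs, coeff_X_pow_mul', if_pos hm, Nat.add_sub_cancel_left,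
      coeff_subst_eq_sum hB0]
  rw [Nat.add_sub_cancel_left]
  rcases Nat.eq_zero_or_pos k with rfl | hk
  · rw [h1]
    simp
  · have h2 : (k : ℝ) * coeff (m + k) (B ^ m) =
        ∑ ij ∈ Finset.HasAntidiagonal.antidiagonal k,
          (ij.1 * coeff ij.1 (q ^ m)) * coeff ij.2 (q ^ k) := by
      rw [h1, Finset.mul_sum, Finset.Nat.sum_antidiagonal_eq_sum_range_succ
        (fun i j => ((i : ℝ) * coeff i (q ^ m)) * coeff j (q ^ k))]
      refine Finset.sum_congr rfl fun d hd => ?_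
      rw [mul_left_comm, ih k (by omega) d (by simpa [Nat.lt_succ_iff] using hd)]
      ring
    have h3 := sum_antidiagonal_coeff_pow q m k k
    rw [← h2] at h3
    have hk' : (k : ℝ) ≠ 0 := by positivity
    apply mul_left_cancel₀ hk'
    linarith

theorem succ_mul_coeff_succ (hB : B = X * q.subst B) (n : ℕ) :
    ((n + 1 : ℕ) : ℝ) * coeff (n + 1) B = coeff n (q ^ (n + 1)) := by
  simpa using mul_coeff_pow_eq hB (n + 1) 1 (by omega)

end Dwass

/-! ### A concentration estimate for the coefficients of powers -/

section Neveu

open PowerSeries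

theorem IsMass.C_mul {f : PowerSeries ℝ} (hf : IsMass f) {y : ℝ} (hy : 0 ≤ y) :
    IsMass (C y * f) :=
  ⟨fun n => by rw [coeff_C_mul]; exact mul_nonneg hy (hf.1 n), by
    simpa only [coeff_C_mul] using hf.2.mul_left y⟩

theorem IsMass.add {f g : PowerSeries ℝ} (hf : IsMass f) (hg : IsMass g) : IsMass (f + g) :=
  ⟨fun n => by rw [map_add]; exact add_nonneg (hf.1 n) (hg.1 n), by
    simpa only [map_add] using hf.2.add hg.2⟩

theorem IsMass.genFun_add {f g : PowerSeries ℝ} (hf : IsMass f) (hg : IsMass g) {s : ℝ}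
    (h0 : 0 ≤ s) (h1 : s ≤ 1) : genFun (f + g) s = genFun f s + genFun g s := by
  unfold genFun
  rw [← (hf.summable_mul_pow h0 h1).tsum_add (hg.summable_mul_pow h0 h1)]
  simp only [map_add, add_mul]

theorem genFun_C_mul (f : PowerSeries ℝ) (y s : ℝ) : genFun (C y * f) s = y * genFun f s := by
  unfold genFun
  rw [← tsum_mul_left]
  simp only [coeff_C_mul, mul_assoc]

theorem genFun_X_pow (k : ℕ) (s : ℝ) : genFun (X ^ k) s = s ^ k := by
  unfold genFun
  rw [tsum_eq_single k fun n hn => by simp [coeff_X_pow, hn]]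
  simp [coeff_X_pow]

/-- The two Chernoff bounds for a binomial variable, with exponential parameter `±ε/2`. From `|exp θ
- 1 - θ| ≤ θ²` each factor has exponent at most `-ε²/2 + ε²/4`. -/
theorem mul_exp_add_one_sub_pow_le {p ε : ℝ} (hp0 : 0 ≤ p) (hp1 : p ≤ 1) (hε0 : 0 ≤ ε)
    (hε1 : ε ≤ 1) (N : ℕ) :
    Real.exp (-(ε / 2 * ((p + ε) * N))) * (p * Real.exp (ε / 2) + (1 - p)) ^ N ≤
      Real.exp (-(ε ^ 2 / 4)) ^ N ∧
    Real.exp (ε / 2 * ((p - ε) * N)) * (p * Real.exp (-(ε / 2)) + (1 - p)) ^ N ≤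
      Real.exp (-(ε ^ 2 / 4)) ^ N := by
  have key : ∀ θ : ℝ, |θ| = ε / 2 → (p * Real.exp θ + (1 - p)) ≤
      Real.exp (p * θ + ε ^ 2 / 4) := by
    intro θ hθ
    have h1 := (abs_le.1 (Real.abs_exp_sub_one_sub_id_le (x := θ) (by rw [hθ]; linarith))).2
    have h2 : θ ^ 2 = ε ^ 2 / 4 := by rw [← sq_abs, hθ]; ring
    have h3 := Real.add_one_le_exp (p * θ + ε ^ 2 / 4)
    have h4 : p * (Real.exp θ - 1 - θ) ≤ 1 * (ε ^ 2 / 4) :=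
      (mul_le_mul_of_nonneg_left (h1.trans_eq h2) hp0).trans
        (mul_le_mul_of_nonneg_right hp1 (by positivity))
    linarith
  have key2 : ∀ θ a : ℝ, |θ| = ε / 2 → a + (p * θ + ε ^ 2 / 4) ≤ -(ε ^ 2 / 4) →
      Real.exp (a * N) * (p * Real.exp θ + (1 - p)) ^ N ≤ Real.exp (-(ε ^ 2 / 4)) ^ N := by
    intro θ a hθ ha
    rw [mul_comm a, Real.exp_nat_mul, ← mul_pow]
    refine pow_le_pow_left₀ (mul_nonneg (Real.exp_nonneg _)
      (add_nonneg (mul_nonneg hp0 (Real.exp_nonneg _)) (by linarith))) ?_ N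
    refine (mul_le_mul_of_nonneg_left (key θ hθ) (Real.exp_nonneg _)).trans ?_
    rw [← Real.exp_add]
    exact Real.exp_le_exp.2 ha
  constructor
  · have := key2 (ε / 2) (-(ε / 2 * (p + ε))) (abs_of_nonneg (by linarith)) (by nlinarith)
    convert this using 3
    ring
  · have := key2 (-(ε / 2)) (ε / 2 * (p - ε)) (by rw [abs_neg, abs_of_nonneg (by linarith)])
      (by nlinarith)
    convert this using 3
    ring

/-- For a walk with `N = n + 1` steps of law `q` ending at `l + k`, let `J` be the number of steps
equal to `k`. By exchangeability `N q(k) P(S_n = l) = E[J; S_N = l + k]`, and `J` deviates from `N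
q(k)` by more than `N ε` only with exponentially small probability. -/
theorem abs_coeff_pow_sub_le {q : PowerSeries ℝ} (hq : IsMass q) (h1 : genFun q 1 = 1) (k : ℕ)
    {ε : ℝ} (hε0 : 0 < ε) (hε1 : ε ≤ 1) (n l : ℕ) :
    |coeff k q * coeff l (q ^ n) - coeff k q * coeff (l + k) (q ^ (n + 1))| ≤
      ε * coeff (l + k) (q ^ (n + 1)) + 2 * Real.exp (-(ε ^ 2 / 4)) ^ (n + 1) := by
  obtain ⟨p, hp⟩ : ∃ p, p = coeff k q := ⟨_, rfl⟩
  obtain ⟨e, he⟩ : ∃ e, e = C p * (X : PowerSeries ℝ) ^ k := ⟨_, rfl⟩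
  obtain ⟨r, hr⟩ : ∃ r, r = q - e := ⟨_, rfl⟩
  obtain ⟨N, hN⟩ : ∃ N, N = n + 1 := ⟨_, rfl⟩
  have hp0 : 0 ≤ p := hp ▸ hq.1 k
  have hp1 : p ≤ 1 := hp ▸ h1 ▸ hq.coeff_le_genFun_one k
  have heM : IsMass e := he ▸ (IsMass.X.pow k).C_mul hp0
  have hqer : q = e + r := by rw [hr]; ring
  have hrM : IsMass r := by
    refine ⟨fun i => ?_, ?_⟩
    · rw [hr, map_sub, he, coeff_C_mul, coeff_X_pow]
      split_ifs with h
      · rw [h, ← hp]; simp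
      · simpa using hq.1 i
    · rw [hr]
      simpa only [map_sub] using hq.2.sub heM.2
  have hge : genFun e 1 = p := by rw [he, genFun_C_mul, genFun_X_pow, one_pow, mul_one]
  have hgr : genFun r 1 = 1 - p := by
    have := heM.genFun_add hrM zero_le_one le_rfl
    rw [← hqer, h1, hge] at this
    linarith
  -- `c j` is the probability that the walk ends at `l + k` with exactly `j` steps equal to `k`; a
  -- variable `y` marking those steps makes `c j` the coefficient of `y ^ j`.
  obtain ⟨c, hc⟩ : ∃ c : ℕ → ℝ,
    c = fun j => (N.choose j : ℝ) * coeff (l + k) (e ^ j * r ^ (N - j)) := ⟨_, rfl⟩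
  have hc0 : ∀ j, 0 ≤ c j := fun j => by
    rw [hc]
    exact mul_nonneg (Nat.cast_nonneg _) (((heM.pow j).mul (hrM.pow _)).1 _)
  have hy : ∀ y : ℝ, coeff (l + k) ((C y * e + r) ^ N) =
      ∑ j ∈ Finset.range (N + 1), y ^ j * c j := by
    intro y
    rw [add_pow, map_sum]
    refine Finset.sum_congr rfl fun j _ => ?_
    rw [hc, mul_pow, ← map_pow, ← map_natCast (C (R := ℝ)), mul_comm _ (C _), coeff_C_mul,
      mul_assoc, coeff_C_mul]
    ring
  have hyle : ∀ y : ℝ, 0 ≤ y →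
      ∑ j ∈ Finset.range (N + 1), y ^ j * c j ≤ (p * y + (1 - p)) ^ N := by
    intro y hy0
    rw [← hy]
    have hM : IsMass (C y * e + r) := (heM.C_mul hy0).add hrM
    refine ((hM.pow N).coeff_le_genFun_one _).trans (le_of_eq ?_)
    rw [hM.genFun_pow zero_le_one le_rfl, (heM.C_mul hy0).genFun_add hrM zero_le_one le_rfl,
      genFun_C_mul, hge, hgr, mul_comm p]
  have hA : coeff (l + k) (q ^ N) = ∑ j ∈ Finset.range (N + 1), c j := by
    simpa [← hqer] using hy 1
  -- Differentiating `(y e + r)^N` at `y = 1` gives this identity; here it is read off from `j *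
  -- choose N j = N * choose (N - 1) (j - 1)`.
  have hjc : (N : ℝ) * (p * coeff l (q ^ n)) = ∑ j ∈ Finset.range (N + 1), j * c j := by
    have h2 : (N : PowerSeries ℝ) * (e * q ^ n) = ∑ j ∈ Finset.range (N + 1),
        ((j * N.choose j : ℕ) : PowerSeries ℝ) * (e ^ j * r ^ (N - j)) := by
      rw [hN, Finset.sum_range_succ', hqer, add_pow, Finset.mul_sum, Finset.mul_sum]
      simp only [zero_mul, Nat.cast_zero, add_zero]
      refine Finset.sum_congr rfl fun j _ => ?_
      have := Nat.add_one_mul_choose_eq n j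
      rw [mul_comm ((n + 1).choose _)] at this
      rw [← this, Nat.add_sub_add_right]
      push_cast
      ring
    have h3 := congrArg (coeff (l + k)) h2
    rw [map_sum, ← map_natCast (C (R := ℝ)), coeff_C_mul, he, mul_assoc, coeff_C_mul,
      coeff_X_pow_mul', if_pos (by omega), Nat.add_sub_cancel] at h3
    rw [h3]
    refine Finset.sum_congr rfl fun j _ => ?_
    rw [← map_natCast (C (R := ℝ)), coeff_C_mul, hc, he]
    push_cast
    ring
  obtain ⟨E, hE⟩ : ∃ E, E = Real.exp (-(ε ^ 2 / 4)) ^ N := ⟨_, rfl⟩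
  have hNpos : (0 : ℝ) < N := by rw [hN]; positivity
  -- The two exponentials dominate the indicators of `j > (p + ε) N` and of `j < (p - ε) N`, where
  -- the deviation is only bounded by `N`.
  have hpt : ∀ j ∈ Finset.range (N + 1), |(j : ℝ) - N * p| * c j ≤
      N * (ε * c j + Real.exp (-(ε / 2 * ((p + ε) * N))) * (Real.exp (ε / 2) ^ j * c j) +
        Real.exp (ε / 2 * ((p - ε) * N)) * (Real.exp (-(ε / 2)) ^ j * c j)) := by
    intro j hj
    have hjN : (j : ℝ) ≤ N := by
      exact_mod_cast Nat.lt_succ_iff.1 (Finset.mem_range.1 hj)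
    have hj0 : (0 : ℝ) ≤ j := Nat.cast_nonneg j
    have e1 : Real.exp (-(ε / 2 * ((p + ε) * N))) * Real.exp (ε / 2) ^ j =
        Real.exp (ε / 2 * (j - (p + ε) * N)) := by
      rw [← Real.exp_nat_mul, ← Real.exp_add]
      ring_nf
    have e2 : Real.exp (ε / 2 * ((p - ε) * N)) * Real.exp (-(ε / 2)) ^ j =
        Real.exp (ε / 2 * ((p - ε) * N - j)) := by
      rw [← Real.exp_nat_mul, ← Real.exp_add]
      ring_nf
    rw [← mul_assoc (Real.exp _), ← mul_assoc (Real.exp _), e1, e2, ← add_mul, ← add_mul, ← mul_assoc]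
    refine mul_le_mul_of_nonneg_right ?_ (hc0 j)
    have p1 := Real.exp_pos (ε / 2 * (j - (p + ε) * N))
    have p2 := Real.exp_pos (ε / 2 * ((p - ε) * N - j))
    have hNp : 0 ≤ N * p ∧ N * p ≤ N := ⟨by positivity, mul_le_of_le_one_right hNpos.le hp1⟩
    rcases le_or_gt ((j : ℝ) - N * p) (N * ε) with ha | ha
    · rcases le_or_gt (N * p - j) (N * ε) with hb | hb
      · refine (abs_le.2 ⟨by linarith, ha⟩).trans (mul_le_mul_of_nonneg_left ?_ hNpos.le)
        linarith
      · have : 1 ≤ Real.exp (ε / 2 * ((p - ε) * N - j)) :=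
          Real.one_le_exp (mul_nonneg (by linarith) (by linarith))
        refine (abs_le.2 ⟨by linarith, by linarith⟩ : _ ≤ (N : ℝ)).trans
          (le_mul_of_one_le_right hNpos.le ?_)
        linarith
    · have : 1 ≤ Real.exp (ε / 2 * (j - (p + ε) * N)) :=
        Real.one_le_exp (mul_nonneg (by linarith) (by linarith))
      refine (abs_le.2 ⟨by linarith, by linarith⟩ : _ ≤ (N : ℝ)).trans
        (le_mul_of_one_le_right hNpos.le ?_)
      linarith
  have hsum : (N : ℝ) * |p * coeff l (q ^ n) - p * coeff (l + k) (q ^ N)| ≤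
      N * (ε * coeff (l + k) (q ^ N) + 2 * E) := by
    have h2 : (N : ℝ) * |p * coeff l (q ^ n) - p * coeff (l + k) (q ^ N)| =
        |∑ j ∈ Finset.range (N + 1), ((j : ℝ) - N * p) * c j| := by
      rw [← abs_of_pos hNpos, ← abs_mul, abs_of_pos hNpos, mul_sub, hjc, hA, ← mul_assoc,
        Finset.mul_sum, ← Finset.sum_sub_distrib]
      simp only [sub_mul]
    rw [h2]
    refine (Finset.abs_sum_le_sum_abs _ _).trans ?_
    simp only [abs_mul, abs_of_nonneg (hc0 _)]
    refine (Finset.sum_le_sum hpt).trans ?_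
    rw [← Finset.mul_sum, Finset.sum_add_distrib, Finset.sum_add_distrib, ← Finset.mul_sum,
      ← Finset.mul_sum, ← Finset.mul_sum, ← hA]
    refine mul_le_mul_of_nonneg_left ?_ hNpos.le
    obtain ⟨b1, b2⟩ := mul_exp_add_one_sub_pow_le hp0 hp1 hε0.le hε1 N
    have b3 := mul_le_mul_of_nonneg_left (hyle _ (Real.exp_nonneg (ε / 2)))
      (Real.exp_nonneg (-(ε / 2 * ((p + ε) * N))))
    have b4 := mul_le_mul_of_nonneg_left (hyle _ (Real.exp_nonneg (-(ε / 2))))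
      (Real.exp_nonneg (ε / 2 * ((p - ε) * N)))
    rw [← hE] at b1 b2
    linarith
  have := le_of_mul_le_mul_left hsum hNpos
  rwa [hE, hN, hp] at this

end Neveu

/-! ### The ratio limit theorem for the total size -/

section Ratio

open PowerSeries

variable {q B : PowerSeries ℝ}

theorem IsMass.coeff_mul_coeff_le {f g : PowerSeries ℝ} (hf : IsMass f) (hg : IsMass g)
    (i j : ℕ) : coeff i f * coeff j g ≤ coeff (i + j) (f * g) := by
  rw [coeff_mul]
  exact Finset.single_le_sum (f := fun ij : ℕ × ℕ => coeff ij.1 f * coeff ij.2 g)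
    (fun ij _ => mul_nonneg (hf.1 _) (hg.1 _))
    (Finset.HasAntidiagonal.mem_antidiagonal.2 (rfl : (i, j).1 + (i, j).2 = i + j))

theorem IsMass.coeff_pow_mul_coeff_pow_le (hq : IsMass q) (n m i j : ℕ) :
    coeff i (q ^ n) * coeff j (q ^ m) ≤ coeff (i + j) (q ^ (n + m)) := by
  rw [pow_add]
  exact (hq.pow n).coeff_mul_coeff_le (hq.pow m) i j

theorem coeff_zero_pow (q : PowerSeries ℝ) (n : ℕ) : coeff 0 (q ^ n) = coeff 0 q ^ n := by
  simp

/-- The support of the coefficients of a power series. -/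
def coeffSupport (q : PowerSeries ℝ) : Set ℕ := {k | coeff k q ≠ 0}

/-- A point `l` of the submonoid is reached with at most `l` positive steps, and steps equal to `0`
fill up the remaining time. -/
theorem IsMass.coeff_pow_pos (hq : IsMass q) (h0 : 0 < coeff 0 q) {l : ℕ}
    (hl : l ∈ AddSubmonoid.closure (coeffSupport q)) : ∀ n, l ≤ n → 0 < coeff l (q ^ n) := by
  induction hl using AddSubmonoid.closure_induction with
  | zero =>
    intro n _
    rw [coeff_zero_pow]
    positivity
  | mem k hk =>
    intro n hn
    have hk' : 0 < coeff k q := lt_of_le_of_ne (hq.1 k) (Ne.symm hk)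
    rcases n with _ | n
    · obtain rfl : k = 0 := by omega
      simp
    · have := hq.coeff_pow_mul_coeff_pow_le 1 n k 0
      rw [pow_one, coeff_zero_pow, add_zero, add_comm 1 n] at this
      exact lt_of_lt_of_le (by positivity) this
  | add x y _ _ hx hy =>
    intro n hn
    have := hq.coeff_pow_mul_coeff_pow_le x (n - x) x y
    rw [Nat.add_sub_cancel' (by omega)] at this
    exact lt_of_lt_of_le (mul_pos (hx x le_rfl) (hy (n - x) (by omega))) this

theorem setGcd_dvd_of_coeff_pow_ne_zero (n : ℕ) {l : ℕ} (h : coeff l (q ^ n) ≠ 0) :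
    Nat.setGcd (coeffSupport q) ∣ l := by
  induction n generalizing l with
  | zero =>
    rw [pow_zero, coeff_one] at h
    have : l = 0 := by
      by_contra hl
      simp [hl] at h
    simp [this]
  | succ n ih =>
    rw [pow_succ, coeff_mul] at h
    obtain ⟨ij, hij, hne⟩ := Finset.exists_ne_zero_of_sum_ne_zero h
    rw [← Finset.HasAntidiagonal.mem_antidiagonal.1 hij]
    exact dvd_add (ih (left_ne_zero_of_mul hne))
      (Nat.setGcd_dvd_of_mem (right_ne_zero_of_mul hne))

/-- Otherwise `[X^M] q^M` decays geometrically. Appending one step `k` and `k - 2` null steps leads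
from position `n` at time `n + 1` to position `n + k` at time `n + k`, so `n [X^n] B` would decay
geometrically too and be summable. -/
theorem exists_pow_le_coeff_pow_diag (hq : IsMass q) (h0 : 0 < coeff 0 q) {k : ℕ} (hk : 2 ≤ k)
    (hqk : coeff k q ≠ 0) (hB : B = X * q.subst B)
    (hsum : ¬ Summable fun n : ℕ => (n : ℝ) * coeff n B) {r : ℝ} (hr0 : 0 < r) (hr1 : r < 1) :
    ∃ M : ℕ, 1 ≤ M ∧ r ^ M ≤ coeff M (q ^ M) := by
  by_contra! hcon
  refine hsum ((summable_nat_add_iff (f := fun n : ℕ => (n : ℝ) * coeff n B) 1).1 ?_)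
  have hqk' : 0 < coeff k q := lt_of_le_of_ne (hq.1 k) (Ne.symm hqk)
  obtain ⟨c, hc⟩ : ∃ c, c = coeff k q * coeff 0 q ^ (k - 2) := ⟨_, rfl⟩
  have hc0 : 0 < c := by rw [hc]; positivity
  have hsummable : Summable fun n : ℕ => c⁻¹ * r ^ k * r ^ n :=
    (summable_geometric_of_lt_one hr0.le hr1).mul_left _
  refine hsummable.of_nonneg_of_le (fun n => ?_) fun n => ?_
  · rw [succ_mul_coeff_succ hB]
    exact (hq.pow _).1 _
  · rw [succ_mul_coeff_succ hB]
    have h1 := hq.coeff_pow_mul_coeff_pow_le 1 (k - 2) k 0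
    rw [pow_one, coeff_zero_pow, add_zero, ← hc] at h1
    have h2 := hq.coeff_pow_mul_coeff_pow_le (n + 1) (1 + (k - 2)) n k
    rw [show n + 1 + (1 + (k - 2)) = n + k by omega] at h2
    have h3 := hcon (n + k) (by omega)
    have h4 : coeff n (q ^ (n + 1)) * c ≤ r ^ (n + k) :=
      (mul_le_mul_of_nonneg_left h1 ((hq.pow _).1 _)).trans (h2.trans h3.le)
    rw [mul_assoc, ← pow_add, add_comm k n, ← div_eq_inv_mul]
    exact (le_div_iff₀ hc0).2 h4

theorem exists_pos_le_of_pos (f : ℕ → ℝ) (K : ℕ) :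
    ∃ δ : ℝ, 0 < δ ∧ ∀ i < K, 0 < f i → δ ≤ f i := by
  induction K with
  | zero => exact ⟨1, one_pos, fun i hi => by omega⟩
  | succ K ih =>
    obtain ⟨δ, hδ, h⟩ := ih
    by_cases hK : 0 < f K
    · refine ⟨min δ (f K), lt_min hδ hK, fun i hi hf => ?_⟩
      rcases Nat.lt_succ_iff_lt_or_eq.1 hi with h' | rfl
      · exact (min_le_left _ _).trans (h i h' hf)
      · exact min_le_right _ _
    · refine ⟨δ, hδ, fun i hi hf => ?_⟩
      rcases Nat.lt_succ_iff_lt_or_eq.1 hi with h' | rfl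
      · exact h i h' hf
      · exact absurd hf hK

/-- The standing assumptions on an offspring generating function and on the generating function
of the total size. -/
structure IsCriticalPair (q B : PowerSeries ℝ) : Prop where
  mass : IsMass q
  genFun_one : genFun q 1 = 1
  zero_pos : 0 < coeff 0 q
  exists_two_le : ∃ k, 2 ≤ k ∧ coeff k q ≠ 0
  eq_subst : B = X * q.subst B
  not_summable : ¬ Summable fun n : ℕ => (n : ℝ) * coeff n B

namespace IsCriticalPair

theorem setGcd_pos (h : IsCriticalPair q B) : 0 < Nat.setGcd (coeffSupport q) := by
  obtain ⟨k, hk, hqk⟩ := h.exists_two_le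
  exact Nat.pos_of_dvd_of_pos (Nat.setGcd_dvd_of_mem (s := coeffSupport q) hqk) (by omega)

theorem exists_forall_mem_closure (q : PowerSeries ℝ) :
    ∃ L, ∀ l, L ≤ l → Nat.setGcd (coeffSupport q) ∣ l →
    l ∈ AddSubmonoid.closure (coeffSupport q) :=
  Nat.exists_mem_closure_of_ge (coeffSupport q)

theorem eventually_coeff_pow_pos (h : IsCriticalPair q B) :
    ∀ᶠ m : ℕ in atTop, 0 < coeff (Nat.setGcd (coeffSupport q) * m)
      (q ^ (Nat.setGcd (coeffSupport q) * m + 1)) := by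
  obtain ⟨L, hL⟩ := exists_forall_mem_closure q
  filter_upwards [eventually_ge_atTop L] with m hm
  exact h.mass.coeff_pow_pos h.zero_pos (hL _ (hm.trans (Nat.le_mul_of_pos_left m h.setGcd_pos))
    (dvd_mul_right _ _)) _ (Nat.le_succ _)

/-- One good diagonal coefficient propagates by supermultiplicativity: `j` blocks of length `M`
followed by a remainder from a bounded range. With `s = √r`, one factor `s ^ n` pays for the blocks
and the other for the remainder. -/
theorem eventually_pow_le_coeff_pow (h : IsCriticalPair q B) {r : ℝ} (hr0 : 0 < r)
    (hr1 : r < 1) : ∀ᶠ m : ℕ in atTop, r ^ (Nat.setGcd (coeffSupport q) * m) ≤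
      coeff (Nat.setGcd (coeffSupport q) * m) (q ^ (Nat.setGcd (coeffSupport q) * m + 1)) := by
  obtain ⟨d, hd⟩ : ∃ d, d = Nat.setGcd (coeffSupport q) := ⟨_, rfl⟩
  have hd0 : 0 < d := hd ▸ h.setGcd_pos
  rw [← hd]
  obtain ⟨k, hk, hqk⟩ := h.exists_two_le
  obtain ⟨s, hs⟩ : ∃ s, s = √r := ⟨_, rfl⟩
  have hs0 : 0 < s := hs ▸ Real.sqrt_pos.2 hr0
  have hs1 : s < 1 := by rw [hs, Real.sqrt_lt' one_pos]; simpa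
  have hss : s * s = r := hs ▸ Real.mul_self_sqrt hr0.le
  obtain ⟨M, hM1, hM⟩ := exists_pow_le_coeff_pow_diag h.mass h.zero_pos hk hqk h.eq_subst
    h.not_summable hs0 hs1
  have hdM : d ∣ M := hd ▸ setGcd_dvd_of_coeff_pow_ne_zero M
    ((lt_of_lt_of_le (pow_pos hs0 M) hM).ne')
  obtain ⟨L, hL⟩ := exists_forall_mem_closure q
  rw [← hd] at hL
  -- Remainders are kept in `[L, L + M)`: above `L` multiples of `d` have positive coefficient, and
  -- a bounded range gives a uniform lower bound `δ`.
  obtain ⟨δ, hδ0, hδ⟩ := exists_pos_le_of_pos (fun i => coeff i (q ^ (i + 1))) (L + M)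
  have hMj : ∀ j : ℕ, s ^ (j * M) ≤ coeff (j * M) (q ^ (j * M)) := by
    intro j
    induction j with
    | zero => simp
    | succ j ih =>
      rw [Nat.succ_mul, pow_add]
      exact (mul_le_mul ih hM (by positivity) ((h.mass.pow _).1 _)).trans
        (h.mass.coeff_pow_mul_coeff_pow_le _ _ _ _)
  have hev : ∀ᶠ n : ℕ in atTop, s ^ n ≤ δ :=
    ((tendsto_pow_atTop_nhds_zero_of_lt_one hs0.le hs1).eventually_lt_const hδ0).mono
      fun _ => le_of_lt
  have htend : Tendsto (fun m : ℕ => d * m) atTop atTop :=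
    tendsto_id.const_mul_atTop' hd0
  filter_upwards [htend.eventually hev, htend.eventually (eventually_ge_atTop L)] with m h1 h2
  obtain ⟨n, hn⟩ : ∃ n, n = d * m := ⟨_, rfl⟩
  rw [← hn] at h1 h2 ⊢
  have hdn : d ∣ n := ⟨m, hn⟩
  obtain ⟨j, i, hij, hi0, hi1⟩ : ∃ j i, j * M + i = n ∧ L ≤ i ∧ i < L + M := by
    refine ⟨(n - L) / M, L + (n - L) % M, ?_, by omega, ?_⟩
    · have := Nat.div_add_mod (n - L) M
      rw [mul_comm M] at this
      omega
    · have := Nat.mod_lt (n - L) (by omega : 0 < M)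
      omega
  have hdi : d ∣ i := (Nat.dvd_add_right (hdM.mul_left j)).1 (hij ▸ hdn)
  have hipos := h.mass.coeff_pow_pos h.zero_pos (hL i hi0 hdi) (i + 1) (by omega)
  have h3 := h.mass.coeff_pow_mul_coeff_pow_le (j * M) (i + 1) (j * M) i
  rw [← add_assoc, hij] at h3
  refine le_trans ?_ h3
  rw [← hss, mul_pow]
  refine mul_le_mul ((pow_le_pow_of_le_one hs0.le hs1.le (by omega)).trans (hMj j))
    (h1.trans (hδ i hi1 hipos)) (by positivity) ((h.mass.pow _).1 _)

/-- This makes the exponential error of `abs_coeff_pow_sub_le` negligible. Applying the lower bound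
to `√r` leaves a spare factor `√r ^ n`. -/
theorem tendsto_pow_div_coeff_pow (h : IsCriticalPair q B) {r : ℝ} (hr0 : 0 < r)
    (hr1 : r < 1) : Tendsto (fun m : ℕ => r ^ (Nat.setGcd (coeffSupport q) * m) /
      coeff (Nat.setGcd (coeffSupport q) * m) (q ^ (Nat.setGcd (coeffSupport q) * m + 1)))
      atTop (𝓝 0) := by
  obtain ⟨s, hs⟩ : ∃ s, s = √r := ⟨_, rfl⟩
  have hs0 : 0 < s := hs ▸ Real.sqrt_pos.2 hr0
  have hs1 : s < 1 := by rw [hs, Real.sqrt_lt' one_pos]; simpa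
  have hss : s * s = r := hs ▸ Real.mul_self_sqrt hr0.le
  have htend : Tendsto (fun m : ℕ => Nat.setGcd (coeffSupport q) * m) atTop atTop :=
    tendsto_id.const_mul_atTop' h.setGcd_pos
  refine squeeze_zero' (.of_forall fun m => ?_) ?_
    ((tendsto_pow_atTop_nhds_zero_of_lt_one hs0.le hs1).comp htend)
  · exact div_nonneg (by positivity) ((h.mass.pow _).1 _)
  · filter_upwards [h.eventually_pow_le_coeff_pow hs0 hs1, h.eventually_coeff_pow_pos]
      with m hm hpos
    rw [div_le_iff₀ hpos, ← hss, mul_pow]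
    exact mul_le_mul_of_nonneg_left hm (by positivity)

theorem tendsto_one_of_abs_sub_le {u v : ℕ → ℝ} (hu : Tendsto u atTop (𝓝 1))
    (huv : ∀ ε : ℝ, 0 < ε → ∀ᶠ m in atTop, |u m - v m| ≤ ε * v m + ε) :
    Tendsto v atTop (𝓝 1) := by
  rw [Metric.tendsto_atTop'] at hu ⊢
  intro ε hε
  -- With `η ≤ 1/2` the inequality bounds `v` by `4`; then `|u - v| ≤ 5 η ≤ ε / 2`.
  obtain ⟨η, hη⟩ : ∃ η, η = min (1 / 2) (ε / 10) := ⟨_, rfl⟩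
  have hη0 : 0 < η := by rw [hη]; positivity
  have hη1 : η ≤ 1 / 2 := hη ▸ min_le_left _ _
  have hη2 : η ≤ ε / 10 := hη ▸ min_le_right _ _
  obtain ⟨N1, h1⟩ := hu η hη0
  obtain ⟨N2, h2⟩ := eventually_atTop.1 (huv η hη0)
  refine ⟨max N1 N2, fun n hn => ?_⟩
  have a1 := h1 n (lt_of_le_of_lt (le_max_left _ _) hn)
  have a2 := abs_le.1 (h2 n ((le_max_right _ _).trans hn.le))
  rw [Real.dist_eq, abs_lt] at a1 ⊢
  have a3 : v n ≤ 4 := by nlinarith [a1.1, a1.2, a2.1, a2.2]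
  have a4 : η * v n ≤ η * 4 := mul_le_mul_of_nonneg_left a3 hη0.le
  constructor <;> linarith [a1.1, a1.2, a2.1, a2.2]

/-- One more step, of size `k` in the support, does not change the probability asymptotically:
`abs_coeff_pow_sub_le` divided by the reference coefficient. -/
theorem tendsto_coeff_pow_shift_step (h : IsCriticalPair q B) {k : ℕ} (hk : coeff k q ≠ 0)
    (i e : ℕ) (hie : Tendsto (fun m : ℕ =>
      coeff (Nat.setGcd (coeffSupport q) * m + e)
        (q ^ (Nat.setGcd (coeffSupport q) * m + 1 + i)) /
      coeff (Nat.setGcd (coeffSupport q) * m) (q ^ (Nat.setGcd (coeffSupport q) * m + 1)))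
      atTop (𝓝 1)) :
    Tendsto (fun m : ℕ => coeff (Nat.setGcd (coeffSupport q) * m + (e + k))
        (q ^ (Nat.setGcd (coeffSupport q) * m + 1 + (i + 1))) /
      coeff (Nat.setGcd (coeffSupport q) * m) (q ^ (Nat.setGcd (coeffSupport q) * m + 1)))
      atTop (𝓝 1) := by
  refine tendsto_one_of_abs_sub_le hie fun ε hε => ?_
  have hk' : 0 < coeff k q := lt_of_le_of_ne (h.mass.1 k) (Ne.symm hk)
  -- The concentration estimate carries a factor `coeff k q` on its left side; it is absorbed into
  -- the choice of `η`.
  obtain ⟨η, hη⟩ : ∃ η, η = min 1 (ε * coeff k q) := ⟨_, rfl⟩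
  have hη0 : 0 < η := by rw [hη]; positivity
  have hη1 : η ≤ 1 := hη ▸ min_le_left _ _
  have hη2 : η ≤ ε * coeff k q := hη ▸ min_le_right _ _
  obtain ⟨E, hE⟩ : ∃ E, E = Real.exp (-(η ^ 2 / 4)) := ⟨_, rfl⟩
  have hE0 : 0 < E := hE ▸ Real.exp_pos _
  have hE1 : E < 1 := hE ▸ Real.exp_lt_one_iff.2 (by rw [neg_lt_zero]; positivity)
  have hev := (h.tendsto_pow_div_coeff_pow hE0 hE1).eventually_lt_const
    (show 0 < ε * coeff k q / 2 by positivity)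
  filter_upwards [hev, h.eventually_coeff_pow_pos] with m hm hpos
  obtain ⟨n, hn⟩ : ∃ n, n = Nat.setGcd (coeffSupport q) * m := ⟨_, rfl⟩
  rw [← hn] at hm hpos ⊢
  obtain ⟨α, hα⟩ : ∃ α, α = coeff n (q ^ (n + 1)) := ⟨_, rfl⟩
  rw [← hα] at hm hpos ⊢
  have key := abs_coeff_pow_sub_le h.mass h.genFun_one k hη0 hη1 (n + 1 + i) (n + e)
  rw [add_assoc n e k, add_assoc (n + 1) i 1, ← hE, ← mul_sub, abs_mul, abs_of_pos hk'] at key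
  have hEn : E ^ (n + 1 + (i + 1)) ≤ E ^ n := pow_le_pow_of_le_one hE0.le hE1.le (by omega)
  have hA : 0 ≤ coeff (n + (e + k)) (q ^ (n + 1 + (i + 1))) := (h.mass.pow _).1 _
  have h5 : E ^ n ≤ ε * coeff k q / 2 * α := ((div_lt_iff₀ hpos).1 hm).le
  have h6 : coeff k q * |coeff (n + e) (q ^ (n + 1 + i)) -
      coeff (n + (e + k)) (q ^ (n + 1 + (i + 1)))| ≤
      coeff k q * (ε * coeff (n + (e + k)) (q ^ (n + 1 + (i + 1))) + ε * α) := by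
    have := mul_le_mul_of_nonneg_right hη2 hA
    linarith
  have h7 := le_of_mul_le_mul_left h6 hk'
  rw [← sub_div, abs_div, abs_of_pos hpos, div_le_iff₀ hpos, add_mul, mul_assoc,
    div_mul_cancel₀ _ hpos.ne']
  exact h7

/-- Iteration of single steps along a decomposition of `l` into support elements. The starting shift
`(i, e)` is quantified inside so that the induction can concatenate two displacements. -/
theorem tendsto_coeff_pow_shift (h : IsCriticalPair q B) {l : ℕ}
    (hl : l ∈ AddSubmonoid.closure (coeffSupport q)) : ∀ i e : ℕ, Tendsto (fun m : ℕ =>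
      coeff (Nat.setGcd (coeffSupport q) * m + e)
        (q ^ (Nat.setGcd (coeffSupport q) * m + 1 + i)) /
      coeff (Nat.setGcd (coeffSupport q) * m) (q ^ (Nat.setGcd (coeffSupport q) * m + 1)))
      atTop (𝓝 1) → ∀ n, l ≤ n → Tendsto (fun m : ℕ =>
      coeff (Nat.setGcd (coeffSupport q) * m + (e + l))
        (q ^ (Nat.setGcd (coeffSupport q) * m + 1 + (i + n))) /
      coeff (Nat.setGcd (coeffSupport q) * m) (q ^ (Nat.setGcd (coeffSupport q) * m + 1)))
      atTop (𝓝 1) := by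
  -- Since `0` is in the support, time can be added without moving.
  have hzero : ∀ i e : ℕ, Tendsto (fun m : ℕ =>
      coeff (Nat.setGcd (coeffSupport q) * m + e)
        (q ^ (Nat.setGcd (coeffSupport q) * m + 1 + i)) /
      coeff (Nat.setGcd (coeffSupport q) * m) (q ^ (Nat.setGcd (coeffSupport q) * m + 1)))
      atTop (𝓝 1) → ∀ n, Tendsto (fun m : ℕ =>
      coeff (Nat.setGcd (coeffSupport q) * m + e)
        (q ^ (Nat.setGcd (coeffSupport q) * m + 1 + (i + n))) /
      coeff (Nat.setGcd (coeffSupport q) * m) (q ^ (Nat.setGcd (coeffSupport q) * m + 1)))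
      atTop (𝓝 1) := by
    intro i e hie n
    induction n with
    | zero => exact hie
    | succ n ih => exact h.tendsto_coeff_pow_shift_step h.zero_pos.ne' (i + n) e ih
  induction hl using AddSubmonoid.closure_induction with
  | zero => exact fun i e hie n _ => hzero i e hie n
  | mem k hk =>
    intro i e hie n hn
    rcases n with _ | n
    · obtain rfl : k = 0 := by omega
      exact hie
    · exact h.tendsto_coeff_pow_shift_step hk (i + n) e (hzero i e hie n)
  | add x y _ _ hx hy =>
    intro i e hie n hn
    have := hy (i + x) (e + x) (hx i e hie x le_rfl) (n - x) (by omega)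
    rwa [add_assoc e, add_assoc i, Nat.add_sub_cancel' (by omega : x ≤ n)] at this

/-- Displacements `d (L + 1)` from `d m` and `d L` from `d (m + 1)` reach the same position at the
same time, so both reference coefficients are equivalent to one common coefficient. -/
theorem tendsto_coeff_pow_ratio (h : IsCriticalPair q B) : Tendsto (fun m : ℕ =>
      coeff (Nat.setGcd (coeffSupport q) * (m + 1))
        (q ^ (Nat.setGcd (coeffSupport q) * (m + 1) + 1)) /
      coeff (Nat.setGcd (coeffSupport q) * m) (q ^ (Nat.setGcd (coeffSupport q) * m + 1)))
      atTop (𝓝 1) := by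
  obtain ⟨L, hL⟩ := exists_forall_mem_closure q
  have hd0 := h.setGcd_pos
  have hbase : Tendsto (fun m : ℕ =>
      coeff (Nat.setGcd (coeffSupport q) * m + 0)
        (q ^ (Nat.setGcd (coeffSupport q) * m + 1 + 0)) /
      coeff (Nat.setGcd (coeffSupport q) * m) (q ^ (Nat.setGcd (coeffSupport q) * m + 1)))
      atTop (𝓝 1) := by
    refine tendsto_const_nhds.congr' ?_
    filter_upwards [h.eventually_coeff_pow_pos] with m hm
    rw [add_zero, add_zero, div_self hm.ne']
  have h1 := h.tendsto_coeff_pow_shift (hL (Nat.setGcd (coeffSupport q) * L)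
    (Nat.le_mul_of_pos_left L hd0) (dvd_mul_right _ _)) 0 0 hbase _ le_rfl
  have h2 := h.tendsto_coeff_pow_shift (hL (Nat.setGcd (coeffSupport q) * (L + 1))
    ((Nat.le_succ L).trans (Nat.le_mul_of_pos_left (L + 1) hd0)) (dvd_mul_right _ _)) 0 0 hbase _
      le_rfl
  have h3 := h2.div (h1.comp (tendsto_add_atTop_nat 1)) one_ne_zero
  rw [div_one] at h3
  refine h3.congr' ?_
  filter_upwards [h.eventually_coeff_pow_pos,
    (tendsto_add_atTop_nat 1).eventually h.eventually_coeff_pow_pos,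
    (h2.eventually_ne one_ne_zero)] with m hm hm1 hne
  simp only [Pi.div_apply, Function.comp_apply, zero_add] at hne ⊢
  rw [show Nat.setGcd (coeffSupport q) * (m + 1) + Nat.setGcd (coeffSupport q) * L =
      Nat.setGcd (coeffSupport q) * m + Nat.setGcd (coeffSupport q) * (L + 1) by ring,
    show Nat.setGcd (coeffSupport q) * (m + 1) + 1 + Nat.setGcd (coeffSupport q) * L =
      Nat.setGcd (coeffSupport q) * m + 1 + Nat.setGcd (coeffSupport q) * (L + 1) by ring]
  have hne' := (div_ne_zero_iff.1 hne).1
  field_simp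

/-- The sum of `d` consecutive coefficients. -/
noncomputable def _root_.windowSum (d : ℕ) (f : PowerSeries ℝ) (n : ℕ) : ℝ :=
  ∑ j ∈ Finset.range d, coeff (n + j) f

/-- Sizes carried by `B` are congruent to `1` modulo the period, and a window of length equal to the
period contains exactly one such integer; the quotient is `⌈n / d⌉`. -/
theorem windowSum_succ_eq (h : IsCriticalPair q B) (n : ℕ) :
    windowSum (Nat.setGcd (coeffSupport q)) B (n + 1) =
      coeff (Nat.setGcd (coeffSupport q) *
        ((n + (Nat.setGcd (coeffSupport q) - 1)) / Nat.setGcd (coeffSupport q)) + 1) B := by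
  have hd0 := h.setGcd_pos
  have hvan : ∀ l, ¬ Nat.setGcd (coeffSupport q) ∣ l → coeff (l + 1) B = 0 := by
    intro l hl
    have h1 := succ_mul_coeff_succ h.eq_subst l
    by_contra hne
    refine hl (setGcd_dvd_of_coeff_pow_ne_zero (l + 1) (h1 ▸ mul_ne_zero ?_ hne))
    positivity
  obtain ⟨d, hd⟩ : ∃ d, d = Nat.setGcd (coeffSupport q) := ⟨_, rfl⟩
  rw [← hd] at hd0 hvan ⊢
  obtain ⟨m, hm⟩ : ∃ m, m = (n + (d - 1)) / d := ⟨_, rfl⟩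
  have h1 := Nat.div_add_mod (n + (d - 1)) d
  have h2 := Nat.mod_lt (n + (d - 1)) hd0
  rw [← hm] at h1 ⊢
  unfold windowSum
  rw [Finset.sum_eq_single (d * m - n)]
  · rw [show n + 1 + (d * m - n) = d * m + 1 by omega]
  · intro j hj hne
    rw [add_right_comm]
    refine hvan _ fun hdvd => hne ?_
    obtain ⟨c, hc⟩ := hdvd
    have hj' := Finset.mem_range.1 hj
    have : c = m := by
      rw [hm]
      refine (Nat.div_eq_of_lt_le ?_ ?_).symm
      · rw [mul_comm c d]; omega
      · rw [Nat.succ_mul, mul_comm c d]; omega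
    rw [← this, ← hc]
    omega
  · intro hj
    exact absurd (Finset.mem_range.2 (by omega)) hj

theorem tendsto_windowSum (h : IsCriticalPair q B) :
    (∀ᶠ n in atTop, 0 < windowSum (Nat.setGcd (coeffSupport q)) B n) ∧
    Tendsto (fun n => windowSum (Nat.setGcd (coeffSupport q)) B (n + 1) /
      windowSum (Nat.setGcd (coeffSupport q)) B n) atTop (𝓝 1) := by
  have hd0 := h.setGcd_pos
  have hw := h.windowSum_succ_eq
  have hpos := h.eventually_coeff_pow_pos
  have hrat := h.tendsto_coeff_pow_ratio
  have hdw := fun m => succ_mul_coeff_succ h.eq_subst (Nat.setGcd (coeffSupport q) * m)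
  obtain ⟨d, hd⟩ : ∃ d, d = Nat.setGcd (coeffSupport q) := ⟨_, rfl⟩
  simp only [← hd] at hd0 hw hpos hrat hdw ⊢
  have hpos' : ∀ᶠ m : ℕ in atTop, 0 < coeff (d * m + 1) B := by
    filter_upwards [hpos] with m hm
    rw [← hdw m] at hm
    exact pos_of_mul_pos_right hm (by positivity)
  have hrat' : Tendsto (fun m : ℕ => coeff (d * (m + 1) + 1) B / coeff (d * m + 1) B)
      atTop (𝓝 1) := by
    -- The prefactors of the Otter-Dwass formula.
    have hlin : Tendsto (fun m : ℕ => ((d * m + 1 : ℕ) : ℝ) / ((d * (m + 1) + 1 : ℕ) : ℝ))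
        atTop (𝓝 1) := by
      have hinf : Tendsto (fun m : ℕ => ((d * (m + 1) + 1 : ℕ) : ℝ)) atTop atTop := by
        refine tendsto_natCast_atTop_atTop.comp (tendsto_atTop_mono (fun m => ?_) tendsto_id)
        have := Nat.le_mul_of_pos_left (m + 1) hd0
        simp only [id_eq]
        omega
      have := (hinf.const_div_atTop (d : ℝ)).const_sub 1
      rw [sub_zero] at this
      refine this.congr fun m => ?_
      have : ((d * (m + 1) + 1 : ℕ) : ℝ) ≠ 0 := by positivity
      field_simp
      push_cast
      ring
    have := hrat.mul hlin
    rw [one_mul] at this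
    refine this.congr' ?_
    filter_upwards [hpos'] with m hm
    rw [← hdw, ← hdw]
    have h1 : ((d * (m + 1) + 1 : ℕ) : ℝ) ≠ 0 := by positivity
    have h2 : ((d * m + 1 : ℕ) : ℝ) ≠ 0 := by positivity
    field_simp
  have hm : Tendsto (fun n => (n + (d - 1)) / d) atTop atTop :=
    (Nat.tendsto_div_const_atTop hd0.ne').comp (tendsto_add_atTop_nat (d - 1))
  have hposn : ∀ᶠ n in atTop, 0 < windowSum d B (n + 1) := by
    filter_upwards [hm.eventually hpos'] with n hn
    rw [hw]
    exact hn
  refine ⟨eventually_atTop.2 ?_, ?_⟩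
  · obtain ⟨N, hN⟩ := eventually_atTop.1 hposn
    refine ⟨N + 1, fun n hn => ?_⟩
    have := hN (n - 1) (by omega)
    rwa [Nat.sub_add_cancel (by omega)] at this
  · refine (tendsto_add_atTop_iff_nat 1).1 ?_
    rw [Metric.tendsto_atTop]
    intro ε hε
    obtain ⟨N1, h1⟩ := Metric.tendsto_atTop.1 (hrat'.comp hm) ε hε
    obtain ⟨N2, h2⟩ := eventually_atTop.1 hposn
    refine ⟨max N1 N2, fun n hn => ?_⟩
    have a1 := h1 n ((le_max_left _ _).trans hn)
    have a2 := h2 n ((le_max_right _ _).trans hn)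
    -- Sliding the window by one either keeps its only admissible size, giving ratio `1`, or moves
    -- to the next one.
    have hcase : (n + 1 + (d - 1)) / d = (n + (d - 1)) / d ∨
        (n + 1 + (d - 1)) / d = (n + (d - 1)) / d + 1 := by
      have b1 : (n + (d - 1)) / d ≤ (n + 1 + (d - 1)) / d := Nat.div_le_div_right (by omega)
      have b2 : (n + 1 + (d - 1)) / d ≤ (n + (d - 1) + d) / d := Nat.div_le_div_right (by omega)
      rw [Nat.add_div_right _ hd0] at b2
      omega
    rcases hcase with hc | hc
    · rw [hw (n + 1), hc, ← hw n, div_self a2.ne', dist_self]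
      exact hε
    · rw [hw (n + 1), hc, hw n]
      exact a1

end IsCriticalPair

end Ratio

/-! ### Lower bounds for the tails of convolutions -/

section TailWeight

open PowerSeries

/-- The windows of `f` are asymptotically at least `z` times the total mass of `f` times `β`. -/
def HasTailWeight (β : ℕ → ℝ) (d : ℕ) (f : PowerSeries ℝ) (z : ℝ) : Prop :=
  ∀ ε : ℝ, 0 < ε → ∀ᶠ n in atTop, (z * genFun f 1 - ε) * β n ≤ windowSum d f n

variable {β : ℕ → ℝ} {d : ℕ} {f g : PowerSeries ℝ}

theorem IsMass.windowSum_nonneg (hf : IsMass f) (d n : ℕ) : 0 ≤ windowSum d f n :=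
  Finset.sum_nonneg fun _ _ => hf.1 _

/-- A bounded shift is harmless because `β (n + 1) / β n` tends to `1`. -/
theorem eventually_shift_le (hβ : ∀ᶠ n in atTop, 0 < β n)
    (hr : Tendsto (fun n => β (n + 1) / β n) atTop (𝓝 1)) {w : ℕ → ℝ} {c : ℝ}
    (hw : ∀ ε : ℝ, 0 < ε → ∀ᶠ n in atTop, (c - ε) * β n ≤ w n) (b : ℕ) :
    ∀ ε : ℝ, 0 < ε → ∀ᶠ n in atTop, (c - ε) * β n ≤ w (n - b) := by
  induction b with
  | zero => exact hw
  | succ b ih =>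
    intro ε hε
    have h1 : Tendsto (fun n => (c - ε) * (β (n + 1) / β n)) atTop (𝓝 (c - ε)) := by
      simpa using hr.const_mul (c - ε)
    have h2 : ∀ᶠ n in atTop, (c - ε) * β (n + 1) ≤ w (n - b) := by
      filter_upwards [hβ, ih (ε / 2) (by linarith),
        h1.eventually_lt_const (show c - ε < c - ε / 2 by linarith)] with n hn h3 h4
      rw [← mul_div_assoc, div_lt_iff₀ hn] at h4
      linarith
    obtain ⟨N, hN⟩ := eventually_atTop.1 h2
    refine eventually_atTop.2 ⟨N + 1, fun n hn => ?_⟩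
    have := hN (n - 1) (by omega)
    rwa [Nat.sub_add_cancel (by omega), Nat.sub_sub, add_comm 1 b] at this

/-- The ranges where the index of `g`, respectively of `f`, is below `M` are disjoint once `2 M ≤
N`. -/
theorem IsMass.le_coeff_mul (hf : IsMass f) (hg : IsMass g) {M N : ℕ} (h : 2 * M ≤ N) :
    ∑ b ∈ Finset.range M, coeff b g * coeff (N - b) f +
      ∑ a ∈ Finset.range M, coeff a f * coeff (N - a) g ≤ coeff N (f * g) := by
  rw [coeff_mul, Finset.Nat.sum_antidiagonal_eq_sum_range_succ
    (fun i j => coeff i f * coeff j g)]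
  have hinj : Set.InjOn (fun b => N - b) (Finset.range M : Set ℕ) := by
    intro x hx y hy hxy
    simp only [Finset.coe_range, Set.mem_Iio] at hx hy hxy
    omega
  have hdisj : Disjoint ((Finset.range M).image fun b => N - b) (Finset.range M) := by
    rw [Finset.disjoint_left]
    intro x hx hx'
    obtain ⟨b, hb, rfl⟩ := Finset.mem_image.1 hx
    rw [Finset.mem_range] at hb hx'
    omega
  have hsub : (Finset.range M).image (fun b => N - b) ∪ Finset.range M ⊆
      Finset.range (N + 1) := by
    intro x hx
    rw [Finset.mem_union, Finset.mem_image] at hx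
    rw [Finset.mem_range]
    rcases hx with ⟨b, _, rfl⟩ | hx
    · omega
    · rw [Finset.mem_range] at hx
      omega
  refine le_trans (le_of_eq ?_) (Finset.sum_le_sum_of_subset_of_nonneg hsub
    fun i _ _ => mul_nonneg (hf.1 _) (hg.1 _))
  rw [Finset.sum_union hdisj, Finset.sum_image hinj]
  congr 1
  refine Finset.sum_congr rfl fun b hb => ?_
  have := Finset.mem_range.1 hb
  rw [Nat.sub_sub_self (by omega), mul_comm]

theorem IsMass.le_windowSum_mul (hf : IsMass f) (hg : IsMass g) (d : ℕ) {M n : ℕ}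
    (h : 2 * M ≤ n) :
    ∑ b ∈ Finset.range M, coeff b g * windowSum d f (n - b) +
      ∑ a ∈ Finset.range M, coeff a f * windowSum d g (n - a) ≤ windowSum d (f * g) n := by
  unfold windowSum
  have h1 : ∀ u v : PowerSeries ℝ, ∑ b ∈ Finset.range M, coeff b u *
      ∑ j ∈ Finset.range d, coeff (n - b + j) v = ∑ j ∈ Finset.range d,
        ∑ b ∈ Finset.range M, coeff b u * coeff (n + j - b) v := by
    intro u v
    simp only [Finset.mul_sum]
    rw [Finset.sum_comm]
    refine Finset.sum_congr rfl fun j _ => Finset.sum_congr rfl fun b hb => ?_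
    have := Finset.mem_range.1 hb
    rw [show n - b + j = n + j - b by omega]
  rw [h1, h1, ← Finset.sum_add_distrib]
  exact Finset.sum_le_sum fun j _ => hf.le_coeff_mul hg (by omega)

theorem IsMass.exists_sum_range_gt (hf : IsMass f) {η : ℝ} (hη : 0 < η) :
    ∀ᶠ M in atTop, genFun f 1 - η < ∑ a ∈ Finset.range M, coeff a f := by
  have h := hf.2.hasSum.tendsto_sum_nat
  have h1 : ∑' n, coeff n f = genFun f 1 := by simp [genFun]
  rw [h1] at h
  exact h.eventually_const_lt (by linarith)

theorem IsMass.sum_range_le (hf : IsMass f) (M : ℕ) :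
    ∑ a ∈ Finset.range M, coeff a f ≤ genFun f 1 := by
  have h1 : ∑' n, coeff n f = genFun f 1 := by simp [genFun]
  rw [← h1]
  exact hf.2.sum_le_tsum _ fun _ _ => hf.1 _

namespace HasTailWeight

theorem zero (hβ : ∀ᶠ n in atTop, 0 < β n) (hf : IsMass f) : HasTailWeight β d f 0 := by
  intro ε hε
  filter_upwards [hβ] with n hn
  refine le_trans ?_ (hf.windowSum_nonneg d n)
  rw [zero_mul, zero_sub]
  exact mul_nonpos_of_nonpos_of_nonneg (by linarith) hn.le

/-- The principle of one big jump, as a lower bound: a large sum arises from a large first term with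
a moderate second term or the reverse, and these two disjoint scenarios contribute `y` and `z`. -/
theorem mul (hβ : ∀ᶠ n in atTop, 0 < β n)
    (hr : Tendsto (fun n => β (n + 1) / β n) atTop (𝓝 1)) (hf : IsMass f) (hg : IsMass g)
    {y z : ℝ} (hy : 0 ≤ y) (hz : 0 ≤ z) (hfy : HasTailWeight β d f y)
    (hgz : HasTailWeight β d g z) : HasTailWeight β d (f * g) (y + z) := by
  intro ε hε
  rw [hf.genFun_mul hg zero_le_one le_rfl]
  have hF0 := hf.genFun_nonneg zero_le_one
  have hG0 := hg.genFun_nonneg zero_le_one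
  have hFM := hf.sum_range_le
  have hGM := hg.sum_range_le
  have hFe := fun {η : ℝ} (hη : 0 < η) => hf.exists_sum_range_gt hη
  have hGe := fun {η : ℝ} (hη : 0 < η) => hg.exists_sum_range_gt hη
  have hfs := eventually_shift_le hβ hr hfy
  have hgs := eventually_shift_le hβ hr hgz
  obtain ⟨F, hF⟩ : ∃ F, F = genFun f 1 := ⟨_, rfl⟩
  obtain ⟨G, hG⟩ : ∃ G, G = genFun g 1 := ⟨_, rfl⟩
  simp only [← hF, ← hG] at *
  -- `K` collects the coefficients of `η` when `(G - η) y F - η G + (F - η) z G - η F` is expanded.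
  obtain ⟨K, hK⟩ : ∃ K, K = y * F + G + z * G + F := ⟨_, rfl⟩
  have hK0 : 0 ≤ K := by rw [hK]; positivity
  obtain ⟨η, hη⟩ : ∃ η, η = ε / (K + 1) := ⟨_, rfl⟩
  have hη0 : 0 < η := by rw [hη]; positivity
  have hηK : η * K ≤ ε := by
    rw [hη, div_mul_eq_mul_div, div_le_iff₀ (by linarith)]
    nlinarith
  obtain ⟨M, hM1, hM2⟩ := ((hFe hη0).and (hGe hη0)).exists
  have e1 : ∀ᶠ n in atTop, ∀ b ∈ Finset.range M, (y * F - η) * β n ≤ windowSum d f (n - b) :=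
    (Finset.eventually_all _).2 fun b _ => hfs b η hη0
  have e2 : ∀ᶠ n in atTop, ∀ b ∈ Finset.range M, (z * G - η) * β n ≤ windowSum d g (n - b) :=
    (Finset.eventually_all _).2 fun b _ => hgs b η hη0
  filter_upwards [hβ, e1, e2, eventually_ge_atTop (2 * M)] with n hn h1 h2 h3
  refine le_trans ?_ (hf.le_windowSum_mul hg d h3)
  have h4 : (∑ b ∈ Finset.range M, coeff b g) * ((y * F - η) * β n) ≤
      ∑ b ∈ Finset.range M, coeff b g * windowSum d f (n - b) := by
    rw [Finset.sum_mul]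
    exact Finset.sum_le_sum fun b hb => mul_le_mul_of_nonneg_left (h1 b hb) (hg.1 b)
  have h5 : (∑ b ∈ Finset.range M, coeff b f) * ((z * G - η) * β n) ≤
      ∑ b ∈ Finset.range M, coeff b f * windowSum d g (n - b) := by
    rw [Finset.sum_mul]
    exact Finset.sum_le_sum fun b hb => mul_le_mul_of_nonneg_left (h2 b hb) (hf.1 b)
  refine le_trans ?_ (add_le_add h4 h5)
  have hFM' := hFM M
  have hGM' := hGM M
  rw [← mul_assoc (Finset.sum _ _), ← mul_assoc (Finset.sum _ _), ← add_mul]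
  refine mul_le_mul_of_nonneg_right ?_ hn.le
  have k1 : (G - η) * (y * F) ≤ (∑ b ∈ Finset.range M, coeff b g) * (y * F) :=
    mul_le_mul_of_nonneg_right hM2.le (by positivity)
  have k2 : (F - η) * (z * G) ≤ (∑ b ∈ Finset.range M, coeff b f) * (z * G) :=
    mul_le_mul_of_nonneg_right hM1.le (by positivity)
  have k3 := mul_le_mul_of_nonneg_right hFM' hη0.le
  have k4 := mul_le_mul_of_nonneg_right hGM' hη0.le
  have k5 : η * K = η * (y * F) + η * G + η * (z * G) + η * F := by rw [hK]; ring
  linarith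

theorem prod (hβ : ∀ᶠ n in atTop, 0 < β n)
    (hr : Tendsto (fun n => β (n + 1) / β n) atTop (𝓝 1)) {ι : Type*} (t : Finset ι)
    {f : ι → PowerSeries ℝ} (hf : ∀ i, IsMass (f i)) {z : ι → ℝ} (hz : ∀ i, 0 ≤ z i)
    (h : ∀ i, HasTailWeight β d (f i) (z i)) :
    HasTailWeight β d (∏ i ∈ t, f i) (∑ i ∈ t, z i) := by
  classical
  induction t using Finset.induction_on with
  | empty => simpa using zero hβ IsMass.one
  | insert i t hi ih =>
    rw [Finset.prod_insert hi, Finset.sum_insert hi]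
    exact mul hβ hr (hf i) (IsMass.prod t hf) (hz i) (Finset.sum_nonneg fun i _ => hz i) (h i) ih

theorem mul_left (hβ : ∀ᶠ n in atTop, 0 < β n)
    (hr : Tendsto (fun n => β (n + 1) / β n) atTop (𝓝 1)) (hf : IsMass f) (hg : IsMass g)
    {z : ℝ} (hz : 0 ≤ z) (hgz : HasTailWeight β d g z) : HasTailWeight β d (f * g) z := by
  simpa using mul hβ hr hf hg le_rfl hz (zero hβ hf) hgz

end HasTailWeight

end TailWeight

/-! ### Balls of the local distance -/

namespace PlaneTree

open Classical in
/-- The vertices at height `h`. -/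
noncomputable def level (h : ℕ) (t : PlaneTree) : Finset Node :=
  {u ∈ (finite_restrict h t).toFinset | u.length = h}

open Classical in
/-- The vertices at height less than `h`. -/
noncomputable def below (h : ℕ) (t : PlaneTree) : Finset Node :=
  {u ∈ (finite_restrict h t).toFinset | u.length < h}

theorem mem_level {h : ℕ} {t : PlaneTree} {u : Node} :
    u ∈ level h t ↔ u ∈ t.nodes ∧ u.length = h := by
  simp only [level, restrict, Finset.mem_filter, Set.Finite.mem_toFinset, Set.mem_ofPred_eq]
  constructor
  · exact fun h => ⟨h.1.1, h.2⟩
  · exact fun h => ⟨⟨h.1, h.2.le⟩, h.2⟩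

theorem mem_below {h : ℕ} {t : PlaneTree} {u : Node} :
    u ∈ below h t ↔ u ∈ t.nodes ∧ u.length < h := by
  simp only [below, restrict, Finset.mem_filter, Set.Finite.mem_toFinset, Set.mem_ofPred_eq]
  constructor
  · exact fun h => ⟨h.1.1, h.2⟩
  · exact fun h => ⟨⟨h.1, h.2.le⟩, h.2⟩

theorem cons_mem_iff_exists_fin (t : PlaneTree) (j : ℕ+) (u : Node) :
    j :: u ∈ t.nodes ↔ ∃ i : Fin (t.outDegree []),
      i.val.succPNat = j ∧ u ∈ (t.childSubtree i.val.succPNat).nodes := by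
  rw [cons_mem_iff]
  constructor
  · rintro ⟨hj, hu⟩
    have hj' := j.natPred_add_one
    exact ⟨⟨j.natPred, by omega⟩, by simp, by simpa using hu⟩
  · rintro ⟨i, rfl, hu⟩
    exact ⟨by simp, hu⟩

theorem level_zero (t : PlaneTree) : level 0 t = {[]} := by
  ext u
  simp only [mem_level, List.length_eq_zero_iff, Finset.mem_singleton]
  exact ⟨fun h => h.2, fun h => ⟨h ▸ t.root_mem, h⟩⟩

theorem below_zero (t : PlaneTree) : below 0 t = ∅ := by
  ext u
  simp [mem_below]

theorem level_succ (h : ℕ) (t : PlaneTree) : level (h + 1) t =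
    Finset.univ.biUnion fun i : Fin (t.outDegree []) =>
      (level h (t.childSubtree i.val.succPNat)).image (List.cons i.val.succPNat) := by
  ext u
  rcases u with _ | ⟨j, u⟩
  · simp [mem_level]
  · simp only [mem_level, cons_mem_iff_exists_fin, List.length_cons, add_left_inj,
      Finset.mem_biUnion, Finset.mem_univ, true_and, Finset.mem_image, List.cons.injEq]
    constructor
    · rintro ⟨⟨i, rfl, hu⟩, hl⟩
      exact ⟨i, u, ⟨hu, hl⟩, rfl, rfl⟩
    · rintro ⟨i, v, ⟨hv, hl⟩, rfl, rfl⟩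
      exact ⟨⟨i, rfl, hv⟩, hl⟩

theorem below_succ (h : ℕ) (t : PlaneTree) : below (h + 1) t =
    insert [] (Finset.univ.biUnion fun i : Fin (t.outDegree []) =>
      (below h (t.childSubtree i.val.succPNat)).image (List.cons i.val.succPNat)) := by
  ext u
  rcases u with _ | ⟨j, u⟩
  · simp [mem_below, root_mem]
  · simp only [mem_below, cons_mem_iff_exists_fin, List.length_cons, add_lt_add_iff_right,
      Finset.mem_insert, reduceCtorEq, false_or,
      Finset.mem_biUnion, Finset.mem_univ, true_and, Finset.mem_image, List.cons.injEq]
    constructor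
    · rintro ⟨⟨i, rfl, hu⟩, hl⟩
      exact ⟨i, u, ⟨hu, hl⟩, rfl, rfl⟩
    · rintro ⟨i, v, ⟨hv, hl⟩, rfl, rfl⟩
      exact ⟨⟨i, rfl, hv⟩, hl⟩

theorem pairwiseDisjoint_image_cons {n : ℕ} (s : Fin n → Finset Node) :
    Set.PairwiseDisjoint (Finset.univ : Finset (Fin n)) fun i =>
      (s i).image (List.cons i.val.succPNat) := by
  intro i _ j _ hij
  refine Finset.disjoint_left.2 fun u hu hu' => hij ?_
  obtain ⟨v, _, rfl⟩ := Finset.mem_image.1 hu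
  obtain ⟨w, _, hw⟩ := Finset.mem_image.1 hu'
  simp only [List.cons.injEq, Nat.succPNat_inj] at hw
  exact Fin.ext hw.1.symm

theorem card_level_succ (h : ℕ) (t : PlaneTree) : (level (h + 1) t).card =
    ∑ i : Fin (t.outDegree []), (level h (t.childSubtree i.val.succPNat)).card := by
  rw [level_succ, Finset.card_biUnion (pairwiseDisjoint_image_cons _)]
  exact Finset.sum_congr rfl fun i _ => Finset.card_image_of_injective _ List.cons_injective

theorem prod_below_succ {M : Type*} [CommMonoid M] (w : ℕ → M) (h : ℕ) (t : PlaneTree) :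
    ∏ u ∈ below (h + 1) t, w (t.outDegree u) = w (t.outDegree []) *
      ∏ i : Fin (t.outDegree []), ∏ u ∈ below h (t.childSubtree i.val.succPNat),
        w ((t.childSubtree i.val.succPNat).outDegree u) := by
  rw [below_succ, Finset.prod_insert (by simp),
    Finset.prod_biUnion (pairwiseDisjoint_image_cons _)]
  congr 1
  refine Finset.prod_congr rfl fun i _ => ?_
  rw [Finset.prod_image fun _ _ _ _ h => List.cons_injective h]
  refine Finset.prod_congr rfl fun u _ => ?_
  rw [outDegree_childSubtree _ _ (by simp)]

/-- The trees that coincide with `t` up to height `h`. -/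
def localBall (h : ℕ) (t : PlaneTree) : Set PlaneTree := {s | s.restrict h = t.restrict h}

theorem measurableSet_localBall (h : ℕ) (t : PlaneTree) : MeasurableSet (localBall h t) :=
  measurableSet_restrict_eq h t

theorem localBall_zero (t : PlaneTree) : localBall 0 t = Set.univ := by
  simp [localBall, restrict_zero]

theorem localBall_succ (h : ℕ) (t : PlaneTree) : localBall (h + 1) t =
    {s | s.outDegree [] = t.outDegree [] ∧ ∀ i : Fin (t.outDegree []),
      s.childSubtree i.val.succPNat ∈ localBall h (t.childSubtree i.val.succPNat)} := by
  ext s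
  exact restrict_succ_eq_iff h s t rfl

end PlaneTree

/-! ### Galton-Watson trees on balls -/

section GWBall

open PlaneTree PowerSeries

variable {p : PMF ℕ} {Ω : Type*} [MeasurableSpace Ω] {P : Measure Ω} [IsProbabilityMeasure P]
  {τ : Ω → PlaneTree}

theorem IsGWTree.measure_localBall (hτ : IsGWTree p τ P) (h : ℕ) (t : PlaneTree) :
    P (τ ⁻¹' localBall h t) = ∏ u ∈ below h t, p (t.outDegree u) := by
  induction h generalizing t with
  | zero => simp [localBall_zero, below_zero]
  | succ h ih =>
    rw [prod_below_succ p, localBall_succ]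
    simp only [← ih]
    exact hτ.measure_children _ fun i => measurableSet_localBall _ _

open Classical in
theorem IsGWTree.treeSeries_children (hτ : IsGWTree p τ P) (A : Set ℕ) (n : ℕ)
    {S : Fin n → Set PlaneTree} (hS : ∀ i, MeasurableSet (S i)) :
    treeSeries A τ P {t | t.outDegree [] = n ∧
        ∀ i : Fin n, t.childSubtree i.val.succPNat ∈ S i} =
      C (p n).toReal * (X ^ (if n ∈ A then 1 else 0) * ∏ i, treeSeries A τ P (S i)) := by
  ext m
  rw [coeff_C_mul, coeff_X_pow_mul']
  split_ifs with hA hm hm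
  · have := hτ.measureReal_children_numDegreeIn A n (m - 1) hS
    rw [if_pos hA, Nat.sub_add_cancel hm] at this
    rw [coeff_treeSeries, ← this]
    rfl
  · obtain rfl : m = 0 := by omega
    rw [coeff_treeSeries, mul_zero, measureReal_eq_zero_iff]
    convert measure_empty (μ := P)
    refine Set.eq_empty_of_forall_notMem fun ω hω => ?_
    have := hω.2
    rw [numDegreeIn_eq_add_sum A _ hω.1.1, if_pos hA] at this
    simp at this
  · have := hτ.measureReal_children_numDegreeIn A n m hS
    rw [if_neg hA, add_zero] at this
    rw [coeff_treeSeries, Nat.sub_zero, ← this]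
    rfl
  · omega

/-- Every vertex of `t` at height `h` carries a fresh copy of `τ`, of weight `1`. Weights add over
the children of the root, as do the cardinals of the levels; the factor `p(n)` and the possible
contribution of the root to `L_A` have weight `0`. -/
theorem IsGWTree.hasTailWeight_localBall (hτ : IsGWTree p τ P) (A : Set ℕ) {β : ℕ → ℝ} {d : ℕ}
    (hβ : ∀ᶠ n in atTop, 0 < β n)
    (hr : Tendsto (fun n => β (n + 1) / β n) atTop (𝓝 1))
    (h1 : HasTailWeight β d (treeSeries A τ P Set.univ) 1) (h : ℕ) (t : PlaneTree) :
    HasTailWeight β d (treeSeries A τ P (localBall h t)) (level h t).card := by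
  classical
  induction h generalizing t with
  | zero => simpa [localBall_zero, level_zero] using h1
  | succ h ih =>
    have hM : ∀ i : Fin (t.outDegree []), IsMass
        (treeSeries A τ P (localBall h (t.childSubtree i.val.succPNat))) := fun i =>
      isMass_treeSeries A hτ.measurable (measurableSet_localBall _ _)
    rw [localBall_succ, hτ.treeSeries_children A _ fun i => measurableSet_localBall _ _,
      card_level_succ, Nat.cast_sum]
    have hz : ∀ i : Fin (t.outDegree []),
        (0 : ℝ) ≤ (level h (t.childSubtree i.val.succPNat)).card := fun i => Nat.cast_nonneg _
    have hC : IsMass (C (p (t.outDegree [])).toReal) := by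
      simpa using IsMass.one.C_mul (ENNReal.toReal_nonneg (a := p (t.outDegree [])))
    refine HasTailWeight.mul_left hβ hr hC ((IsMass.X.pow _).mul (IsMass.prod _ hM))
      (Finset.sum_nonneg fun i _ => hz i) ?_
    exact HasTailWeight.mul_left hβ hr (IsMass.X.pow _) (IsMass.prod _ hM)
      (Finset.sum_nonneg fun i _ => hz i) (HasTailWeight.prod hβ hr _ hM hz fun i => ih _)

end GWBall

/-! ### Kesten's tree -/

section Kesten

open PlaneTree

theorem mem_ofDegrees_append_iff (k : Node → ℕ) (u : Node) (i : ℕ+) :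
    u ++ [i] ∈ (ofDegrees k).nodes ↔ u ∈ (ofDegrees k).nodes ∧ (i : ℕ) ≤ k u := by
  constructor
  · exact fun h => ⟨(ofDegrees k).ancestor_mem u [i] h, h u i List.prefix_rfl⟩
  · rintro ⟨h, hi⟩ v j hv
    rcases List.prefix_concat_iff.1 hv with e | e
    · obtain ⟨rfl, hj⟩ := List.append_inj' e rfl
      obtain rfl : j = i := by simpa using hj
      exact hi
    · exact h v j e

theorem eq_of_forall_pnat_le_iff {a b : ℕ} (h : ∀ i : ℕ+, (i : ℕ) ≤ a ↔ (i : ℕ) ≤ b) : a = b := by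
  refine le_antisymm ?_ ?_
  · rcases Nat.eq_zero_or_pos a with rfl | ha
    · exact Nat.zero_le _
    · exact (h ⟨a, ha⟩).1 le_rfl
  · rcases Nat.eq_zero_or_pos b with rfl | hb
    · exact Nat.zero_le _
    · exact (h ⟨b, hb⟩).2 le_rfl

theorem outDegree_ofDegrees {k : Node → ℕ} {u : Node} (hu : u ∈ (ofDegrees k).nodes) :
    (ofDegrees k).outDegree u = k u := by
  refine eq_of_forall_pnat_le_iff fun i => ?_
  rw [← append_singleton_mem_iff, mem_ofDegrees_append_iff, and_iff_right hu]

theorem measurable_ofDegrees {α : Type*} [MeasurableSpace α] {k : α → Node → ℕ}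
    (hk : ∀ u, Measurable fun a => k a u) : Measurable fun a => ofDegrees (k a) := by
  refine measurable_of_nodes fun u => ?_
  have : {a | u ∈ (ofDegrees (k a)).nodes} =
      ⋂ (v : Node) (i : ℕ+) (_ : v ++ [i] <+: u), {a | (i : ℕ) ≤ k a v} := by
    ext a
    simp [ofDegrees]
  rw [this]
  exact .iInter fun v => .iInter fun i => .iInter fun _ => hk v measurableSet_Ici

theorem isSpecial_append_iff (I : Node → ℕ) (u : Node) (i : ℕ+) :
    IsSpecial I (u ++ [i]) ↔ IsSpecial I u ∧ (i : ℕ) = I u := by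
  constructor
  · intro h
    generalize hv : u ++ [i] = v at h
    cases h with
    | root => simp at hv
    | child w j hw hj =>
      obtain ⟨rfl, e⟩ := List.append_inj' hv rfl
      obtain rfl : i = j := by simpa using e
      exact ⟨hw, hj⟩
  · exact fun h => .child u i h.1 h.2

theorem IsSpecial.of_append {I : Node → ℕ} {u w : Node} (h : IsSpecial I (u ++ w)) :
    IsSpecial I u := by
  induction w using List.reverseRecOn with
  | nil => simpa using h
  | append_singleton w i ih =>
    rw [← List.append_assoc, isSpecial_append_iff] at h
    exact ih h.1

/-- Special vertices form a single ray. -/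
theorem IsSpecial.prefix_of_length_le {I : Node → ℕ} {u v : Node} (hu : IsSpecial I u)
    (hv : IsSpecial I v) (h : u.length ≤ v.length) : u <+: v := by
  induction u using List.reverseRecOn with
  | nil => exact List.nil_prefix
  | append_singleton u i ih =>
    rw [isSpecial_append_iff] at hu
    rw [List.length_append, List.length_singleton] at h
    obtain ⟨w, rfl⟩ := ih hu.1 (by omega)
    rcases w with _ | ⟨j, w⟩
    · simp at h
    · rw [List.append_cons] at hv
      have := ((isSpecial_append_iff I u j).1 hv.of_append).2
      rw [← hu.2] at this
      exact ⟨w, by rw [PNat.coe_inj.1 this, List.append_assoc, List.singleton_append]⟩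

theorem measurableSet_isSpecial (u : Node) :
    MeasurableSet {x : Node → ℕ × (ℕ × ℕ) | IsSpecial (fun v => (x v).2.2) u} := by
  induction u using List.reverseRecOn with
  | nil =>
    convert MeasurableSet.univ
    exact Set.eq_univ_of_forall fun x => IsSpecial.root
  | append_singleton u i ih =>
    simp only [isSpecial_append_iff, Set.ofPred_and]
    refine ih.inter ?_
    have : Measurable fun x : Node → ℕ × (ℕ × ℕ) => (x u).2.2 := by fun_prop
    convert this (measurableSet_singleton (i : ℕ)) using 1
    ext x
    exact eq_comm

theorem measurable_kestenTree : Measurable kestenTree := by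
  refine measurable_ofDegrees fun u => ?_
  refine Measurable.ite (measurableSet_isSpecial u) ?_ ?_ <;> fun_prop

variable {p : PMF ℕ} (h0 : offspringMean p ≠ 0) (h1 : offspringMean p ≠ ∞)

/-- The size-biasing factor `n` cancels the uniform choice `1 / n`, so a special vertex with a
prescribed heir has the same weight as a normal one. -/
theorem specialOffspring_apply (hm : offspringMean p = 1) (n i : ℕ) :
    specialOffspring p h0 h1 (n, i) = if 1 ≤ i ∧ i ≤ n then p n else 0 := by
  have hsb : ∀ n : ℕ, sizeBiased p h0 h1 n = n * p n := by
    intro n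
    have hm' : ∑' n : ℕ, (n : ℝ≥0∞) * p n = 1 := hm
    rw [sizeBiased, PMF.normalize_apply, hm', inv_one, mul_one]
  rw [specialOffspring, PMF.bind_apply, tsum_eq_single n]
  · rw [hsb]
    by_cases hn : 1 ≤ n
    · rw [dif_pos hn, PMF.map_apply, tsum_eq_single i]
      · rw [if_pos rfl, PMF.uniformOfFinset_apply]
        simp only [Finset.mem_Icc]
        split_ifs with hi
        · rw [Nat.card_Icc, Nat.add_sub_cancel, mul_right_comm, ENNReal.mul_inv_cancel, one_mul]
          · exact_mod_cast (by omega : n ≠ 0)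
          · exact ENNReal.natCast_ne_top n
        · rw [mul_zero]
      · intro j hj
        rw [if_neg]
        simpa using fun h => hj h.symm
    · obtain rfl : n = 0 := by omega
      rw [Nat.cast_zero, zero_mul, zero_mul, if_neg]
      omega
  · intro m hm'
    rw [hsb]
    split_ifs with hm1
    · rw [PMF.map_apply, ENNReal.tsum_eq_zero.2, mul_zero]
      intro j
      rw [if_neg]
      simp [hm'.symm]
    · obtain rfl : m = 0 := by omega
      simp

/-- The offspring of the vertex `u` of `t` when `u` belongs to the special path to `v`, respectively
when it does not. -/
def spineOffspring (t : PlaneTree) (v u : Node) : Set (ℕ × (ℕ × ℕ)) :=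
  {y | (u <+: v → y.2 = (t.outDegree u, ((v.getD u.length 1 : ℕ+) : ℕ))) ∧
    (¬ u <+: v → y.1 = t.outDegree u)}

theorem measure_spineOffspring (hm : offspringMean p = 1) {t : PlaneTree} {h : ℕ} {u v : Node}
    (hv : v ∈ level h t) (hu : u ∈ below h t) :
    (p.toMeasure.prod (specialOffspring p h0 h1).toMeasure) (spineOffspring t v u) =
      p (t.outDegree u) := by
  rw [mem_level] at hv
  rw [mem_below] at hu
  by_cases huv : u <+: v
  · obtain ⟨w, rfl⟩ := huv
    -- The vertex `u` is strictly lower than `v`, so the path to `v` continues after `u` and the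
    -- default value in `getD` is not used.
    rcases w with _ | ⟨i, w⟩
    · simp only [List.append_nil] at hv
      omega
    have hi : (i : ℕ) ≤ t.outDegree u := by
      rw [← append_singleton_mem_iff]
      exact t.ancestor_mem (u ++ [i]) w (by simpa using hv.1)
    have : spineOffspring t (u ++ i :: w) u = Set.univ ×ˢ {(t.outDegree u, (i : ℕ))} := by
      ext y
      simp [spineOffspring]
    rw [this, Measure.prod_prod, measure_univ, one_mul,
      PMF.toMeasure_apply_singleton _ _ (measurableSet_singleton _),
      specialOffspring_apply h0 h1 hm, if_pos ⟨i.pos, hi⟩]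
  · have : spineOffspring t v u = {t.outDegree u} ×ˢ Set.univ := by
      ext y
      simp [spineOffspring, huv]
    rw [this, Measure.prod_prod, measure_univ, mul_one,
      PMF.toMeasure_apply_singleton _ _ (measurableSet_singleton _)]

theorem exists_isSpecial_mem_kestenTree {x : Node → ℕ × (ℕ × ℕ)}
    (hx : ∀ u, 1 ≤ (x u).2.2 ∧ (x u).2.2 ≤ (x u).2.1) (h : ℕ) :
    ∃ v ∈ (kestenTree x).nodes, v.length = h ∧ IsSpecial (fun v => (x v).2.2) v := by
  induction h with
  | zero => exact ⟨[], (kestenTree x).root_mem, rfl, .root⟩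
  | succ h ih =>
    obtain ⟨v, hv, hl, hs⟩ := ih
    obtain ⟨i, hi⟩ : ∃ i : ℕ+, (i : ℕ) = (x v).2.2 := ⟨⟨(x v).2.2, (hx v).1⟩, rfl⟩
    refine ⟨v ++ [i], ?_, by simp [hl], .child v _ hs hi⟩
    rw [kestenTree, mem_ofDegrees_append_iff, hi]
    refine ⟨hv, ?_⟩
    rw [if_pos hs]
    exact (hx v).2

/-- The witness is the special vertex at height `h`: together with `t` it determines the relevant
labels of all vertices below height `h`. -/
theorem exists_spineOffspring_of_mem_localBall {x : Node → ℕ × (ℕ × ℕ)}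
    (hx : ∀ u, 1 ≤ (x u).2.2 ∧ (x u).2.2 ≤ (x u).2.1) {h : ℕ} {t : PlaneTree}
    (ht : kestenTree x ∈ localBall h t) :
    ∃ v ∈ level h t, ∀ u ∈ below h t, x u ∈ spineOffspring t v u := by
  obtain ⟨v, hv, hl, hs⟩ := exists_isSpecial_mem_kestenTree hx h
  refine ⟨v, mem_level.2 ⟨(mem_nodes_iff_of_restrict_eq ht hl.le).1 hv, hl⟩, fun u hu => ?_⟩
  rw [mem_below] at hu
  have huk : u ∈ (kestenTree x).nodes := (mem_nodes_iff_of_restrict_eq ht hu.2.le).2 hu.1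
  have hdeg : (kestenTree x).outDegree u = t.outDegree u := by
    refine eq_of_forall_pnat_le_iff fun i => ?_
    rw [← append_singleton_mem_iff, ← append_singleton_mem_iff]
    exact mem_nodes_iff_of_restrict_eq ht (by simpa using hu.2)
  rw [kestenTree, outDegree_ofDegrees huk] at hdeg
  constructor
  · rintro ⟨w, rfl⟩
    rw [if_pos hs.of_append] at hdeg
    rcases w with _ | ⟨i, w⟩
    · simp only [List.append_nil] at hl
      omega
    rw [List.append_cons] at hs
    have := ((isSpecial_append_iff _ u i).1 hs.of_append).2
    ext
    · exact hdeg
    · simpa using this.symm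
  · intro huv
    rwa [if_neg fun hsu => huv (hsu.prefix_of_length_le hs (by omega))] at hdeg

/-- Union bound over the position of the spine at height `h`; each position has weight `∏ p(k_u)`.
An upper bound is enough, since it is compared with lower bounds for the conditioned trees. -/
theorem kestenLaw_localBall_le (hm : offspringMean p = 1) (h : ℕ) (t : PlaneTree) :
    kestenLaw p h0 h1 (localBall h t) ≤
      (level h t).card * ∏ u ∈ below h t, p (t.outDegree u) := by
  rw [kestenLaw, Measure.map_apply measurable_kestenTree (measurableSet_localBall h t)]
  obtain ⟨ν, hν⟩ : ∃ ν, ν = p.toMeasure.prod (specialOffspring p h0 h1).toMeasure := ⟨_, rfl⟩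
  have hνp : IsProbabilityMeasure ν := by rw [hν]; infer_instance
  -- Labels whose special rank is not that of an actual child would interrupt the spine; they have
  -- probability zero.
  have hbad : ν {y | ¬ (1 ≤ y.2.2 ∧ y.2.2 ≤ y.2.1)} = 0 := by
    have : {y : ℕ × (ℕ × ℕ) | ¬ (1 ≤ y.2.2 ∧ y.2.2 ≤ y.2.1)} =
        Set.univ ×ˢ {z : ℕ × ℕ | ¬ (1 ≤ z.2 ∧ z.2 ≤ z.1)} := by
      ext y
      simp
    rw [this, hν, Measure.prod_prod, measure_univ, one_mul,
      PMF.toMeasure_apply_eq_zero_iff _ .of_discrete]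
    refine Set.disjoint_left.2 fun z hz hz' => ?_
    rw [PMF.mem_support_iff, ← Prod.mk.eta (p := z), specialOffspring_apply h0 h1 hm,
      if_neg hz'] at hz
    exact hz rfl
  have hsub : kestenTree ⁻¹' localBall h t ⊆
      (⋃ u : Node, (fun x => x u) ⁻¹' {y | ¬ (1 ≤ y.2.2 ∧ y.2.2 ≤ y.2.1)}) ∪
      ⋃ v ∈ level h t, Set.pi (below h t : Set Node) (spineOffspring t v) := by
    intro x hx
    by_cases hgood : ∀ u, 1 ≤ (x u).2.2 ∧ (x u).2.2 ≤ (x u).2.1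
    · obtain ⟨v, hv, hu⟩ := exists_spineOffspring_of_mem_localBall hgood hx
      exact Or.inr (Set.mem_biUnion hv hu)
    · obtain ⟨u, hu⟩ := not_forall.1 hgood
      exact Or.inl (Set.mem_iUnion.2 ⟨u, hu⟩)
  simp only [← hν]
  refine (measure_mono hsub).trans ((measure_union_le _ _).trans ?_)
  rw [measure_iUnion_null, zero_add]
  · refine (measure_biUnion_finset_le _ _).trans ?_
    rw [← nsmul_eq_mul]
    refine Finset.sum_le_card_nsmul _ _ _ fun v hv => ?_
    rw [Measure.infinitePi_pi _ fun _ _ => .of_discrete]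
    refine le_of_eq (Finset.prod_congr rfl fun u hu => ?_)
    rw [hν, measure_spineOffspring h0 h1 hm hv hu]
  · intro u
    rw [← Measure.map_apply (measurable_pi_apply u) .of_discrete,
      Measure.infinitePi_map_eval, hbad]

end Kesten

/-! ### The generating function of the number of vertices with given out-degrees -/

section Offspring

open PowerSeries

/-- The generating function of a probability distribution on `ℕ`. -/
noncomputable def pmfSeries (p : PMF ℕ) : PowerSeries ℝ := PowerSeries.mk fun n => (p n).toReal

theorem coeff_pmfSeries (p : PMF ℕ) (n : ℕ) : coeff n (pmfSeries p) = (p n).toReal :=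
  PowerSeries.coeff_mk _ _

theorem hasSum_toReal_pmf (p : PMF ℕ) : HasSum (fun n => (p n).toReal) 1 := by
  have h := ENNReal.hasSum_toReal (f := fun n => p n) (by rw [p.tsum_coe]; exact ENNReal.one_ne_top)
  rwa [← ENNReal.tsum_toReal_eq fun n => p.apply_ne_top n, p.tsum_coe, ENNReal.toReal_one] at h

theorem isMass_pmfSeries (p : PMF ℕ) : IsMass (pmfSeries p) :=
  ⟨fun n => by rw [coeff_pmfSeries]; exact ENNReal.toReal_nonneg, by
    simpa only [coeff_pmfSeries] using (hasSum_toReal_pmf p).summable⟩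

theorem genFun_pmfSeries (p : PMF ℕ) (s : ℝ) :
    genFun (pmfSeries p) s = ∑' n, (p n).toReal * s ^ n := by
  unfold genFun
  simp only [coeff_pmfSeries]

theorem genFun_pmfSeries_one (p : PMF ℕ) : genFun (pmfSeries p) 1 = 1 := by
  simpa [genFun, coeff_pmfSeries] using (hasSum_toReal_pmf p).tsum_eq

theorem hasSum_mul_toReal_pmf {p : PMF ℕ} (hm : offspringMean p = 1) :
    HasSum (fun n : ℕ => (n : ℝ) * (p n).toReal) 1 := by
  have hm' : ∑' n : ℕ, (n : ℝ≥0∞) * p n = 1 := hm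
  have h := ENNReal.hasSum_toReal (f := fun n : ℕ => (n : ℝ≥0∞) * p n)
    (by rw [hm']; exact ENNReal.one_ne_top)
  rw [← ENNReal.tsum_toReal_eq fun n => ENNReal.mul_ne_top (ENNReal.natCast_ne_top n)
    (p.apply_ne_top n), hm', ENNReal.toReal_one] at h
  simpa using h

theorem IsNondegenerate.exists_two_le {p : PMF ℕ} (hp : IsNondegenerate p) :
    ∃ k, 2 ≤ k ∧ p k ≠ 0 := by
  by_contra! h
  have h1 := p.tsum_coe
  rw [tsum_eq_sum (s := {0, 1}) fun k hk => h k (by simp at hk; omega)] at h1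
  rw [Finset.sum_pair zero_ne_one] at h1
  exact hp.2.2.ne h1

theorem abs_pow_sub_pow_le_mul {x y : ℝ} (hx0 : 0 ≤ x) (hx1 : x ≤ 1) (hy0 : 0 ≤ y) (hy1 : y ≤ 1)
    (n : ℕ) : |x ^ n - y ^ n| ≤ n * |x - y| := by
  induction n with
  | zero => simp
  | succ n ih =>
    have h : x ^ (n + 1) - y ^ (n + 1) = x * (x ^ n - y ^ n) + (x - y) * y ^ n := by ring
    rw [h]
    refine (abs_add_le _ _).trans ?_
    rw [abs_mul, abs_mul, abs_of_nonneg hx0, abs_of_nonneg (pow_nonneg hy0 n)]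
    have h1 := mul_le_mul hx1 ih (abs_nonneg _) zero_le_one
    have h2 := mul_le_mul_of_nonneg_left (pow_le_one₀ hy0 hy1 (n := n)) (abs_nonneg (x - y))
    push_cast
    linarith

theorem abs_genFun_pmfSeries_sub_le {p : PMF ℕ} (hm : offspringMean p = 1) {x y : ℝ}
    (hx0 : 0 ≤ x) (hx1 : x ≤ 1) (hy0 : 0 ≤ y) (hy1 : y ≤ 1) :
    |genFun (pmfSeries p) x - genFun (pmfSeries p) y| ≤ |x - y| := by
  have hM := isMass_pmfSeries p
  unfold genFun
  rw [← (hM.summable_mul_pow hx0 hx1).tsum_sub (hM.summable_mul_pow hy0 hy1), ← Real.norm_eq_abs]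
  have h := (hasSum_mul_toReal_pmf hm).mul_right |x - y|
  rw [one_mul] at h
  refine tsum_of_norm_bounded h fun n => ?_
  rw [← mul_sub, norm_mul, Real.norm_eq_abs, Real.norm_eq_abs, abs_of_nonneg (hM.1 n),
    coeff_pmfSeries, mul_comm (n : ℝ), mul_assoc]
  exact mul_le_mul_of_nonneg_left (abs_pow_sub_pow_le_mul hx0 hx1 hy0 hy1 n)
    ENNReal.toReal_nonneg

/-- The equation `x = s g(x)` has at most one solution in `[0, 1]` when `s < 1` and `g` is a
critical generating function. -/
theorem eq_of_eq_mul_genFun {p : PMF ℕ} (hm : offspringMean p = 1) {x y s : ℝ}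
    (hs0 : 0 ≤ s) (hs1 : s < 1) (hx0 : 0 ≤ x) (hx1 : x ≤ 1) (hy0 : 0 ≤ y) (hy1 : y ≤ 1)
    (hx : x = s * genFun (pmfSeries p) x) (hy : y = s * genFun (pmfSeries p) y) : x = y := by
  have h1 := abs_genFun_pmfSeries_sub_le hm hx0 hx1 hy0 hy1
  have h2 : |x - y| = s * |genFun (pmfSeries p) x - genFun (pmfSeries p) y| := by
    have : x - y = s * (genFun (pmfSeries p) x - genFun (pmfSeries p) y) := by
      rw [mul_sub, ← hx, ← hy]
    conv_lhs => rw [this, abs_mul, abs_of_nonneg hs0]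
  have h3 : |x - y| ≤ s * |x - y| := h2.trans_le (mul_le_mul_of_nonneg_left h1 hs0)
  have h4 := abs_nonneg (x - y)
  have h5 : |x - y| = 0 := by nlinarith
  linarith [abs_eq_zero.1 h5]

/-- Averaging Bernoulli's inequality `x ^ n ≥ 1 - n (1 - x)` under a law of mean `1` gives `g(x) ≥
x`, strictly for `x < 1` as some `k ≥ 2` is charged. -/
theorem eq_one_of_eq_genFun {p : PMF ℕ} (hm : offspringMean p = 1) (hp : IsNondegenerate p)
    {x : ℝ} (hx0 : 0 ≤ x) (hx1 : x ≤ 1) (hx : x = genFun (pmfSeries p) x) : x = 1 := by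
  by_contra hne
  have hlt : x < 1 := lt_of_le_of_ne hx1 hne
  obtain ⟨k, hk, hpk⟩ := hp.exists_two_le
  have hlin : HasSum (fun n : ℕ => (p n).toReal * (1 - n * (1 - x))) x := by
    have := (hasSum_toReal_pmf p).sub ((hasSum_mul_toReal_pmf hm).mul_right (1 - x))
    rw [one_mul, sub_sub_cancel] at this
    exact this.congr_fun fun n => by ring
  have hsum := (isMass_pmfSeries p).summable_mul_pow hx0 hx1
  simp only [coeff_pmfSeries] at hsum
  have hbern : ∀ n : ℕ, 1 - n * (1 - x) ≤ x ^ n := fun n => by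
    have := one_add_mul_le_pow (show -2 ≤ x - 1 by linarith) n
    rw [add_sub_cancel] at this
    linarith
  have hstrict : 1 - k * (1 - x) < x ^ k := by
    obtain ⟨j, rfl⟩ : ∃ j, k = j + 2 := ⟨k - 2, by omega⟩
    have h1 := mul_le_mul_of_nonneg_left (hbern (j + 1)) hx0
    rw [← pow_succ'] at h1
    refine lt_of_lt_of_le ?_ h1
    push_cast
    have : 0 < (j + 1 : ℝ) * ((1 - x) * (1 - x)) :=
      mul_pos (by positivity) (mul_pos (by linarith) (by linarith))
    linarith
  have hpk' : 0 < (p k).toReal := ENNReal.toReal_pos hpk (p.apply_ne_top k)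
  have := Summable.tsum_lt_tsum (i := k)
    (fun n => mul_le_mul_of_nonneg_left (hbern n) (ENNReal.toReal_nonneg (a := p n)))
    (mul_lt_mul_of_pos_left hstrict hpk') hlin.summable hsum
  rw [hlin.tsum_eq] at this
  unfold genFun at hx
  simp only [coeff_pmfSeries] at hx
  linarith

end Offspring

/-! ### Functional equations for the counts -/

section TreeSeriesUniv

open PowerSeries PlaneTree

/-- Coefficientwise summation of series commutes with evaluation. -/
theorem hasSum_genFun {F : PowerSeries ℝ} (hF : IsMass F) {f : ℕ → PowerSeries ℝ}
    (hf : ∀ n m, 0 ≤ coeff m (f n)) (h : ∀ m, HasSum (fun n => coeff m (f n)) (coeff m F)) {s : ℝ}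
    (h0 : 0 ≤ s) (h1 : s ≤ 1) : HasSum (fun n => genFun (f n) s) (genFun F s) := by
  have hrow : ∀ m, HasSum (fun n => coeff m (f n) * s ^ m) (coeff m F * s ^ m) :=
    fun m => (h m).mul_right (s ^ m)
  have hs : Summable fun mn : ℕ × ℕ => coeff mn.1 (f mn.2) * s ^ mn.1 := by
    refine (summable_prod_of_nonneg fun mn =>
      mul_nonneg (hf _ _) (pow_nonneg h0 _)).2 ⟨fun m => (hrow m).summable, ?_⟩
    exact (hF.summable_mul_pow h0 h1).congr fun m => (hrow m).tsum_eq.symm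
  have h3 : Summable fun nm : ℕ × ℕ => coeff nm.2 (f nm.1) * s ^ nm.2 := hs.prod_symm
  have h4 : ∑' n, genFun (f n) s = genFun F s := by
    have e1 : ∑' mn : ℕ × ℕ, coeff mn.1 (f mn.2) * s ^ mn.1 = genFun F s :=
      hs.tsum_prod.trans (tsum_congr fun m => (hrow m).tsum_eq)
    have e2 : ∑' nm : ℕ × ℕ, coeff nm.2 (f nm.1) * s ^ nm.2 = ∑' n, genFun (f n) s :=
      h3.tsum_prod
    rw [← e1, ← e2]
    exact (Equiv.prodComm ℕ ℕ).tsum_eq fun mn : ℕ × ℕ => coeff mn.1 (f mn.2) * s ^ mn.1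
  have h5 : Summable fun n => genFun (f n) s := h3.prod
  rw [← h4]
  exact h5.hasSum

variable {p : PMF ℕ} {Ω : Type*} [MeasurableSpace Ω] {P : Measure Ω} [IsProbabilityMeasure P]
  {τ : Ω → PlaneTree}

open Classical in
theorem IsGWTree.hasSum_coeff_treeSeries (hτ : IsGWTree p τ P) (A : Set ℕ) (m : ℕ) :
    HasSum (fun n => coeff m (C (p n).toReal *
      (X ^ (if n ∈ A then 1 else 0) * treeSeries A τ P Set.univ ^ n)))
      (coeff m (treeSeries A τ P Set.univ)) := by
  have hc : ∀ n, C (p n).toReal *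
      (X ^ (if n ∈ A then 1 else 0) * treeSeries A τ P Set.univ ^ n) =
      treeSeries A τ P {t | t.outDegree [] = n} := fun n => by
    have := hτ.treeSeries_children A n (S := fun _ => Set.univ) fun _ => .univ
    rw [Finset.prod_const, Finset.card_univ, Fintype.card_fin] at this
    rw [← this]
    simp
  simp only [hc, coeff_treeSeries]
  have hmeas : ∀ n, MeasurableSet
      {ω | τ ω ∈ {t : PlaneTree | t.outDegree [] = n} ∧ (τ ω).numDegreeIn A = m} := fun n =>
    measurableSet_numDegreeIn A hτ.measurable
      (measurable_outDegree [] (measurableSet_singleton n)) {(m : ℕ∞)}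
  have hd : Pairwise (Function.onFun Disjoint fun n : ℕ =>
      {ω | τ ω ∈ {t : PlaneTree | t.outDegree [] = n} ∧ (τ ω).numDegreeIn A = m}) :=
    fun i j hij => Set.disjoint_left.2 fun ω h1 h2 => hij (h1.1.symm.trans h2.1)
  have hU := measure_iUnion (μ := P) hd hmeas
  have hset : {ω | τ ω ∈ Set.univ ∧ (τ ω).numDegreeIn A = m} = ⋃ n : ℕ,
      {ω | τ ω ∈ {t : PlaneTree | t.outDegree [] = n} ∧ (τ ω).numDegreeIn A = m} := by
    ext ω
    simp
  rw [hset, measureReal_def, hU, ENNReal.tsum_toReal_eq fun _ => measure_ne_top _ _]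
  exact ENNReal.hasSum_toReal (hU ▸ measure_ne_top _ _)

open Classical in
theorem IsGWTree.hasSum_genFun_treeSeries (hτ : IsGWTree p τ P) (A : Set ℕ) {s : ℝ} (h0 : 0 ≤ s)
    (h1 : s ≤ 1) : HasSum (fun n => (p n).toReal *
      (s ^ (if n ∈ A then 1 else 0) * genFun (treeSeries A τ P Set.univ) s ^ n))
      (genFun (treeSeries A τ P Set.univ) s) := by
  have hM := isMass_treeSeries (P := P) A hτ.measurable MeasurableSet.univ
  have hf : ∀ n, IsMass (X ^ (if n ∈ A then 1 else 0) * treeSeries A τ P Set.univ ^ n) :=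
    fun n => (IsMass.X.pow _).mul (hM.pow n)
  have := hasSum_genFun hM (fun n => ((hf n).C_mul ENNReal.toReal_nonneg).1)
    (hτ.hasSum_coeff_treeSeries A) h0 h1
  refine this.congr_fun fun n => ?_
  rw [genFun_C_mul, (IsMass.X.pow _).genFun_mul (hM.pow n) h0 h1, genFun_X_pow,
    hM.genFun_pow h0 h1]

/-- Almost sure finiteness holds because `B(1)` is a fixed point of the generating function of `p`,
and the total size has infinite mean because a finite mean `μ` would satisfy `μ = 1 + μ`. -/
theorem IsGWTree.isCriticalPair (hτ : IsGWTree p τ P) (hm : offspringMean p = 1)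
    (hp : IsNondegenerate p) :
    genFun (treeSeries Set.univ τ P Set.univ) 1 = 1 ∧
      IsCriticalPair (pmfSeries p) (treeSeries Set.univ τ P Set.univ) := by
  have hM := isMass_treeSeries (P := P) Set.univ hτ.measurable MeasurableSet.univ
  have hcoeff := hτ.hasSum_coeff_treeSeries Set.univ
  have hfix := hτ.hasSum_genFun_treeSeries Set.univ zero_le_one le_rfl
  obtain ⟨B, hB⟩ : ∃ B, B = treeSeries Set.univ τ P Set.univ := ⟨_, rfl⟩
  rw [← hB] at hM hcoeff hfix ⊢
  simp only [Set.mem_univ, if_true, pow_one, one_mul] at hcoeff hfix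
  have hle : genFun B 1 ≤ 1 := by
    rw [hB, genFun_treeSeries_one Set.univ hτ.measurable MeasurableSet.univ]
    exact measureReal_le_one
  have hone : genFun B 1 = 1 := by
    refine eq_one_of_eq_genFun hm hp (hM.genFun_nonneg zero_le_one) hle ?_
    rw [genFun_pmfSeries, hfix.tsum_eq]
  have hB0 : coeff 0 B = 0 := by
    rw [← (hcoeff 0).tsum_eq]
    simp
  refine ⟨hone, isMass_pmfSeries p, genFun_pmfSeries_one p, ?_, ?_, ?_, ?_⟩
  · rw [coeff_pmfSeries]
    exact ENNReal.toReal_pos hp.1.ne' (p.apply_ne_top 0)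
  · obtain ⟨k, hk, hpk⟩ := hp.exists_two_le
    exact ⟨k, hk, by
      rw [coeff_pmfSeries]; exact (ENNReal.toReal_pos hpk (p.apply_ne_top k)).ne'⟩
  · ext m
    rcases m with _ | m
    · rw [hB0, coeff_zero_X_mul]
    · rw [coeff_succ_X_mul, coeff_subst_eq_sum (by simpa using hB0), ← (hcoeff (m + 1)).tsum_eq]
      simp only [coeff_C_mul, coeff_succ_X_mul, coeff_pmfSeries]
      -- `B` has no constant term, so only finitely many powers contribute to a given coefficient.
      refine tsum_eq_sum fun d hd => ?_
      rw [coeff_pow_eq_zero_of_lt (by simpa using hB0) (by simpa using hd), mul_zero]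
  -- Apply `X d/dX` to `B = ∑ p(n) X B^n` and evaluate at `1`.
  · intro hsum
    have hDM : IsMass (X * derivative ℝ B) :=
      ⟨fun n => by rw [coeff_X_mul_derivative]; exact mul_nonneg n.cast_nonneg (hM.1 n), by
        simpa only [coeff_X_mul_derivative] using hsum⟩
    have hD : ∀ n : ℕ, X * derivative ℝ (C (p n).toReal * (X * B ^ n)) =
        C (p n).toReal * (X * B ^ n + C (n : ℝ) * (X * (B ^ (n - 1) * (X * derivative ℝ B)))) := by
      intro n
      rw [Derivation.leibniz, derivative_C, Derivation.leibniz, derivative_X, derivative_pow,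
        map_natCast]
      simp only [smul_eq_mul]
      ring
    have hDf : ∀ n : ℕ, IsMass
        (X * B ^ n + C (n : ℝ) * (X * (B ^ (n - 1) * (X * derivative ℝ B)))) := fun n =>
      (IsMass.X.mul (hM.pow n)).add ((IsMass.X.mul ((hM.pow _).mul hDM)).C_mul n.cast_nonneg)
    have hX : genFun X 1 = 1 := by simpa using genFun_X_pow 1 1
    have hE := hasSum_genFun hDM (f := fun n => X * derivative ℝ (C (p n).toReal * (X * B ^ n)))
      (fun n => by rw [hD]; exact ((hDf n).C_mul ENNReal.toReal_nonneg).1)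
      (fun m => by simpa only [coeff_X_mul_derivative] using (hcoeff m).mul_left (m : ℝ))
      zero_le_one le_rfl
    have hval : ∀ n, genFun (X * derivative ℝ (C (p n).toReal * (X * B ^ n))) 1 =
        (p n).toReal + n * (p n).toReal * genFun (X * derivative ℝ B) 1 := by
      intro n
      rw [hD, genFun_C_mul, (IsMass.X.mul (hM.pow n)).genFun_add
        ((IsMass.X.mul ((hM.pow _).mul hDM)).C_mul n.cast_nonneg) zero_le_one le_rfl,
        genFun_C_mul, IsMass.X.genFun_mul (hM.pow n) zero_le_one le_rfl,
        IsMass.X.genFun_mul ((hM.pow _).mul hDM) zero_le_one le_rfl,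
        (hM.pow _).genFun_mul hDM zero_le_one le_rfl, hM.genFun_pow zero_le_one le_rfl,
        hM.genFun_pow zero_le_one le_rfl, hone, hX]
      ring
    simp only [hval] at hE
    have h2 := (hasSum_toReal_pmf p).add ((hasSum_mul_toReal_pmf hm).mul_right
      (genFun (X * derivative ℝ B) 1))
    have := hE.unique h2
    linarith

end TreeSeriesUniv

/-! ### Existence of the reduced offspring distribution -/

section Mean

open PowerSeries

/-- The measure on `ℕ` with generating function `f` has first moment `μ`. -/
def HasMean (f : PowerSeries ℝ) (μ : ℝ) : Prop := HasSum (fun n : ℕ => (n : ℝ) * coeff n f) μ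

variable {f g : PowerSeries ℝ} {μ ν : ℝ}

/-- The operator `X d/dX` turns first moments into total masses, so rules for means follow from the
product rule and the calculus of masses. -/
theorem HasMean.isMass_derivative (hf : IsMass f) (h : HasMean f μ) :
    IsMass (X * derivative ℝ f) :=
  ⟨fun n => by rw [coeff_X_mul_derivative]; exact mul_nonneg n.cast_nonneg (hf.1 n), by
    simpa only [coeff_X_mul_derivative] using h.summable⟩

theorem HasMean.genFun_derivative (h : HasMean f μ) : genFun (X * derivative ℝ f) 1 = μ := by
  rw [← h.tsum_eq]
  simp [genFun, coeff_X_mul_derivative, -coeff_succ_X_mul]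

theorem hasMean_of_isMass_derivative (h : IsMass (X * derivative ℝ f)) :
    HasMean f (genFun (X * derivative ℝ f) 1) := by
  have := h.2.hasSum
  simp only [coeff_X_mul_derivative] at this
  unfold HasMean genFun
  simp only [coeff_X_mul_derivative, one_pow, mul_one]
  exact this

theorem HasMean.mul (hf : IsMass f) (hg : IsMass g) (hμ : HasMean f μ) (hν : HasMean g ν) :
    HasMean (f * g) (μ * genFun g 1 + genFun f 1 * ν) := by
  have h1 := (hμ.isMass_derivative hf).mul hg
  have h2 := hf.mul (hν.isMass_derivative hg)
  have h : X * derivative ℝ (f * g) = X * derivative ℝ f * g + f * (X * derivative ℝ g) := by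
    rw [Derivation.leibniz]
    simp only [smul_eq_mul]
    ring
  have h3 := hasMean_of_isMass_derivative (f := f * g) (h ▸ h1.add h2)
  rwa [h, h1.genFun_add h2 zero_le_one le_rfl,
    (hμ.isMass_derivative hf).genFun_mul hg zero_le_one le_rfl,
    hf.genFun_mul (hν.isMass_derivative hg) zero_le_one le_rfl, hμ.genFun_derivative,
    hν.genFun_derivative] at h3

theorem hasMean_one : HasMean 1 0 := by
  unfold HasMean
  convert hasSum_zero using 2 with n
  rcases n with _ | n <;> simp [coeff_one]

theorem HasMean.C_mul (hμ : HasMean f μ) (y : ℝ) : HasMean (C y * f) (y * μ) := by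
  unfold HasMean
  exact (HasSum.mul_left y hμ).congr_fun fun n => by rw [coeff_C_mul]; ring

theorem HasMean.pow (hf : IsMass f) (hμ : HasMean f μ) (n : ℕ) :
    HasMean (f ^ n) (n * genFun f 1 ^ (n - 1) * μ) := by
  induction n with
  | zero => simpa using hasMean_one
  | succ n ih =>
    have h := ih.mul (hf.pow n) hf hμ
    rw [hf.genFun_pow zero_le_one le_rfl, ← pow_succ] at h
    convert h using 1
    rcases n with _ | n
    · simp
    · rw [Nat.add_sub_cancel, Nat.add_sub_cancel]
      push_cast
      ring

theorem exists_hasSum_coeff {f : ℕ → PowerSeries ℝ} (hf : ∀ n, IsMass (f n))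
    (hs : Summable fun n => genFun (f n) 1) :
    ∃ F, IsMass F ∧ ∀ m, HasSum (fun n => coeff m (f n)) (coeff m F) := by
  have hg : ∀ n, ∑' m, coeff m (f n) = genFun (f n) 1 := fun n => by simp [genFun]
  have h1 : Summable fun nm : ℕ × ℕ => coeff nm.2 (f nm.1) :=
    (summable_prod_of_nonneg fun nm => (hf nm.1).1 nm.2).2
      ⟨fun n => (hf n).2, hs.congr fun n => (hg n).symm⟩
  have h2 : Summable fun mn : ℕ × ℕ => coeff mn.1 (f mn.2) := h1.prod_symm
  have h3 : ∀ m, Summable fun n => coeff m (f n) := fun m => h2.prod_factor m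
  have h4 : Summable fun m => ∑' n, coeff m (f n) := h2.prod
  refine ⟨PowerSeries.mk fun m => ∑' n, coeff m (f n), ⟨fun m => ?_, ?_⟩, fun m => ?_⟩
  · rw [coeff_mk]
    exact tsum_nonneg fun n => (hf n).1 m
  · simpa only [coeff_mk] using h4
  · rw [coeff_mk]
    exact (h3 m).hasSum

theorem hasMean_of_hasSum_coeff {F : PowerSeries ℝ} {f : ℕ → PowerSeries ℝ}
    (hf : ∀ n, IsMass (f n)) (hF : ∀ m, HasSum (fun n => coeff m (f n)) (coeff m F))
    {μ : ℕ → ℝ} (hμ : ∀ n, HasMean (f n) (μ n)) {ν : ℝ} (hν : HasSum μ ν) : HasMean F ν := by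
  have hgen : ∀ n, genFun (X * derivative ℝ (f n)) 1 = μ n := fun n => (hμ n).genFun_derivative
  obtain ⟨G, hG, hGs⟩ := exists_hasSum_coeff (fun n => (hμ n).isMass_derivative (hf n))
    (hν.summable.congr fun n => (hgen n).symm)
  have hGF : G = X * derivative ℝ F := by
    ext m
    refine (hGs m).unique ?_
    simpa only [coeff_X_mul_derivative] using (hF m).mul_left (m : ℝ)
  have h1 := hasSum_genFun hG (fun n => ((hμ n).isMass_derivative (hf n)).1) hGs zero_le_one le_rfl
  simp only [hgen] at h1
  have h2 := hasMean_of_isMass_derivative (f := F) (hGF ▸ hG)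
  rwa [← hGF, h1.unique hν] at h2

theorem genFun_C_add_C_mul_X (a b s : ℝ) : genFun (C a + C b * X) s = a + b * s := by
  unfold genFun
  rw [tsum_eq_sum (s := {0, 1}) fun n hn => ?_]
  · rw [Finset.sum_pair zero_ne_one]
    simp [coeff_X, coeff_C]
  · simp only [Finset.mem_insert, Finset.mem_singleton, not_or] at hn
    simp [coeff_X, coeff_C, hn.1, hn.2]

theorem isMass_C {a : ℝ} (ha : 0 ≤ a) : IsMass (C a) := by simpa using IsMass.one.C_mul ha

theorem hasMean_C_add_C_mul_X (a b : ℝ) : HasMean (C a + C b * X) b := by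
  unfold HasMean
  convert hasSum_single (f := fun n : ℕ => (n : ℝ) * coeff n (C a + C b * X)) 1 fun n hn => ?_
  · simp [coeff_C]
  · rcases n with _ | _ | n
    · simp
    · exact absurd rfl hn
    · simp

/-- Binomial thinning of a measure on `ℕ`. -/
theorem exists_thinning {w : PowerSeries ℝ} (hw : IsMass w) (hμ : HasMean w μ) {a : ℝ}
    (ha0 : 0 ≤ a) (ha1 : a ≤ 1) : ∃ F, IsMass F ∧ HasMean F ((1 - a) * μ) ∧
      ∀ s, 0 ≤ s → s ≤ 1 → genFun F s = genFun w (a + (1 - a) * s) := by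
  have hb : 0 ≤ 1 - a := by linarith
  have hl : IsMass (C a + C (1 - a) * X) := (isMass_C ha0).add (IsMass.X.C_mul hb)
  have hf : ∀ n, IsMass (C (coeff n w) * (C a + C (1 - a) * X) ^ n) :=
    fun n => (hl.pow n).C_mul (hw.1 n)
  have hval : ∀ s, 0 ≤ s → s ≤ 1 → ∀ n, genFun (C (coeff n w) * (C a + C (1 - a) * X) ^ n) s =
      coeff n w * (a + (1 - a) * s) ^ n := fun s h0 h1 n => by
    rw [genFun_C_mul, hl.genFun_pow h0 h1, genFun_C_add_C_mul_X]
  obtain ⟨F, hF, hFs⟩ := exists_hasSum_coeff hf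
    (hw.2.congr fun n => by rw [hval 1 zero_le_one le_rfl]; simp)
  refine ⟨F, hF, hasMean_of_hasSum_coeff hf hFs
    (fun n => ((hasMean_C_add_C_mul_X a (1 - a)).pow hl n).C_mul (coeff n w)) ?_,
    fun s h0 h1 => ?_⟩
  · rw [genFun_C_add_C_mul_X]
    refine (HasSum.mul_left (1 - a) hμ).congr_fun fun n => ?_
    rw [show a + (1 - a) * 1 = 1 by ring, one_pow]
    ring
  · have := hasSum_genFun hF (fun n => (hf n).1) hFs h0 h1
    simp only [hval s h0 h1] at this
    exact this.tsum_eq.symm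

/-- `V` is the series `∑ f^n`; its mean comes from `∑ n r^(n-1) = (1 - r)^(-2)`. -/
theorem exists_geometric (hf : IsMass f) (hμ : HasMean f μ) (h1 : genFun f 1 < 1) :
    ∃ V, IsMass V ∧ HasMean V ((1 - genFun f 1)⁻¹ ^ 2 * μ) ∧ 0 < coeff 0 V ∧
      ∀ s, 0 ≤ s → s ≤ 1 → genFun V s = (1 - genFun f s)⁻¹ := by
  have h0 := hf.genFun_nonneg zero_le_one
  have hval : ∀ s, 0 ≤ s → s ≤ 1 → HasSum (fun n => genFun (f ^ n) s) (1 - genFun f s)⁻¹ := by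
    intro s hs0 hs1
    simp only [hf.genFun_pow hs0 hs1]
    exact hasSum_geometric_of_lt_one (hf.genFun_nonneg hs0)
      ((hf.genFun_mono hs0 hs1 le_rfl).trans_lt h1)
  obtain ⟨V, hV, hVs⟩ := exists_hasSum_coeff (fun n => hf.pow n) (hval 1 zero_le_one le_rfl).summable
  refine ⟨V, hV, hasMean_of_hasSum_coeff (fun n => hf.pow n) hVs (fun n => hμ.pow hf n) ?_, ?_,
    fun s hs0 hs1 => ?_⟩
  · refine HasSum.mul_right μ ?_
    have h := hasSum_choose_mul_geometric_of_norm_lt_one 1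
      (show ‖genFun f 1‖ < 1 by rwa [Real.norm_eq_abs, abs_of_nonneg h0])
    rw [← hasSum_nat_add_iff' 1]
    simpa using h
  · have h2 := (hVs 0).summable.le_tsum 0 fun n _ => (hf.pow n).1 0
    rw [(hVs 0).tsum_eq] at h2
    simp only [pow_zero, coeff_zero_one] at h2
    linarith
  · exact (hasSum_genFun hV (fun n => (hf.pow n).1) hVs hs0 hs1).unique (hval s hs0 hs1)

/-- `g` is `(f - f(0)) / X`; lowering every index by one removes from the mean the mass off `0`. -/
theorem exists_shift (hf : IsMass f) (hμ : HasMean f μ) :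
    ∃ g, IsMass g ∧ HasMean g (μ - genFun g 1) ∧
      ∀ s, 0 ≤ s → s ≤ 1 → genFun f s = coeff 0 f + s * genFun g s := by
  obtain ⟨g, hg⟩ : ∃ g : PowerSeries ℝ, g = PowerSeries.mk fun n => coeff (n + 1) f := ⟨_, rfl⟩
  have hc : ∀ n, coeff n g = coeff (n + 1) f := fun n => by rw [hg, coeff_mk]
  have hgs : Summable fun n => coeff n g := by
    simpa only [hc] using (summable_nat_add_iff (f := fun n => coeff n f) 1).2 hf.2
  have hgM : IsMass g := ⟨fun n => by rw [hc]; exact hf.1 _, hgs⟩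
  refine ⟨g, hgM, ?_, fun s h0 h1 => ?_⟩
  · have h1 := (hasSum_nat_add_iff' (f := fun n : ℕ => (n : ℝ) * coeff n f) 1).2 hμ
    have h2 : HasSum (fun n => coeff n g) (genFun g 1) := by
      simpa [genFun] using hgs.hasSum
    have h3 := h1.sub h2
    simp only [Finset.range_one, Finset.sum_singleton, Nat.cast_zero, zero_mul, sub_zero] at h3
    unfold HasMean
    refine h3.congr_fun fun n => ?_
    rw [hc]
    push_cast
    ring
  · unfold genFun
    rw [(hf.summable_mul_pow h0 h1).tsum_eq_zero_add, ← tsum_mul_left, pow_zero, mul_one]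
    congr 1
    refine tsum_congr fun n => ?_
    rw [hc, pow_succ]
    ring

theorem coeff_zero_eq_genFun (f : PowerSeries ℝ) : coeff 0 f = genFun f 0 := by
  unfold genFun
  rw [tsum_eq_single 0 fun n hn => by simp [hn]]
  simp

theorem exists_pmf_of_isMass (hf : IsMass f) (h1 : genFun f 1 = 1) :
    ∃ q : PMF ℕ, pmfSeries q = f := by
  have hs : HasSum (fun n => ENNReal.ofReal (coeff n f)) 1 := by
    have : ∑' n, ENNReal.ofReal (coeff n f) = 1 := by
      rw [← ENNReal.ofReal_tsum_of_nonneg hf.1 hf.2, show ∑' n, coeff n f = 1 by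
        rw [← h1]; simp [genFun], ENNReal.ofReal_one]
    rw [← this]
    exact ENNReal.summable.hasSum
  refine ⟨⟨fun n => ENNReal.ofReal (coeff n f), hs⟩, ?_⟩
  ext n
  exact (coeff_pmfSeries _ n).trans (ENNReal.toReal_ofReal (hf.1 n))

theorem offspringMean_eq_one {q : PMF ℕ} (h : HasMean (pmfSeries q) 1) : offspringMean q = 1 := by
  have h1 : ∀ n : ℕ, (n : ℝ≥0∞) * q n = ENNReal.ofReal (n * coeff n (pmfSeries q)) := fun n => by
    rw [coeff_pmfSeries, ENNReal.ofReal_mul n.cast_nonneg, ENNReal.ofReal_natCast,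
      ENNReal.ofReal_toReal (q.apply_ne_top n)]
  rw [offspringMean, tsum_congr h1, ← ENNReal.ofReal_tsum_of_nonneg
    (fun n => mul_nonneg n.cast_nonneg ((isMass_pmfSeries q).1 n)) h.summable, h.tsum_eq,
    ENNReal.ofReal_one]

/-- If `q` lived on `{0, 1}`, mean `1` would force `q 1 = 1`, leaving nothing for `0`. -/
theorem isNondegenerate_of_critical {q : PMF ℕ} (hm : offspringMean q = 1) (h0 : 0 < q 0) :
    IsNondegenerate q := by
  have h1 : q 0 + q 1 < 1 := by
    refine lt_of_le_of_ne ?_ fun h => ?_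
    · rw [← q.tsum_coe, ← Finset.sum_pair (f := q) zero_ne_one]
      exact ENNReal.sum_le_tsum _
    · have hz : ∀ k, k ∉ ({0, 1} : Finset ℕ) → q k = 0 := by
        intro k hk
        have h2 := ENNReal.sum_le_tsum (f := q) (insert k {0, 1})
        rw [Finset.sum_insert hk, Finset.sum_pair zero_ne_one, h, q.tsum_coe] at h2
        by_contra hne
        exact absurd h2 (not_le.2 (by
          rw [add_comm]; exact ENNReal.lt_add_right ENNReal.one_ne_top hne))
      rw [offspringMean, tsum_eq_sum (s := {0, 1}) fun k hk => by rw [hz k hk, mul_zero],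
        Finset.sum_pair zero_ne_one] at hm
      simp only [Nat.cast_zero, zero_mul, zero_add, Nat.cast_one, one_mul] at hm
      rw [hm] at h
      exact absurd h (ne_of_gt (by
        rw [add_comm]; exact ENNReal.lt_add_right ENNReal.one_ne_top h0.ne'))
  exact ⟨h0, lt_of_le_of_lt le_self_add h1, h1⟩

end Mean

/-! ### The reduced offspring distribution -/

section Reduced

open PowerSeries

open Classical in
/-- The generating function of the restriction of `p` to `A`. -/
noncomputable def restrictSeries (p : PMF ℕ) (A : Set ℕ) : PowerSeries ℝ :=
  PowerSeries.mk fun n => if n ∈ A then (p n).toReal else 0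

open Classical in
theorem coeff_restrictSeries (p : PMF ℕ) (A : Set ℕ) (n : ℕ) :
    coeff n (restrictSeries p A) = if n ∈ A then (p n).toReal else 0 :=
  coeff_mk _ _

theorem isMass_restrictSeries (p : PMF ℕ) (A : Set ℕ) : IsMass (restrictSeries p A) := by
  refine ⟨fun n => ?_, (hasSum_toReal_pmf p).summable.of_nonneg_of_le (fun n => ?_) fun n => ?_⟩ <;>
    rw [coeff_restrictSeries] <;> split_ifs <;> simp

theorem restrictSeries_add_compl (p : PMF ℕ) (A : Set ℕ) :
    restrictSeries p A + restrictSeries p Aᶜ = pmfSeries p := by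
  ext n
  rw [map_add, coeff_restrictSeries, coeff_restrictSeries, coeff_pmfSeries]
  by_cases h : n ∈ A <;> simp [h]

theorem exists_hasMean_restrictSeries {p : PMF ℕ} (hm : offspringMean p = 1) (A : Set ℕ) :
    ∃ μ, HasMean (restrictSeries p A) μ := by
  refine ⟨_, ((hasSum_mul_toReal_pmf hm).summable.of_nonneg_of_le (fun n => ?_)
    fun n => ?_).hasSum⟩ <;> rw [coeff_restrictSeries] <;> split_ifs <;>
    first | positivity | exact le_rfl | (rw [mul_zero]; positivity)

/-- Let `u` and `v` be `g_A` and `g_{Aᶜ}` composed with `x ↦ a + (1 - a) x`. Since `g_{Aᶜ}(a) = a`,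
`v(x) = a + (1 - a) x ψ(x)` for some `ψ` with nonnegative coefficients, so the equation becomes `(1
- a) x (1 - ψ(x)) = s u(x)`. Hence `q = (1 - a)⁻¹ u / (1 - ψ)`: a thinning of the children without
descendants counted by `L_A`, followed by a geometric series. -/
theorem exists_reduced_pmf {p : PMF ℕ} (hm : offspringMean p = 1) (A : Set ℕ) {a : ℝ}
    (ha0 : 0 ≤ a) (ha1 : a < 1) (ha : genFun (restrictSeries p Aᶜ) a = a)
    (hA : 0 < genFun (restrictSeries p A) a) :
    ∃ q : PMF ℕ, offspringMean q = 1 ∧ IsNondegenerate q ∧ ∀ s x : ℝ, 0 ≤ x → x ≤ 1 →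
      a + (1 - a) * x = s * genFun (restrictSeries p A) (a + (1 - a) * x) +
        genFun (restrictSeries p Aᶜ) (a + (1 - a) * x) → x = s * genFun (pmfSeries q) x := by
  have hMA := isMass_restrictSeries p A
  have hMC := isMass_restrictSeries p Aᶜ
  obtain ⟨μA, hμA⟩ := exists_hasMean_restrictSeries hm A
  obtain ⟨μC, hμC⟩ := exists_hasMean_restrictSeries hm Aᶜ
  have hμ : μA + μC = 1 := by
    refine (HasSum.add hμA hμC).unique ?_
    convert hasSum_mul_toReal_pmf hm using 2 with n
    rw [← mul_add, ← map_add, restrictSeries_add_compl, coeff_pmfSeries]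
  have htot : genFun (restrictSeries p A) 1 + genFun (restrictSeries p Aᶜ) 1 = 1 := by
    rw [← hMA.genFun_add hMC zero_le_one le_rfl, restrictSeries_add_compl, genFun_pmfSeries_one]
  have hb : 0 < 1 - a := by linarith
  obtain ⟨u, hu, huμ, hus⟩ := exists_thinning hMA hμA ha0 ha1.le
  obtain ⟨v, hv, hvμ, hvs⟩ := exists_thinning hMC hμC ha0 ha1.le
  obtain ⟨φ, hφ⟩ : ∃ φ, φ = C (1 - a)⁻¹ * v := ⟨_, rfl⟩
  have hφM : IsMass φ := hφ ▸ hv.C_mul (inv_nonneg.2 hb.le)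
  have hφμ : HasMean φ μC := by
    have := hvμ.C_mul (1 - a)⁻¹
    rwa [← hφ, inv_mul_cancel_left₀ hb.ne'] at this
  have hφs : ∀ s, 0 ≤ s → s ≤ 1 →
      genFun φ s = (1 - a)⁻¹ * genFun (restrictSeries p Aᶜ) (a + (1 - a) * s) :=
    fun s h0 h1 => by rw [hφ, genFun_C_mul, hvs s h0 h1]
  have hφ0 : coeff 0 φ = (1 - a)⁻¹ * a := by
    rw [coeff_zero_eq_genFun, hφs 0 le_rfl zero_le_one, mul_zero, add_zero, ha]
  obtain ⟨ψ, hψ, hψμ, hψs⟩ := exists_shift hφM hφμ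
  obtain ⟨π, hπ⟩ : ∃ π, π = genFun (restrictSeries p A) 1 := ⟨_, rfl⟩
  have hπ0 : 0 < π := by
    rw [hπ]
    exact hA.trans_le (hMA.genFun_mono ha0 ha1.le le_rfl)
  have hu1 : genFun u 1 = π := by rw [hus 1 zero_le_one le_rfl, hπ]; congr 1; ring
  -- This value makes the total mass of `g` equal to `1`, and with `π > 0` it makes the geometric
  -- series converge.
  have hψ1 : 1 - genFun ψ 1 = (1 - a)⁻¹ * π := by
    have h := hψs 1 zero_le_one le_rfl
    rw [hφs 1 zero_le_one le_rfl, hφ0, show a + (1 - a) * 1 = 1 by ring,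
      show genFun (restrictSeries p Aᶜ) 1 = 1 - π by rw [hπ]; linarith, one_mul] at h
    have h2 : (1 - a)⁻¹ * (1 - a) = 1 := inv_mul_cancel₀ hb.ne'
    linarith
  have hψlt : genFun ψ 1 < 1 := by
    have : 0 < (1 - a)⁻¹ * π := by positivity
    linarith
  obtain ⟨V, hV, hVμ, hV0, hVs⟩ := exists_geometric hψ hψμ hψlt
  obtain ⟨g, hg⟩ : ∃ g, g = C (1 - a)⁻¹ * (u * V) := ⟨_, rfl⟩
  have hgM : IsMass g := hg ▸ (hu.mul hV).C_mul (inv_nonneg.2 hb.le)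
  have hgs : ∀ s, 0 ≤ s → s ≤ 1 → genFun g s = (1 - a)⁻¹ * (genFun u s * (1 - genFun ψ s)⁻¹) :=
    fun s h0 h1 => by rw [hg, genFun_C_mul, hu.genFun_mul hV h0 h1, hVs s h0 h1]
  have hg1 : genFun g 1 = 1 := by
    rw [hgs 1 zero_le_one le_rfl, hu1, hψ1]
    field_simp
  -- The mean is `(1 - a) / π * (μA + μC - 1) + 1`, and `μA + μC = 1` by criticality of `p`.
  have hgμ : HasMean g 1 := by
    have h := (huμ.mul hu hV hVμ).C_mul (1 - a)⁻¹
    rw [← hg, hVs 1 zero_le_one le_rfl, hu1, hψ1] at h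
    convert h using 1
    have h3 : μA = 1 - μC := by linarith
    have h4 : genFun ψ 1 = 1 - (1 - a)⁻¹ * π := by linarith
    rw [h3, h4]
    field_simp
    ring
  obtain ⟨q, hq⟩ := exists_pmf_of_isMass hgM hg1
  have hqm : offspringMean q = 1 := offspringMean_eq_one (hq ▸ hgμ)
  refine ⟨q, hqm, isNondegenerate_of_critical hqm ?_, fun s x hx0 hx1 hx => ?_⟩
  · have h0 : 0 < coeff 0 g := by
      have h1 : 0 < coeff 0 u := by
        rw [coeff_zero_eq_genFun, hus 0 le_rfl zero_le_one, mul_zero, add_zero]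
        exact hA
      have h2 : coeff 0 (u * V) = coeff 0 u * coeff 0 V := by simp
      rw [hg, coeff_C_mul, h2]
      positivity
    rw [← hq, coeff_pmfSeries] at h0
    exact (ENNReal.toReal_pos_iff.1 h0).1
  · rw [hq, hgs x hx0 hx1, hus x hx0 hx1]
    have h1 := hψs x hx0 hx1
    rw [hφs x hx0 hx1, hφ0] at h1
    have h2 : 0 < 1 - genFun ψ x := by
      have := hψ.genFun_mono hx0 hx1 le_rfl
      linarith
    have h3 : genFun (restrictSeries p Aᶜ) (a + (1 - a) * x) =
        a + (1 - a) * (x * genFun ψ x) := by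
      have := congrArg (fun y => (1 - a) * y) h1
      simp only [mul_add, mul_inv_cancel_left₀ hb.ne'] at this
      exact this
    rw [h3] at hx
    obtain ⟨y, hy⟩ : ∃ y, y = genFun (restrictSeries p A) (a + (1 - a) * x) := ⟨_, rfl⟩
    rw [← hy] at hx ⊢
    field_simp
    linarith

end Reduced

/-! ### Existence of Galton-Watson trees -/

section Existence

open PlaneTree

theorem childSubtree_ofDegrees (k : Node → ℕ) (i : ℕ+) (hi : (i : ℕ) ≤ k []) :
    (ofDegrees k).childSubtree i = ofDegrees fun u => k (i :: u) := by
  have hroot : (ofDegrees k).outDegree [] = k [] := outDegree_ofDegrees (ofDegrees k).root_mem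
  ext u
  have h := cons_mem_iff (ofDegrees k) i u
  rw [hroot] at h
  rw [← and_iff_right hi (b := u ∈ ((ofDegrees k).childSubtree i).nodes), ← h]
  constructor
  · intro hu v j hv
    exact hu (i :: v) j (by simpa using hv)
  · intro hu v j hv
    rcases v with _ | ⟨i', v⟩
    · obtain rfl : j = i := by simpa using hv
      exact hi
    · simp only [List.cons_append, List.cons_prefix_cons] at hv
      obtain ⟨rfl, hv⟩ := hv
      exact hu v j hv

/-- The family of labels whose root label is `x.1` and whose label at `i :: u` is `x.2 (i, u)`. -/
def consLabels (x : ℕ × (ℕ+ × Node → ℕ)) : Node → ℕ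
  | [] => x.1
  | i :: u => x.2 (i, u)

theorem measurable_consLabels : Measurable consLabels := by
  refine measurable_pi_lambda _ fun v => ?_
  rcases v with _ | ⟨i, u⟩
  · exact measurable_fst
  · exact (measurable_pi_apply (i, u)).comp measurable_snd

variable (q : PMF ℕ)

/-- An i.i.d. family on the nodes splits into the root label and an independent i.i.d. family on the
other nodes; checked on finite cylinders. -/
theorem map_consLabels : (q.toMeasure.prod (Measure.infinitePi fun _ : ℕ+ × Node =>
    q.toMeasure)).map consLabels = Measure.infinitePi fun _ : Node => q.toMeasure := by
  classical
  refine Measure.eq_infinitePi _ fun s t ht => ?_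
  have hinj : Function.Injective fun iu : ℕ+ × Node => iu.1 :: iu.2 := by
    rintro ⟨i, u⟩ ⟨j, v⟩ h
    simpa using h
  have hpre : consLabels ⁻¹' Set.pi (s : Set Node) t =
      (if [] ∈ s then t [] else Set.univ) ×ˢ
        Set.pi (s.preimage (fun iu : ℕ+ × Node => iu.1 :: iu.2) hinj.injOn : Set (ℕ+ × Node))
          fun iu => t (iu.1 :: iu.2) := by
    ext ⟨n, y⟩
    simp only [Set.mem_preimage, Set.mem_pi, SetLike.mem_coe, Set.mem_prod, Finset.mem_preimage,
      Prod.forall]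
    constructor
    · intro h
      refine ⟨?_, fun i u hiu => h (i :: u) hiu⟩
      split_ifs with h0
      · exact h [] h0
      · trivial
    · rintro ⟨h0, h⟩ v hv
      rcases v with _ | ⟨i, u⟩
      · rwa [if_pos hv] at h0
      · exact h i u hv
  -- The factor of the root is set to `1` so that the product over the other nodes extends to all of
  -- `s`; the root factor is then restored.
  rw [Measure.map_apply measurable_consLabels (.pi s.countable_toSet fun v _ => ht v), hpre,
    Measure.prod_prod, Measure.infinitePi_pi _ fun _ _ => ht _,
    Finset.prod_congr rfl (g := fun iu : ℕ+ × Node => if (iu.1 :: iu.2 : Node) = [] then 1 else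
      q.toMeasure (t (iu.1 :: iu.2))) fun iu _ => by simp,
    Finset.prod_preimage (fun iu : ℕ+ × Node => (iu.1 :: iu.2 : Node)) s hinj.injOn
      (fun v => if v = [] then 1 else q.toMeasure (t v)) fun v _ hv => by
        rcases v with _ | ⟨i, u⟩
        · simp
        · exact absurd ⟨(i, u), rfl⟩ hv]
  have h1 : q.toMeasure (if [] ∈ s then t [] else Set.univ) =
      ∏ v ∈ s, if v = [] then q.toMeasure (t []) else 1 := by
    rw [Finset.prod_ite_eq']
    split_ifs <;> simp
  rw [h1, ← Finset.prod_mul_distrib]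
  refine Finset.prod_congr rfl fun v _ => ?_
  split_ifs with hv
  · rw [hv, mul_one]
  · rw [one_mul]

/-- Currying `ℕ+ × Node` makes the label families above the different children independent copies of
the whole family. -/
theorem measure_root_label_and_subtrees (n : ℕ) {S : Fin n → Set (Node → ℕ)}
    (hS : ∀ i, MeasurableSet (S i)) :
    (Measure.infinitePi fun _ : Node => q.toMeasure)
      {k | k [] = n ∧ ∀ i : Fin n, (fun u => k (i.val.succPNat :: u)) ∈ S i} =
      q n * ∏ i, (Measure.infinitePi fun _ : Node => q.toMeasure) (S i) := by
  have hSm : MeasurableSet {k : Node → ℕ | k [] = n ∧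
      ∀ i : Fin n, (fun u => k (i.val.succPNat :: u)) ∈ S i} := by
    simp only [Set.ofPred_and, Set.ofPred_forall]
    exact (measurable_pi_apply ([] : Node) (measurableSet_singleton n)).inter
      (.iInter fun i => measurable_pi_lambda (fun (k : Node → ℕ) u => k (i.val.succPNat :: u))
        (fun u => measurable_pi_apply _) (hS i))
  have hpre : consLabels ⁻¹' {k | k [] = n ∧
      ∀ i : Fin n, (fun u => k (i.val.succPNat :: u)) ∈ S i} =
      {n} ×ˢ (MeasurableEquiv.curry ℕ+ Node ℕ ⁻¹' {y | ∀ i : Fin n, y i.val.succPNat ∈ S i}) := by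
    ext ⟨m, y⟩
    rfl
  have hinj : Function.Injective fun i : Fin n => i.val.succPNat := fun i j hij =>
    Fin.ext (Nat.succPNat_injective hij)
  have hdif : ∀ i : Fin n, (if h : i.val.succPNat.natPred < n then
      S ⟨i.val.succPNat.natPred, h⟩ else Set.univ) = S i := fun i => by
    simp
  have hset : {y : ℕ+ → Node → ℕ | ∀ i : Fin n, y i.val.succPNat ∈ S i} =
      Set.pi ((Finset.univ.image fun i : Fin n => i.val.succPNat : Finset ℕ+) : Set ℕ+)
        fun j => if h : j.natPred < n then S ⟨j.natPred, h⟩ else Set.univ := by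
    ext y
    simp only [Set.mem_ofPred_eq, Set.mem_pi, SetLike.mem_coe, Finset.mem_image, Finset.mem_univ,
      true_and, forall_exists_index, forall_apply_eq_imp_iff, hdif]
  rw [← map_consLabels q, Measure.map_apply measurable_consLabels hSm, hpre, Measure.prod_prod,
    PMF.toMeasure_apply_singleton _ _ (measurableSet_singleton n), hset,
    ← Measure.map_apply (MeasurableEquiv.measurable _),
    Measure.infinitePi_map_curry (fun _ _ => q.toMeasure), Measure.infinitePi_pi,
    Finset.prod_image fun i _ j _ hij => hinj hij, map_consLabels q]
  · simp only [hdif]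
  · intro j _
    split_ifs
    · exact hS _
    · exact .univ
  · refine .pi (Finset.countable_toSet _) fun j _ => ?_
    split_ifs
    · exact hS _
    · exact .univ

/-- Provides the tree `τ_A` on a concrete space: all nodes, present or not, get i.i.d. labels. -/
theorem isGWTree_ofDegrees :
    IsGWTree q ofDegrees (Measure.infinitePi fun _ : Node => q.toMeasure) := by
  obtain ⟨P, hP⟩ : ∃ P, P = Measure.infinitePi fun _ : Node => q.toMeasure := ⟨_, rfl⟩
  have hPp : IsProbabilityMeasure P := by rw [hP]; infer_instance
  have hmeas : Measurable ofDegrees := measurable_ofDegrees fun u => measurable_pi_apply u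
  have hdeg : ∀ k : Node → ℕ, (ofDegrees k).outDegree [] = k [] := fun k =>
    outDegree_ofDegrees (ofDegrees k).root_mem
  have hroot : ∀ n, P {k | k [] = n} = q n := fun n => by
    simpa [hP] using measure_root_label_and_subtrees q n (S := fun _ => Set.univ) fun _ => .univ
  rw [← hP]
  have hmain : ∀ n, ∀ S : Fin n → Set PlaneTree, (∀ i, MeasurableSet (S i)) →
      P {k | k [] = n} ≠ 0 →
      P[|{k | k [] = n}] (⋂ i, (fun k => (ofDegrees k).childSubtree i.val.succPNat) ⁻¹' S i) =
        ∏ i, P (ofDegrees ⁻¹' S i) := by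
    intro n S hS hne
    have h := measure_root_label_and_subtrees q n (S := fun i => ofDegrees ⁻¹' S i)
      fun i => hmeas (hS i)
    rw [← hP] at h
    have hE : MeasurableSet {k : Node → ℕ | k [] = n} :=
      measurableSet_eq_fun (measurable_pi_apply _) measurable_const
    rw [cond_apply hE,
      show ({k | k [] = n} ∩ ⋂ i, (fun k => (ofDegrees k).childSubtree i.val.succPNat) ⁻¹' S i) =
        {k | k [] = n ∧ ∀ i : Fin n, (fun u => k (i.val.succPNat :: u)) ∈ ofDegrees ⁻¹' S i} from ?_,
      h, ← hroot, ← mul_assoc, ENNReal.inv_mul_cancel hne (measure_ne_top _ _), one_mul]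
    ext k
    simp only [Set.mem_inter_iff, Set.mem_ofPred_eq, Set.mem_iInter, Set.mem_preimage,
      and_congr_right_iff]
    intro hk
    refine forall_congr' fun i => ?_
    rw [childSubtree_ofDegrees k _ (by rw [hk]; simp)]
  -- The marginals are read off the joint law by imposing no condition on the other children.
  have hsingle : ∀ n (i : Fin n) (T : Set PlaneTree), MeasurableSet T →
      P {k | k [] = n} ≠ 0 →
      P[|{k | k [] = n}] ((fun k => (ofDegrees k).childSubtree i.val.succPNat) ⁻¹' T) =
        P (ofDegrees ⁻¹' T) := by
    intro n i T hT hne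
    classical
    have h := hmain n (Function.update (fun _ => Set.univ) i T) (fun j => by
      by_cases hj : j = i
      · subst hj; simpa using hT
      · simp [hj]) hne
    rw [Finset.prod_eq_single i (fun j _ hj => by simp [hj]) (by simp),
      Function.update_self] at h
    rw [← h]
    congr 1
    ext k
    simp only [Set.mem_preimage, Set.mem_iInter]
    constructor
    · intro hk j
      by_cases hj : j = i
      · subst hj; simpa using hk
      · simp [hj]
    · intro hk
      simpa using hk i
  refine ⟨hmeas, fun n => ?_, fun n _ hne => ?_⟩
  · simpa only [hdeg] using hroot n
  simp only [hdeg] at hne ⊢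
  have hcm : ∀ i : Fin n, Measurable fun k => (ofDegrees k).childSubtree i.val.succPNat :=
    fun i => (measurable_childSubtree _).comp hmeas
  refine ⟨?_, fun i => ⟨(hcm i).aemeasurable, hmeas.aemeasurable, ?_⟩⟩
  · rw [iIndepFun_iff_measure_inter_preimage_eq_mul]
    intro s T hT
    classical
    have h := hmain n (fun i => if i ∈ s then T i else Set.univ) (fun i => by
      split_ifs with hi
      · exact hT i hi
      · exact .univ) hne
    rw [show (⋂ i ∈ s, (fun k => (ofDegrees k).childSubtree i.val.succPNat) ⁻¹' T i) =
      ⋂ i, (fun k => (ofDegrees k).childSubtree i.val.succPNat) ⁻¹'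
        (if i ∈ s then T i else Set.univ) from ?_, h, ← Finset.prod_subset s.subset_univ]
    · refine Finset.prod_congr rfl fun i hi => ?_
      rw [if_pos hi, hsingle n i _ (hT i hi) hne]
    · intro i _ hi
      simp [hi]
    · ext k
      simp only [Set.mem_iInter, Set.mem_preimage]
      refine forall_congr' fun i => ?_
      split_ifs with hi <;> simp [hi]
  · ext T hT
    rw [Measure.map_apply (hcm i) hT, Measure.map_apply hmeas hT, hsingle n i T hT hne]

end Existence

/-! ### Convergence in distribution for the local topology -/

section Portmanteau

open PlaneTree

theorem localBall_anti {g h : ℕ} (hgh : g ≤ h) (t : PlaneTree) :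
    localBall h t ⊆ localBall g t := fun _ hs => restrict_mono hgh hs

/-- Weak convergence of probability measures on trees may be tested on balls, from below. -/
theorem tendsto_of_forall_localBall {μ : ProbabilityMeasure PlaneTree}
    {μs : ℕ → ProbabilityMeasure PlaneTree}
    (hball : ∀ (h : ℕ) (t : PlaneTree) (ε : ℝ), 0 < ε → ∀ᶠ n in atTop,
      (μ : Measure PlaneTree).real (localBall h t) - ε ≤
        (μs n : Measure PlaneTree).real (localBall h t)) :
    Tendsto μs atTop (𝓝 μ) := by
  -- Portmanteau criterion: `G` is the increasing union over `h` of unions of balls of height `h`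
  -- contained in `G`.
  refine tendsto_of_forall_isOpen_le_liminf_nat' fun G hG => le_of_forall_lt fun r hr => ?_
  have hGU : G = ⋃ h, {t | localBall h t ⊆ G} := by
    ext t
    simp only [Set.mem_iUnion, Set.mem_ofPred_eq]
    exact ⟨fun ht => exists_restrict_subset hG ht, fun ⟨h, hh⟩ => hh rfl⟩
  have hmono : Monotone fun h => {t | localBall h t ⊆ G} := fun g h hgh t ht =>
    (localBall_anti hgh t).trans ht
  obtain ⟨h, hh⟩ : ∃ h, r < (μ : Measure PlaneTree) {t | localBall h t ⊆ G} := by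
    rw [hGU, hmono.measure_iUnion] at hr
    exact lt_iSup_iff.1 hr
  -- Indexing balls by their truncation makes them countably many and pairwise disjoint; finitely
  -- many then carry mass greater than `r`.
  obtain ⟨V, hV⟩ : ∃ V : Set (Finset Node),
      V = {F : Finset Node | ∃ t : PlaneTree, t.restrict h = (F : Set Node) ∧ localBall h t ⊆ G} := ⟨_, rfl⟩
  have hch : ∀ F : V, ∃ t : PlaneTree, t.restrict h = F.1 ∧ localBall h t ⊆ G := fun F =>
    (Set.ext_iff.1 hV F.1).1 F.2
  choose t ht htG using hch
  have hdis : Pairwise (Function.onFun Disjoint fun F : V => localBall h (t F)) := by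
    intro F F' hne
    refine Set.disjoint_left.2 fun s hs hs' => hne (Subtype.ext ?_)
    have : (F.1 : Set Node) = F'.1 := by
      rw [← ht, ← ht]
      exact (Eq.symm hs).trans hs'
    exact_mod_cast this
  have hU : {t | localBall h t ⊆ G} = ⋃ F : V, localBall h (t F) := by
    ext s
    simp only [Set.mem_iUnion, Set.mem_ofPred_eq]
    constructor
    · intro hs
      refine ⟨⟨(finite_restrict h s).toFinset, ?_⟩, ?_⟩
      · rw [hV]
        exact ⟨s, by simp, hs⟩
      · exact ((ht _).trans (by simp)).symm
    · rintro ⟨F, hF⟩ s' hs'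
      exact htG F (Eq.trans hs' hF)
  rw [hU, measure_iUnion hdis fun F => measurableSet_localBall _ _, ENNReal.tsum_eq_iSup_sum] at hh
  obtain ⟨T, hT⟩ := lt_iSup_iff.1 hh
  have hreal : r.toReal < ∑ F ∈ T, (μ : Measure PlaneTree).real (localBall h (t F)) := by
    rw [show ∑ F ∈ T, (μ : Measure PlaneTree).real (localBall h (t F)) =
      (∑ F ∈ T, (μ : Measure PlaneTree) (localBall h (t F))).toReal from
        (ENNReal.toReal_sum fun F _ => measure_ne_top _ _).symm]
    exact (ENNReal.toReal_lt_toReal hT.ne_top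
      (ENNReal.sum_ne_top.2 fun F _ => measure_ne_top _ _)).2 hT
  obtain ⟨δ, hδ⟩ : ∃ δ, δ = ∑ F ∈ T, (μ : Measure PlaneTree).real (localBall h (t F)) - r.toReal :=
    ⟨_, rfl⟩
  have hδ0 : 0 < δ := by rw [hδ]; linarith
  obtain ⟨N, hN⟩ : ∃ N : ℝ, N = T.card := ⟨_, rfl⟩
  have hN0 : 0 ≤ N := hN ▸ T.card.cast_nonneg
  obtain ⟨c, hc⟩ : ∃ c, r < c ∧ ∀ᶠ n in atTop, c ≤ (μs n : Measure PlaneTree) G := by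
    refine ⟨ENNReal.ofReal (r.toReal + δ / 2), ?_, ?_⟩
    · rw [ENNReal.lt_ofReal_iff_toReal_lt hT.ne_top]
      linarith
    · have hev : ∀ᶠ n in atTop, ∀ F ∈ T, (μ : Measure PlaneTree).real (localBall h (t F)) -
          δ / (2 * (N + 1)) ≤ (μs n : Measure PlaneTree).real (localBall h (t F)) :=
        (Finset.eventually_all T).2 fun F _ => hball h (t F) _ (by positivity)
      filter_upwards [hev] with n hn
      refine ENNReal.ofReal_le_of_le_toReal ?_
      have h1 : ∑ F ∈ T, (μs n : Measure PlaneTree).real (localBall h (t F)) ≤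
          (μs n : Measure PlaneTree).real G := by
        rw [← measureReal_biUnion_finset (fun F _ F' _ hne => hdis hne)
          fun F _ => measurableSet_localBall _ _]
        exact measureReal_mono (Set.iUnion₂_subset fun F _ => htG F)
      have h2 := Finset.sum_le_sum hn
      rw [Finset.sum_sub_distrib, Finset.sum_const, nsmul_eq_mul, ← hN] at h2
      have h3 : N * (δ / (2 * (N + 1))) ≤ δ / 2 := by
        rw [mul_div_assoc', div_le_div_iff₀ (by positivity) (by positivity)]
        nlinarith
      have h4 : (μs n : Measure PlaneTree).real G = ((μs n : Measure PlaneTree) G).toReal := rfl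
      rw [← h4]
      linarith
  exact hc.1.trans_le (le_liminf_of_le (by isBoundedDefault) hc.2)

end Portmanteau

/-! ### The reduced tree -/

section Reduced

open PowerSeries PlaneTree

variable {p : PMF ℕ} {Ω : Type*} [MeasurableSpace Ω] {P : Measure Ω} [IsProbabilityMeasure P]
  {τ : Ω → PlaneTree}

theorem genFun_treeSeries_nonneg (hτ : Measurable τ) (A : Set ℕ) {s : ℝ} (h0 : 0 ≤ s) :
    0 ≤ genFun (treeSeries A τ P Set.univ) s :=
  (isMass_treeSeries A hτ .univ).genFun_nonneg h0

theorem genFun_treeSeries_le_one (hτ : Measurable τ) (A : Set ℕ) {s : ℝ} (h0 : 0 ≤ s)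
    (h1 : s ≤ 1) : genFun (treeSeries A τ P Set.univ) s ≤ 1 := by
  refine ((isMass_treeSeries A hτ .univ).genFun_mono h0 h1 le_rfl).trans ?_
  rw [genFun_treeSeries_one A hτ .univ]
  exact measureReal_le_one

/-- Decomposition at the root, which contributes a factor `s` exactly when its degree is in `A`. -/
theorem IsGWTree.genFun_treeSeries_eq (hτ : IsGWTree p τ P) (A : Set ℕ) {s : ℝ} (h0 : 0 ≤ s)
    (h1 : s ≤ 1) : genFun (treeSeries A τ P Set.univ) s =
      s * genFun (restrictSeries p A) (genFun (treeSeries A τ P Set.univ) s) +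
        genFun (restrictSeries p Aᶜ) (genFun (treeSeries A τ P Set.univ) s) := by
  have hx0 := genFun_treeSeries_nonneg (P := P) hτ.measurable A h0
  have hx1 := genFun_treeSeries_le_one (P := P) hτ.measurable A h0 h1
  have h := hτ.hasSum_genFun_treeSeries A h0 h1
  obtain ⟨x, hx⟩ : ∃ x, x = genFun (treeSeries A τ P Set.univ) s := ⟨_, rfl⟩
  rw [← hx] at hx0 hx1 h ⊢
  have h' := (((isMass_restrictSeries p A).summable_mul_pow hx0 hx1).hasSum.mul_left s).add
    ((isMass_restrictSeries p Aᶜ).summable_mul_pow hx0 hx1).hasSum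
  refine h.unique (h'.congr_fun fun n => ?_)
  rw [coeff_restrictSeries, coeff_restrictSeries]
  by_cases hn : n ∈ A
  · simp [hn]; ring
  · simp [hn]

theorem restrictSeries_univ (p : PMF ℕ) : restrictSeries p Set.univ = pmfSeries p := by
  ext n
  rw [coeff_restrictSeries, coeff_pmfSeries]
  simp

theorem restrictSeries_empty (p : PMF ℕ) : restrictSeries p ∅ = 0 := by
  ext n
  rw [coeff_restrictSeries]
  simp

theorem IsGWTree.genFun_treeSeries_univ_eq (hτ : IsGWTree p τ P) {s : ℝ} (h0 : 0 ≤ s)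
    (h1 : s ≤ 1) : genFun (treeSeries Set.univ τ P Set.univ) s =
      s * genFun (pmfSeries p) (genFun (treeSeries Set.univ τ P Set.univ) s) := by
  have h := hτ.genFun_treeSeries_eq Set.univ h0 h1
  rw [restrictSeries_univ, Set.compl_univ, restrictSeries_empty,
    show ∀ x, genFun 0 x = 0 from fun x => by simp [genFun], add_zero] at h
  exact h

theorem IsGWTree.coeff_zero_treeSeries_univ (hτ : IsGWTree p τ P) :
    coeff 0 (treeSeries Set.univ τ P Set.univ) = 0 := by
  rw [coeff_zero_eq_genFun]
  simpa using hτ.genFun_treeSeries_univ_eq le_rfl zero_le_one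

theorem exists_mem_ne_zero_of_tsum_pos {A : Set ℕ} (hA : 0 < ∑' n : A, p n) :
    ∃ n ∈ A, 0 < (p n).toReal := by
  by_contra! h
  refine hA.ne' (ENNReal.tsum_eq_zero.2 fun n => ?_)
  have := le_antisymm (h n n.2) ENNReal.toReal_nonneg
  simpa [ENNReal.toReal_eq_zero_iff, p.apply_ne_top] using this

theorem IsGWTree.coeff_zero_treeSeries_eq (hτ : IsGWTree p τ P) (A : Set ℕ) :
    genFun (restrictSeries p Aᶜ) (coeff 0 (treeSeries A τ P Set.univ)) =
      coeff 0 (treeSeries A τ P Set.univ) := by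
  rw [coeff_zero_eq_genFun]
  simpa using (hτ.genFun_treeSeries_eq A le_rfl zero_le_one).symm

/-- The value `1` would give `g_{Aᶜ}(1) = 1`, leaving no mass for `A`. -/
theorem IsGWTree.coeff_zero_treeSeries_lt_one (hτ : IsGWTree p τ P) {A : Set ℕ}
    (hA : 0 < ∑' n : A, p n) : coeff 0 (treeSeries A τ P Set.univ) < 1 := by
  have hle : coeff 0 (treeSeries A τ P Set.univ) ≤ 1 := by
    rw [coeff_zero_eq_genFun]
    exact genFun_treeSeries_le_one hτ.measurable A le_rfl zero_le_one
  refine lt_of_le_of_ne hle fun h => ?_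
  have h1 := hτ.coeff_zero_treeSeries_eq A
  rw [h] at h1
  have hMA := isMass_restrictSeries p A
  have h2 := hMA.genFun_add (isMass_restrictSeries p Aᶜ) zero_le_one le_rfl
  rw [restrictSeries_add_compl, genFun_pmfSeries_one, h1] at h2
  obtain ⟨n, hn, hpn⟩ := exists_mem_ne_zero_of_tsum_pos hA
  have h3 := hMA.coeff_le_genFun_one n
  rw [coeff_restrictSeries, if_pos hn] at h3
  linarith

theorem IsGWTree.genFun_restrictSeries_coeff_zero_pos (hτ : IsGWTree p τ P)
    (hp : IsNondegenerate p) {A : Set ℕ} (hA : 0 < ∑' n : A, p n) :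
    0 < genFun (restrictSeries p A) (coeff 0 (treeSeries A τ P Set.univ)) := by
  have hMA := isMass_restrictSeries p A
  have ha0 : 0 ≤ coeff 0 (treeSeries A τ P Set.univ) :=
    (isMass_treeSeries A hτ.measurable .univ).1 0
  have ha1 := (hτ.coeff_zero_treeSeries_lt_one hA).le
  have hp0 : 0 < (p 0).toReal := ENNReal.toReal_pos hp.1.ne' (p.apply_ne_top 0)
  have hpos : ∀ n ∈ A, 0 < (p n).toReal * coeff 0 (treeSeries A τ P Set.univ) ^ n →
      0 < genFun (restrictSeries p A) (coeff 0 (treeSeries A τ P Set.univ)) := by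
    intro n hn h
    refine h.trans_le ?_
    have h1 := (hMA.summable_mul_pow ha0 ha1).le_tsum n
      fun m _ => mul_nonneg (hMA.1 m) (pow_nonneg ha0 m)
    rwa [coeff_restrictSeries, if_pos hn] at h1
  -- If `a = 0`, then `0 ∈ A`, since otherwise `g_{Aᶜ}(0) = p(0) > 0` would differ from `a`. If `a >
  -- 0`, any charged element of `A` will do.
  rcases ha0.eq_or_lt with h0 | h0
  · refine hpos 0 ?_ (by simpa using hp0)
    by_contra hn
    have h1 := hτ.coeff_zero_treeSeries_eq A
    rw [← h0, ← coeff_zero_eq_genFun, coeff_restrictSeries, if_pos (show 0 ∈ Aᶜ from hn)] at h1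
    exact hp0.ne' h1
  · obtain ⟨n, hn, hpn⟩ := exists_mem_ne_zero_of_tsum_pos hA
    exact hpos n hn (by positivity)

theorem measure_numDegreeIn_eq_top (hτ : Measurable τ) {A : Set ℕ}
    (h : genFun (treeSeries A τ P Set.univ) 1 = 1) : P {ω | (τ ω).numDegreeIn A = ⊤} = 0 := by
  rw [genFun_treeSeries_one A hτ .univ] at h
  have hm := measurableSet_numDegreeIn A hτ .univ {m | m ≠ ⊤}
  have h1 := (prob_compl_eq_zero_iff (μ := P) hm).2 (by
    rwa [← ENNReal.toReal_eq_one_iff])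
  convert h1 using 2
  ext ω
  simp

theorem measureReal_numDegreeIn_pos (hτ : Measurable τ) (A : Set ℕ) :
    P.real {ω | 0 < (τ ω).numDegreeIn A} = 1 - coeff 0 (treeSeries A τ P Set.univ) := by
  have hm : MeasurableSet {ω | τ ω ∈ Set.univ ∧ (τ ω).numDegreeIn A = ((0 : ℕ) : ℕ∞)} :=
    measurableSet_numDegreeIn A hτ .univ {((0 : ℕ) : ℕ∞)}
  rw [coeff_treeSeries, ← probReal_compl_eq_one_sub hm]
  congr 1
  ext ω
  simp [pos_iff_ne_zero]

theorem measurableSet_numDegreeIn_pos (hτ : Measurable τ) (A : Set ℕ) :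
    MeasurableSet {ω | 0 < (τ ω).numDegreeIn A} := by
  simpa using measurableSet_numDegreeIn A hτ .univ {m | 0 < m}

theorem measureReal_numDegreeIn_eq {Q : Measure Ω} (A : Set ℕ) (m : ℕ) :
    Q.real {ω | (τ ω).numDegreeIn A = m} = coeff m (treeSeries A τ Q Set.univ) := by
  simp [coeff_treeSeries]

theorem measureReal_size_eq {Q : Measure Ω} (m : ℕ) :
    Q.real {ω | (τ ω).size = m} = coeff m (treeSeries Set.univ τ Q Set.univ) := by
  simp only [size_eq_numDegreeIn_univ, measureReal_numDegreeIn_eq]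

theorem genFun_one_of_coeff_succ {f g : PowerSeries ℝ} (hf : IsMass f) (hg : IsMass g)
    (hg1 : genFun g 1 = 1) (hg0 : coeff 0 g = 0)
    (h : ∀ n, coeff (n + 1) f = (1 - coeff 0 f) * coeff (n + 1) g) : genFun f 1 = 1 := by
  have h1 := hf.2.tsum_eq_zero_add
  have h2 := hg.2.tsum_eq_zero_add
  simp only [h, tsum_mul_left] at h1
  simp only [genFun, one_pow, mul_one] at hg1 ⊢
  rw [hg1, hg0, zero_add] at h2
  rw [h1, ← h2]
  ring

/-- `(G - a) / (1 - a)` and the generating function of the size of a tree with offspring law `q`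
solve the same equation `x = s q(x)`; uniqueness for `s < 1` and identification of coefficients
conclude. -/
theorem IsGWTree.exists_isReducedOffspring (hτ : IsGWTree p τ P) (hm : offspringMean p = 1)
    (hp : IsNondegenerate p) {A : Set ℕ} (hA : 0 < ∑' n : A, p n) :
    ∃ q : PMF ℕ, IsReducedOffspring A τ P q := by
  have hMΛ := isMass_treeSeries (P := P) A hτ.measurable .univ
  have ha0 := hMΛ.1 0
  have ha1 := hτ.coeff_zero_treeSeries_lt_one hA
  have hreal := measureReal_numDegreeIn_pos (P := P) hτ.measurable A
  obtain ⟨q, hq1, hq2, hq⟩ := exists_reduced_pmf hm A ha0 ha1 (hτ.coeff_zero_treeSeries_eq A)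
    (hτ.genFun_restrictSeries_coeff_zero_pos hp hA)
  have hσ := isGWTree_ofDegrees q
  obtain ⟨P₁, hP₁⟩ : ∃ P₁, P₁ = Measure.infinitePi fun _ : Node => q.toMeasure := ⟨_, rfl⟩
  have hP₁p : IsProbabilityMeasure P₁ := by rw [hP₁]; infer_instance
  rw [← hP₁] at hσ
  have hMB := isMass_treeSeries (P := P₁) Set.univ hσ.measurable .univ
  obtain ⟨hB1, -⟩ := hσ.isCriticalPair hq1 hq2
  have hB0 := hσ.coeff_zero_treeSeries_univ
  have hnn := fun s (h : 0 ≤ s) => genFun_treeSeries_nonneg (P := P₁) hσ.measurable Set.univ h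
  have hle := fun s (h : 0 ≤ s) h' =>
    genFun_treeSeries_le_one (P := P₁) hσ.measurable Set.univ (s := s) h h'
  have hBs := fun s (h : 0 ≤ s) h' => hσ.genFun_treeSeries_univ_eq (s := s) h h'
  have hGs := fun s (h : 0 ≤ s) h' => hτ.genFun_treeSeries_eq A (s := s) h h'
  have hGle := fun s (h : 0 ≤ s) h' => genFun_treeSeries_le_one (P := P) hτ.measurable A (s := s) h h'
  have hGa : ∀ s, 0 ≤ s → s ≤ 1 → coeff 0 (treeSeries A τ P Set.univ) ≤
      genFun (treeSeries A τ P Set.univ) s := fun s h0 h1 => by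
    rw [coeff_zero_eq_genFun]
    exact hMΛ.genFun_mono le_rfl h0 h1
  refine ⟨q, hq1, hq2, Node → ℕ, inferInstance, P₁, ofDegrees, hP₁p, hσ, ?_⟩
  have hcoeffΛ := fun m => measureReal_numDegreeIn_eq (Q := P) (τ := τ) A m
  have hcoeffB := fun m => measureReal_size_eq (Q := P₁) (τ := ofDegrees) m
  have htopΛ := measure_numDegreeIn_eq_top (P := P) (A := A) hτ.measurable
  have htopB := measure_numDegreeIn_eq_top (P := P₁) (A := Set.univ) hσ.measurable hB1
  obtain ⟨Λ, hΛ⟩ : ∃ Λ, Λ = treeSeries A τ P Set.univ := ⟨_, rfl⟩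
  obtain ⟨B, hB⟩ : ∃ B, B = treeSeries Set.univ ofDegrees P₁ Set.univ := ⟨_, rfl⟩
  rw [← hB] at hMB hB1 hB0 hnn hle hBs hcoeffB
  rw [← hΛ] at hMΛ ha0 ha1 hreal hq hGs hGle hGa hcoeffΛ htopΛ
  obtain ⟨a, ha⟩ : ∃ a, a = coeff 0 Λ := ⟨_, rfl⟩
  rw [← ha] at ha0 ha1 hreal hq hGa
  have hb : 0 < 1 - a := by linarith
  have hkey : ∀ s, 0 ≤ s → s < 1 → genFun Λ s = a + (1 - a) * genFun B s := by
    intro s h0 h1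
    have hH : a + (1 - a) * ((genFun Λ s - a) / (1 - a)) = genFun Λ s := by
      rw [mul_div_cancel₀ _ hb.ne']; ring
    have hH0 : 0 ≤ (genFun Λ s - a) / (1 - a) :=
      div_nonneg (sub_nonneg.2 (hGa s h0 h1.le)) hb.le
    have hH1 : (genFun Λ s - a) / (1 - a) ≤ 1 := by
      rw [div_le_one hb]
      linarith [hGle s h0 h1.le]
    have h2 := eq_of_eq_mul_genFun hq1 h0 h1 hH0 hH1 (hnn s h0) (hle s h0 h1.le)
      (hq s _ hH0 hH1 (by rw [hH]; exact hGs s h0 h1.le)) (hBs s h0 h1.le)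
    rw [← h2, hH]
  have hcoef : ∀ n, coeff (n + 1) Λ = (1 - a) * coeff (n + 1) B := by
    intro n
    have hF : IsMass (C a + C (1 - a) * B) := by
      have := (IsMass.one.C_mul ha0).add (hMB.C_mul hb.le)
      rwa [mul_one] at this
    have hs : ∀ s, 0 ≤ s → s ≤ 1 → genFun (C a + C (1 - a) * B) s = a + (1 - a) * genFun B s := by
      intro s h0 h1
      have := (IsMass.one.C_mul ha0).genFun_add (hMB.C_mul hb.le) h0 h1
      rw [genFun_C_mul, genFun_C_mul, IsMass.genFun_one, mul_one, mul_one] at this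
      exact this
    have h := eq_zero_of_tsum_mul_pow_eq_zero
      (c := fun n => coeff n Λ - coeff n (C a + C (1 - a) * B)) (hMΛ.2.sub hF.2).abs
      (fun s h0 h1 => by
        have h2 := hkey s h0.le h1
        rw [← hs s h0.le h1.le] at h2
        simp only [sub_mul]
        rw [(hMΛ.summable_mul_pow h0.le h1.le).tsum_sub (hF.summable_mul_pow h0.le h1.le)]
        exact sub_eq_zero.2 h2) (n + 1)
    simp only [map_add, coeff_C_mul] at h
    rw [coeff_C, if_neg n.succ_ne_zero] at h
    linarith
  -- Finiteness of `L_A(τ)` is inherited from that of the reduced tree; it settles the value `⊤`.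
  have hΛ1 : genFun Λ 1 = 1 := genFun_one_of_coeff_succ hMΛ hMB hB1 hB0 (ha ▸ hcoef)
  have hpos : P {ω | 0 < (τ ω).numDegreeIn A} ≠ 0 := by
    intro h
    rw [measureReal_def, h, ENNReal.toReal_zero] at hreal
    linarith
  intro n
  rw [cond_apply (measurableSet_numDegreeIn_pos hτ.measurable A)]
  induction n using ENat.recTopCoe with
  | top =>
    rw [measure_mono_null Set.inter_subset_right (htopΛ hΛ1), mul_zero]
    simp only [size_eq_numDegreeIn_univ]
    exact htopB.symm
  | coe n =>
    rcases n with _ | n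
    · have h1 : {ω | 0 < (τ ω).numDegreeIn A} ∩ {ω | (τ ω).numDegreeIn A = ((0 : ℕ) : ℕ∞)} = ∅ := by
        ext ω
        simp only [Set.mem_inter_iff, Set.mem_ofPred_eq, Set.mem_empty_iff_false, iff_false, not_and,
          Nat.cast_zero]
        exact fun h => h.ne'
      have h2 := hcoeffB 0
      rw [hB0, measureReal_eq_zero_iff] at h2
      rw [h1, measure_empty, mul_zero, h2]
    · have h1 : {ω | 0 < (τ ω).numDegreeIn A} ∩ {ω | (τ ω).numDegreeIn A = ((n + 1 : ℕ) : ℕ∞)} =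
          {ω | (τ ω).numDegreeIn A = ((n + 1 : ℕ) : ℕ∞)} := by
        ext ω
        simp only [Set.mem_inter_iff, Set.mem_ofPred_eq, and_iff_right_iff_imp]
        intro h
        rw [h]
        exact_mod_cast n.succ_pos
      have h2 : P {ω | (τ ω).numDegreeIn A = ((n + 1 : ℕ) : ℕ∞)} =
          P {ω | 0 < (τ ω).numDegreeIn A} * P₁ {k | (ofDegrees k).size = ((n + 1 : ℕ) : ℕ∞)} := by
        rw [← ENNReal.toReal_eq_toReal_iff' (measure_ne_top _ _)
          (ENNReal.mul_ne_top (measure_ne_top _ _) (measure_ne_top _ _)), ENNReal.toReal_mul]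
        simp only [← measureReal_def]
        rw [hcoeffΛ, hcoeffB, hreal, hcoef]
      rw [h1, h2, ← mul_assoc, ENNReal.inv_mul_cancel hpos (measure_ne_top _ _), one_mul]

end Reduced

/-! ### Convergence of conditioned Galton-Watson trees -/

section Period

open PowerSeries

/-- The integers `k` in the definition are the divisors of the gcd of the support; positivity of the
gcd makes it the greatest of them. -/
theorem offspringPeriod_eq_setGcd {q : PMF ℕ} (h : 0 < Nat.setGcd (coeffSupport (pmfSeries q))) :
    offspringPeriod q = Nat.setGcd (coeffSupport (pmfSeries q)) := by
  have hset : {k : ℕ | q.toMeasure {n : ℕ | k ∣ n} = 1} =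
      {k | k ∣ Nat.setGcd (coeffSupport (pmfSeries q))} := by
    ext k
    rw [Set.mem_ofPred_eq, PMF.toMeasure_apply_eq_one_iff q .of_discrete, Set.mem_ofPred_eq,
      Nat.dvd_setGcd_iff]
    refine forall_congr' fun n => ?_
    rw [show n ∈ coeffSupport (pmfSeries q) ↔ n ∈ q.support by
      simp [coeffSupport, coeff_pmfSeries, PMF.mem_support_iff, ENNReal.toReal_eq_zero_iff,
        q.apply_ne_top]]
    rfl
  unfold offspringPeriod
  rw [hset]
  exact IsGreatest.csSup_eq ⟨dvd_rfl, fun k hk => Nat.le_of_dvd h hk⟩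

end Period

/-! ### Window probabilities of `L_A(τ)` -/

section Windows

open PowerSeries PlaneTree

variable {p q : PMF ℕ} {Ω : Type*} [MeasurableSpace Ω] {P : Measure Ω} [IsProbabilityMeasure P]
  {τ : Ω → PlaneTree}

theorem coeff_succ_treeSeries_of_isReducedOffspring (hτ : IsGWTree p τ P) {A : Set ℕ}
    {Ω₁ : Type} [MeasurableSpace Ω₁] {P₁ : Measure Ω₁} {σ : Ω₁ → PlaneTree}
    (hA : 0 < ∑' n : A, p n)
    (h : ∀ n : ℕ∞, P[|{ω | 0 < (τ ω).numDegreeIn A}] {ω | (τ ω).numDegreeIn A = n} =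
        P₁ {ω | (σ ω).size = n}) (n : ℕ) :
    coeff (n + 1) (treeSeries A τ P Set.univ) =
      (1 - coeff 0 (treeSeries A τ P Set.univ)) *
        coeff (n + 1) (treeSeries Set.univ σ P₁ Set.univ) := by
  have hreal := measureReal_numDegreeIn_pos (P := P) hτ.measurable A
  have ha1 := hτ.coeff_zero_treeSeries_lt_one hA
  have hn := congrArg ENNReal.toReal (h ((n + 1 : ℕ) : ℕ∞))
  have h1 : {ω | 0 < (τ ω).numDegreeIn A} ∩ {ω | (τ ω).numDegreeIn A = ((n + 1 : ℕ) : ℕ∞)} =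
      {ω | (τ ω).numDegreeIn A = ((n + 1 : ℕ) : ℕ∞)} := by
    ext ω
    simp only [Set.mem_inter_iff, Set.mem_ofPred_eq, and_iff_right_iff_imp]
    intro h
    rw [h]
    exact_mod_cast n.succ_pos
  rw [cond_apply (measurableSet_numDegreeIn_pos hτ.measurable A), h1, ENNReal.toReal_mul,
    ENNReal.toReal_inv] at hn
  simp only [← measureReal_def] at hn
  rw [hreal, measureReal_numDegreeIn_eq, measureReal_size_eq] at hn
  rw [← hn, mul_inv_cancel_left₀ (by linarith)]

theorem windowSum_treeSeries (hτ : Measurable τ) (A : Set ℕ) {S : Set PlaneTree}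
    (hS : MeasurableSet S) (d n : ℕ) : windowSum d (treeSeries A τ P S) n =
      P.real {ω | τ ω ∈ S ∧ (n : ℕ∞) ≤ (τ ω).numDegreeIn A ∧
        (τ ω).numDegreeIn A < ((n + d : ℕ) : ℕ∞)} := by
  have h : {ω | τ ω ∈ S ∧ (n : ℕ∞) ≤ (τ ω).numDegreeIn A ∧
      (τ ω).numDegreeIn A < ((n + d : ℕ) : ℕ∞)} =
      ⋃ j ∈ Finset.range d, {ω | τ ω ∈ S ∧ (τ ω).numDegreeIn A = ((n + j : ℕ) : ℕ∞)} := by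
    ext ω
    simp only [Set.mem_ofPred_eq, Set.mem_iUnion, Finset.mem_range, exists_prop]
    constructor
    · rintro ⟨h1, h2, h3⟩
      obtain ⟨m, hm⟩ := ENat.ne_top_iff_exists.1 h3.ne_top
      rw [← hm] at h2 h3 ⊢
      have h2' : n ≤ m := by exact_mod_cast h2
      have h3' : m < n + d := by exact_mod_cast h3
      exact ⟨m - n, by omega, h1, by rw [Nat.add_sub_cancel' h2']⟩
    · rintro ⟨j, hj, h1, h2⟩
      rw [h2]
      exact ⟨h1, by exact_mod_cast Nat.le_add_right n j, by exact_mod_cast Nat.add_lt_add_left hj n⟩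
  rw [h, measureReal_biUnion_finset]
  · simp only [windowSum, coeff_treeSeries]
  · intro i _ j _ hij
    refine Set.disjoint_left.2 fun ω h1 h2 => hij ?_
    have : n + i = n + j := by exact_mod_cast h1.2.symm.trans h2.2
    omega
  · exact fun j _ => measurableSet_numDegreeIn A hτ hS {((n + j : ℕ) : ℕ∞)}

/-- Consecutive windows of length `d` tile the finite values above `n`; this transfers window
estimates to the event `L_A(τ) ≥ n`. -/
theorem hasSum_windowSum_treeSeries (hτ : Measurable τ) (A : Set ℕ) {S : Set PlaneTree}
    (hS : MeasurableSet S) {d : ℕ} (hd : 0 < d) (n : ℕ) :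
    HasSum (fun i => windowSum d (treeSeries A τ P S) (n + i * d))
      (P.real {ω | τ ω ∈ S ∧ (n : ℕ∞) ≤ (τ ω).numDegreeIn A ∧ (τ ω).numDegreeIn A ≠ ⊤}) := by
  simp only [windowSum_treeSeries hτ A hS]
  have h : {ω | τ ω ∈ S ∧ (n : ℕ∞) ≤ (τ ω).numDegreeIn A ∧ (τ ω).numDegreeIn A ≠ ⊤} =
      ⋃ i : ℕ, {ω | τ ω ∈ S ∧ ((n + i * d : ℕ) : ℕ∞) ≤ (τ ω).numDegreeIn A ∧
        (τ ω).numDegreeIn A < ((n + i * d + d : ℕ) : ℕ∞)} := by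
    ext ω
    simp only [Set.mem_ofPred_eq, Set.mem_iUnion]
    constructor
    · rintro ⟨h1, h2, h3⟩
      obtain ⟨m, hm⟩ := ENat.ne_top_iff_exists.1 h3
      rw [← hm] at h2 ⊢
      have h2' : n ≤ m := by exact_mod_cast h2
      have h4 := Nat.div_add_mod (m - n) d
      have h5 := Nat.mod_lt (m - n) hd
      rw [mul_comm] at h4
      exact ⟨(m - n) / d, h1, by exact_mod_cast (by omega), by exact_mod_cast (by omega)⟩
    · rintro ⟨i, h1, h2, h3⟩
      exact ⟨h1, le_trans (by exact_mod_cast Nat.le_add_right n _) h2, h3.ne_top⟩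
  have hdis : Pairwise (Function.onFun Disjoint fun i : ℕ => {ω | τ ω ∈ S ∧
      ((n + i * d : ℕ) : ℕ∞) ≤ (τ ω).numDegreeIn A ∧
        (τ ω).numDegreeIn A < ((n + i * d + d : ℕ) : ℕ∞)}) := by
    intro i j hij
    refine Set.disjoint_left.2 fun ω h1 h2 => hij ?_
    have h3 : n + i * d < n + j * d + d := by exact_mod_cast h1.2.1.trans_lt h2.2.2
    have h4 : n + j * d < n + i * d + d := by exact_mod_cast h2.2.1.trans_lt h1.2.2
    have h5 : i < j + 1 := lt_of_mul_lt_mul_right (a := d) (by linarith) d.zero_le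
    have h6 : j < i + 1 := lt_of_mul_lt_mul_right (a := d) (by linarith) d.zero_le
    omega
  have hU := measure_iUnion (μ := P) hdis fun i => measurableSet_numDegreeIn A hτ hS
    {m | ((n + i * d : ℕ) : ℕ∞) ≤ m ∧ m < ((n + i * d + d : ℕ) : ℕ∞)}
  rw [h, measureReal_def, hU, ENNReal.tsum_toReal_eq fun _ => measure_ne_top _ _]
  exact ENNReal.hasSum_toReal (hU ▸ measure_ne_top _ _)

/-- The windows of the law of `L_A(τ)`, when `L_A(τ)` reduces to a critical offspring
distribution. -/
theorem IsGWTree.tendsto_windowSum_treeSeries (hτ : IsGWTree p τ P) {A : Set ℕ}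
    (hA : 0 < ∑' n : A, p n) (hq : IsReducedOffspring A τ P q) :
    genFun (treeSeries A τ P Set.univ) 1 = 1 ∧ 0 < offspringPeriod q ∧
    (∀ᶠ n in atTop, 0 < windowSum (offspringPeriod q) (treeSeries A τ P Set.univ) n) ∧
    Tendsto (fun n => windowSum (offspringPeriod q) (treeSeries A τ P Set.univ) (n + 1) /
      windowSum (offspringPeriod q) (treeSeries A τ P Set.univ) n) atTop (𝓝 1) := by
  obtain ⟨hq1, hq2, Ω₁, _, P₁, σ, hP₁, hσ, h⟩ := hq
  have hcoef := coeff_succ_treeSeries_of_isReducedOffspring hτ hA h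
  obtain ⟨hB1, hcrit⟩ := hσ.isCriticalPair hq1 hq2
  obtain ⟨hpos, hlim⟩ := hcrit.tendsto_windowSum
  have hd := hcrit.setGcd_pos
  have hper := offspringPeriod_eq_setGcd hd
  rw [← hper] at hd hpos hlim
  have hb : 0 < 1 - coeff 0 (treeSeries A τ P Set.univ) := by
    linarith [hτ.coeff_zero_treeSeries_lt_one hA]
  -- The laws are proportional only off `0`: `L_A(τ)` may vanish while a size is at least `1`. Hence
  -- windows starting at `n + 1`.
  have hw : ∀ n, windowSum (offspringPeriod q) (treeSeries A τ P Set.univ) (n + 1) =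
      (1 - coeff 0 (treeSeries A τ P Set.univ)) *
        windowSum (offspringPeriod q) (treeSeries Set.univ σ P₁ Set.univ) (n + 1) := by
    intro n
    unfold windowSum
    rw [Finset.mul_sum]
    refine Finset.sum_congr rfl fun j _ => ?_
    rw [show n + 1 + j = n + j + 1 by ring, hcoef]
  refine ⟨genFun_one_of_coeff_succ (isMass_treeSeries A hτ.measurable .univ)
    (isMass_treeSeries Set.univ hσ.measurable .univ) hB1 hσ.coeff_zero_treeSeries_univ hcoef,
    hd, ?_, ?_⟩
  · filter_upwards [hpos, eventually_ge_atTop 1] with n hn h1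
    obtain ⟨n, rfl⟩ := Nat.exists_eq_add_of_le' h1
    rw [hw]
    exact mul_pos hb hn
  · refine hlim.congr' ?_
    filter_upwards [eventually_ge_atTop 1] with n h1
    obtain ⟨n, rfl⟩ := Nat.exists_eq_add_of_le' h1
    rw [hw, hw, mul_div_mul_left _ _ hb.ne']

end Windows

/-! ### From window estimates to convergence of conditioned trees -/

section Conditioned

open PlaneTree

variable {p : PMF ℕ} {h0 : offspringMean p ≠ 0} {h1 : offspringMean p ≠ ∞}
  {Ω : Type*} [MeasurableSpace Ω] {P : Measure Ω} [IsProbabilityMeasure P] {τ : Ω → PlaneTree}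

theorem tendstoInDistribution_of_isConditionedOn (hτ : Measurable τ) {E : ℕ → Set Ω}
    (hE : ∀ n, MeasurableSet (E n)) (hpos : ∀ᶠ n in atTop, P (E n) ≠ 0)
    (hball : ∀ (h : ℕ) (t : PlaneTree) (ε : ℝ), 0 < ε → ∀ᶠ n in atTop,
      ((kestenLaw p h0 h1).real (localBall h t) - ε) * P.real (E n) ≤
        P.real (E n ∩ τ ⁻¹' localBall h t))
    {Ω' : Type*} [MeasurableSpace Ω'] {P' : Measure Ω'} [IsProbabilityMeasure P']
    {τstar : Ω' → PlaneTree} (hτstar : IsKestenTree p h0 h1 τstar P')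
    {Ωₙ : ℕ → Type*} [∀ n, MeasurableSpace (Ωₙ n)] {Pₙ : ∀ n, Measure (Ωₙ n)}
    [∀ n, IsProbabilityMeasure (Pₙ n)] {τₙ : ∀ n, Ωₙ n → PlaneTree}
    (hτₙ : ∀ n, Measurable (τₙ n)) (hc : IsConditionedOn τ P E τₙ Pₙ) :
    TendstoInDistribution τₙ atTop τstar Pₙ P' := by
  refine ⟨fun n => (hτₙ n).aemeasurable, hτstar.measurable.aemeasurable,
    tendsto_of_forall_localBall fun h t ε hε => ?_⟩
  filter_upwards [hpos, hball h t ε hε] with n hn hb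
  change (P'.map τstar).real _ - ε ≤ ((Pₙ n).map (τₙ n)).real _
  have hEn : 0 < P.real (E n) := ENNReal.toReal_pos hn (measure_ne_top _ _)
  rw [hτstar.law, (hc n hn).map_eq, map_measureReal_apply hτ (measurableSet_localBall h t),
    measureReal_def P[|E n], cond_apply (hE n), ENNReal.toReal_mul, ENNReal.toReal_inv,
    ← measureReal_def, ← measureReal_def, ← div_eq_inv_mul, le_div_iff₀ hEn]
  exact hb

/-- Asymptotically, the windows of the law of `L_A(τ)` restricted to a ball are at least those
given by Kesten's tree. -/
theorem IsGWTree.eventually_kestenLaw_le (hτ : IsGWTree p τ P) (hm : offspringMean p = 1)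
    {A : Set ℕ} {d : ℕ} (hΛ : genFun (treeSeries A τ P Set.univ) 1 = 1)
    (hpos : ∀ᶠ n in atTop, 0 < windowSum d (treeSeries A τ P Set.univ) n)
    (hlim : Tendsto (fun n => windowSum d (treeSeries A τ P Set.univ) (n + 1) /
      windowSum d (treeSeries A τ P Set.univ) n) atTop (𝓝 1)) (h : ℕ) (t : PlaneTree) {ε : ℝ}
    (hε : 0 < ε) : ∀ᶠ n in atTop, ((kestenLaw p h0 h1).real (localBall h t) - ε) *
      windowSum d (treeSeries A τ P Set.univ) n ≤
        windowSum d (treeSeries A τ P (localBall h t)) n := by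
  -- The windows of `L_A(τ)` serve as the reference sequence, so the unrestricted series has weight
  -- `1` because its total mass is `1`.
  have hunit : HasTailWeight (windowSum d (treeSeries A τ P Set.univ)) d
      (treeSeries A τ P Set.univ) 1 := by
    intro ε hε
    filter_upwards [hpos] with n hn
    rw [hΛ]
    nlinarith
  filter_upwards [hτ.hasTailWeight_localBall A hpos hlim hunit h t ε hε, hpos] with n hn hn0
  refine le_trans (mul_le_mul_of_nonneg_right (sub_le_sub_right ?_ ε) hn0.le) hn
  rw [genFun_treeSeries_one A hτ.measurable (measurableSet_localBall h t)]
  have h2 : P {ω | τ ω ∈ localBall h t ∧ (τ ω).numDegreeIn A ≠ ⊤} = P (τ ⁻¹' localBall h t) := by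
    refine measure_congr ?_
    filter_upwards [measure_eq_zero_iff_ae_notMem.1
      (measure_numDegreeIn_eq_top hτ.measurable hΛ)] with ω hω
    exact propext ⟨fun h => h.1, fun h => ⟨h, hω⟩⟩
  have h3 := kestenLaw_localBall_le h0 h1 hm h t
  rw [← hτ.measure_localBall h t, ← h2] at h3
  have h4 := ENNReal.toReal_mono (ENNReal.mul_ne_top (ENNReal.natCast_ne_top _)
    (measure_ne_top _ _)) h3
  rwa [ENNReal.toReal_mul, ENNReal.toReal_natCast] at h4

end Conditioned

/-! ### The main theorem -/

theorem mainTheorem8 (p : PMF ℕ) (hcrit : offspringMean p = 1) (hp : IsNondegenerate p)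
    (A : Set ℕ) (hA : 0 < ∑' n : A, p n)
    {Ω : Type*} [MeasurableSpace Ω] (P : Measure Ω) [IsProbabilityMeasure P]
    (τ : Ω → PlaneTree) (hτ : IsGWTree p τ P)
    {Ω' : Type*} [MeasurableSpace Ω'] (P' : Measure Ω') [IsProbabilityMeasure P']
    (τstar : Ω' → PlaneTree)
    (hτstar : IsKestenTree p (hcrit ▸ one_ne_zero) (hcrit ▸ ENNReal.one_ne_top) τstar P')
    {Ωₙ : ℕ → Type*} [∀ n, MeasurableSpace (Ωₙ n)] (Pₙ : ∀ n, Measure (Ωₙ n))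
    [∀ n, IsProbabilityMeasure (Pₙ n)]
    (τₙ : ∀ n, Ωₙ n → PlaneTree) (hτₙ : ∀ n, Measurable (τₙ n)) :
    (∃ q : PMF ℕ, IsReducedOffspring A τ P q) ∧
    (∀ q : PMF ℕ, IsReducedOffspring A τ P q →
      (∀ᶠ n : ℕ in atTop, P {ω | (n : ℕ∞) ≤ (τ ω).numDegreeIn A ∧
        (τ ω).numDegreeIn A < ((n + offspringPeriod q : ℕ) : ℕ∞)} ≠ 0) ∧
      (IsConditionedOn τ P (fun n => {ω | (n : ℕ∞) ≤ (τ ω).numDegreeIn A ∧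
          (τ ω).numDegreeIn A < ((n + offspringPeriod q : ℕ) : ℕ∞)}) τₙ Pₙ →
        TendstoInDistribution τₙ atTop τstar Pₙ P')) ∧
    ((∀ n : ℕ, P {ω | (n : ℕ∞) ≤ (τ ω).numDegreeIn A} ≠ 0) ∧
      (IsConditionedOn τ P (fun n => {ω | (n : ℕ∞) ≤ (τ ω).numDegreeIn A}) τₙ Pₙ →
        TendstoInDistribution τₙ atTop τstar Pₙ P')) := by
  have hex := hτ.exists_isReducedOffspring hcrit hp hA
  have hwin : ∀ d n, windowSum d (treeSeries A τ P Set.univ) n =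
      P.real {ω | (n : ℕ∞) ≤ (τ ω).numDegreeIn A ∧
        (τ ω).numDegreeIn A < ((n + d : ℕ) : ℕ∞)} := fun d n => by
    simpa using windowSum_treeSeries (P := P) hτ.measurable A MeasurableSet.univ d n
  have hm1 : ∀ n d : ℕ, MeasurableSet {ω | (n : ℕ∞) ≤ (τ ω).numDegreeIn A ∧
      (τ ω).numDegreeIn A < ((n + d : ℕ) : ℕ∞)} := fun n d => by
    simpa using measurableSet_numDegreeIn A hτ.measurable .univ
      {m | (n : ℕ∞) ≤ m ∧ m < ((n + d : ℕ) : ℕ∞)}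
  have hm2 : ∀ n : ℕ, MeasurableSet {ω | (n : ℕ∞) ≤ (τ ω).numDegreeIn A} := fun n => by
    simpa using measurableSet_numDegreeIn A hτ.measurable .univ {m | (n : ℕ∞) ≤ m}
  have hpos1 : ∀ q : PMF ℕ, IsReducedOffspring A τ P q →
      ∀ᶠ n : ℕ in atTop, P {ω | (n : ℕ∞) ≤ (τ ω).numDegreeIn A ∧
        (τ ω).numDegreeIn A < ((n + offspringPeriod q : ℕ) : ℕ∞)} ≠ 0 := by
    intro q hq
    filter_upwards [(hτ.tendsto_windowSum_treeSeries hA hq).2.2.1] with n hn h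
    rw [hwin, measureReal_def, h] at hn
    simp at hn
  have hpos2 : ∀ n : ℕ, P {ω | (n : ℕ∞) ≤ (τ ω).numDegreeIn A} ≠ 0 := by
    intro n h
    obtain ⟨q, hq⟩ := hex
    obtain ⟨m, hm, hnm⟩ := ((hpos1 q hq).and (eventually_ge_atTop n)).exists
    refine hm (measure_mono_null (fun ω hω => ?_) h)
    exact le_trans (by exact_mod_cast hnm) hω.1
  refine ⟨hex, fun q hq => ⟨hpos1 q hq, fun hc => ?_⟩, hpos2, fun hc => ?_⟩
  · obtain ⟨hΛ, -, hpos, hlim⟩ := hτ.tendsto_windowSum_treeSeries hA hq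
    refine tendstoInDistribution_of_isConditionedOn hτ.measurable (fun n => hm1 n _)
      (hpos1 q hq) (fun h t ε hε => ?_) hτstar hτₙ hc
    filter_upwards [hτ.eventually_kestenLaw_le (h0 := hcrit ▸ one_ne_zero)
      (h1 := hcrit ▸ ENNReal.one_ne_top) hcrit hΛ hpos hlim h t hε] with n hn
    rw [hwin, windowSum_treeSeries hτ.measurable A (PlaneTree.measurableSet_localBall h t)] at hn
    rwa [Set.inter_comm]
  · obtain ⟨q, hq⟩ := hex
    obtain ⟨hΛ, hd, hpos, hlim⟩ := hτ.tendsto_windowSum_treeSeries hA hq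
    refine tendstoInDistribution_of_isConditionedOn hτ.measurable hm2
      (.of_forall hpos2) (fun h t ε hε => ?_) hτstar hτₙ hc
    have hev := hτ.eventually_kestenLaw_le (h0 := hcrit ▸ one_ne_zero)
      (h1 := hcrit ▸ ENNReal.one_ne_top) hcrit hΛ hpos hlim h t hε
    obtain ⟨N, hN⟩ := eventually_atTop.1 hev
    have htop := measure_eq_zero_iff_ae_notMem.1 (measure_numDegreeIn_eq_top hτ.measurable hΛ)
    have hS : ∀ (S : Set PlaneTree) (n : ℕ),
        P {ω | τ ω ∈ S ∧ (n : ℕ∞) ≤ (τ ω).numDegreeIn A ∧ (τ ω).numDegreeIn A ≠ ⊤} =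
          P ({ω | (n : ℕ∞) ≤ (τ ω).numDegreeIn A} ∩ τ ⁻¹' S) := by
      intro S n
      refine measure_congr ?_
      filter_upwards [htop] with ω hω
      exact propext ⟨fun h => ⟨h.2.1, h.1⟩, fun h => ⟨h.2, h.1, hω⟩⟩
    -- The window inequality holds for every starting point beyond `N`, hence for all windows tiling
    -- `[n, ∞)` at once, and can be summed.
    filter_upwards [eventually_ge_atTop N] with n hn
    have h1 := hasSum_windowSum_treeSeries (P := P) hτ.measurable A .univ hd n
    have h2 := hasSum_windowSum_treeSeries (P := P) hτ.measurable A
      (PlaneTree.measurableSet_localBall h t) hd n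
    rw [measureReal_def, hS, ← measureReal_def] at h1 h2
    rw [Set.preimage_univ, Set.inter_univ] at h1
    exact hasSum_le (fun i => hN _ (hn.trans (Nat.le_add_right _ _))) (h1.mul_left _) h2
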